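/- **Setup.** Let $n\ge 1$, with indices in $\mathbb Z/n$. Let $Q$ be the network on the torus with $n$ square faces: the $i$-th face has white lower left and upper right corners, black upper left and lower right corners, and edges $\alpha_i$ (left, upwards), $\beta_i$ (bottom, rightwards), $\gamma_i$ (right, downwards), $\delta_i$ (top, rightwards). An edge $\varepsilon_i$ goes from the upper right corner of face $i$ to the lower left corner of face $i+2$, and an edge $\overline\varepsilon_i$ from the lower right corner of face $i$ to the upper left corner of face $i+1$. Let $\mathcal F_Q$ be the free skew field over $\mathbb Q$ on the edges of $Q$, with the double bracket given on edges by $$\{\!\{\beta_i,\alpha_i\}\!\}=\tfrac12\,\beta_i\otimes\alpha_i,\quad \{\!\{\gamma_i,\varepsilon_i\}\!\}=\tfrac12\,\gamma_i\otimes\varepsilon_i,\quad \{\!\{\beta_i,\gamma_i\}\!\}=\tfrac12\,\gamma_i\otimes\beta_i,\quad \{\!\{\alpha_i,\overline\varepsilon_{i-1}\}\!\}=\tfrac12\,\overline\varepsilon_{i-1}\otimes\alpha_i,$$ by skew-symmetry $\{\!\{g,f\}\!\}=-\{\!\{f,g\}\!\}^\tau$ (where $(p\otimes q)^\tau=q\otimes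 p$), and by zero on all other pairs of edges; it is a derivation in the second argument for the outer bimodule structure. For a double bracket on an algebra $A$ put $\{f,g\}=\mu(\{\!\{f,g\}\!\})$, with $\mu$ the multiplication, and let the induced bracket $\langle f,g\rangle$ be the class of $\{f,g\}$ in $A^\natural=A/[A,A]$, the quotient by the linear span of the commutators. Put $a_i=\alpha_i\overline\varepsilon_{i-1}^{-1}$, $b_i=\beta_i$, $c_i=\varepsilon_i^{-1}\gamma_i$, $d_i=\overline\varepsilon_{i-1}\delta_i\varepsilon_i$, and $z_k=d_1c_1\cdots d_{k-1}c_{k-1}d_k$ for $1\le k\le n$. Reading the index of $z$ cyclically in $\{1,\dots,n\}$, put $$X_i=z_{i-2}\,a_ic_{i-1}^{-1}d_{i-1}^{-1}c_{i-2}^{-1}\,z_{i-2}^{-1},\qquad Y_i=z_{i-2}\,b_ic_i^{-1}d_i^{-1}c_{i-1}^{-1}d_{i-1}^{-1}c_{i-2}^{-1}\,z_{i-2}^{-1},\qquad Z=z_nc_n .$$ Let $\mathscr L_\bullet\subset\mathcal F_Q$ be the group algebra of the free group on $X_1,\dots,X_n,Y_1,\dots,Y_n,Z$ (the algebra of loops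 based at the upper left corner of the first face), and let $\mathscr L^{(1)}_\bullet=\mathscr L_\bullet/\langle Z-1\rangle$, with quotient map $\pi$. The algebra $\mathscr L_\bullet^{(1)}$ is contained in the free skew field $\mathcal F^{(1)}$ on $X_1,\dots,X_n,Y_1,\dots,Y_n$. On $\mathcal F^{(1)}$ take the double bracket whose values on pairs of the generators $X_i$, $Y_i$ are obtained from their double brackets in $\mathcal F_Q$, which lie in $\mathscr L_\bullet\otimes\mathscr L_\bullet$, by setting $Z=1$. The pentagram map $T$ is the following algebra homomorphism. On $\mathscr L_\bullet^{(1)}$, with values in $\mathcal F^{(1)}$, $$T(X_i)=(X_i+Y_i)^{-1}X_i(X_{i+2}+Y_{i+2}),\qquad T(Y_i)=(X_{i+1}+Y_{i+1})^{-1}Y_{i+1}(X_{i+3}+Y_{i+3}).$$ On $\mathscr L_\bullet$, with values in $\mathcal F_Q$, put $\tilde b_i=b_i+a_id_ic_i$, $\tilde a_i=d_ic_i\tilde b_i^{-1}$, $\tilde c_i=\tilde b_i^{-1}a_id_i$, $\tilde d_i=\tilde a_ib_ic_i^{-1}$ and $\xi_k=\tilde a_1\tilde b_1\cdots\tilde a_k\tilde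 b_k$; then $T(Z)=Z$ and, for $1\le i\le n$, $$T(X_i)=\xi_i\,\tilde c_i\tilde a_{i+2}^{-1}\tilde b_{i+1}^{-1}\tilde a_{i+1}^{-1}\,\xi_i^{-1},\qquad T(Y_i)=\xi_i\,\tilde d_{i+1}\tilde a_{i+3}^{-1}\tilde b_{i+2}^{-1}\tilde a_{i+2}^{-1}\tilde b_{i+1}^{-1}\tilde a_{i+1}^{-1}\,\xi_i^{-1}.$$ Let $S$ shift the indices, $X_i\mapsto X_{i-1}$, $Y_i\mapsto Y_{i-1}$, $Z\mapsto Z$, cyclically; thus $S^2\circ T$ denotes the algebra homomorphism $\mathscr L_\bullet\to\mathcal F_Q$ with $X_i\mapsto T(X_{i-2})$, $Y_i\mapsto T(Y_{i-2})$, $Z\mapsto Z$, where $i-2$ is read in $\{1,\dots,n\}$ modulo $n$. **Theorem.** For all $f,g\in\mathscr L_\bullet$ the element $h=\{f,g\}$ lies in $\mathscr L_\bullet$, and: (a) In $\mathscr L^{(1)}_\bullet$ the induced bracket is the image of the induced bracket of $\mathscr L_\bullet$, and it is invariant under the pentagram map: in $(\mathcal F^{(1)})^\natural$, $$\langle\pi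 f,\pi g\rangle=(\pi h)^\natural,\qquad \langle T(\pi f),T(\pi g)\rangle=\big(T(\pi h)\big)^\natural .$$ (b) In $\mathscr L_\bullet$ the induced bracket is invariant under $\widehat T=S^2\circ T$: in $\mathcal F_Q^\natural$, $$\langle\widehat T f,\widehat T g\rangle=(\widehat T h)^\natural .$$ In particular, the images of the generators satisfy the same induced bracket relations as the generators themselves. -/

import Mathlib

open scoped TensorProduct

noncomputable section

/-! ### Double brackets and cyclic spaces -/

section DoubleBrackets

variable {A : Type} [Ring A] [Algebra ℚ A]

/-- A double bracket on a `ℚ`-algebra `A`: a bilinear map `A × A → A ⊗ A` which is a derivation in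
the second argument for the outer bimodule structure, and skew up to exchanging the two tensor
factors. -/
structure IsDoubleBracket (D : A →ₗ[ℚ] A →ₗ[ℚ] A ⊗[ℚ] A) : Prop where
  leibniz : ∀ a b c : A,
    D a (b * c) = D a b * ((1 : A) ⊗ₜ[ℚ] c) + (b ⊗ₜ[ℚ] (1 : A)) * D a c
  skew : ∀ a b : A, D b a = -TensorProduct.comm ℚ A A (D a b)

/-- The cyclic space `A / [A, A]`, the quotient by the linear span of all commutators. -/
abbrev CyclicSpace (A : Type) [Ring A] [Algebra ℚ A] : Type :=
  A ⧸ Submodule.span ℚ {x : A | ∃ a b : A, x = a * b - b * a}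

/-- The class of an element of `A` in the cyclic space. -/
def cyclicClass : A →ₗ[ℚ] CyclicSpace A :=
  Submodule.mkQ _

/-- The single bracket `{a, b} = μ (D a b)`, where `μ` is the multiplication of `A`. -/
def singleBracket (D : A →ₗ[ℚ] A →ₗ[ℚ] A ⊗[ℚ] A) (a b : A) : A :=
  LinearMap.mul' ℚ A (D a b)

/-- The induced bracket `⟨a, b⟩`, the class of `{a, b}` in the cyclic space. -/
def inducedBracket (D : A →ₗ[ℚ] A →ₗ[ℚ] A ⊗[ℚ] A) (a b : A) : CyclicSpace A :=
  cyclicClass (singleBracket D a b)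

/-- For `x` in `A ⊗ A`, the linear map `(p ⊗ q) ⊗ (r ⊗ s) ↦ (r ⊗ p) x (q ⊗ s)`. -/
def sandwich (x : A ⊗[ℚ] A) : (A ⊗[ℚ] A) ⊗[ℚ] (A ⊗[ℚ] A) →ₗ[ℚ] A ⊗[ℚ] A :=
  LinearMap.mul' ℚ (A ⊗[ℚ] A) ∘ₗ
    TensorProduct.map
      (LinearMap.mulRight ℚ x ∘ₗ (TensorProduct.comm ℚ A A).toLinearMap) LinearMap.id ∘ₗ
    (TensorProduct.tensorTensorTensorComm ℚ A A A A).toLinearMap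

theorem sandwich_tmul (x : A ⊗[ℚ] A) (p q r s : A) :
    sandwich x ((p ⊗ₜ[ℚ] q) ⊗ₜ[ℚ] (r ⊗ₜ[ℚ] s)) = (r ⊗ₜ[ℚ] p) * x * (q ⊗ₜ[ℚ] s) := by
  simp [sandwich]

/-- The Leibniz expansion: given the outer derivations `dv v` with `dv v w = δ_{v w} 1 ⊗ 1` on
generators, and the values `t u v` of the double bracket on generators, this is the double bracket
with these values. On monomials it is
`⦃f, g⦄ = ∑_{i, j} (g₁ ⋯ g_{j-1} ⊗ f₁ ⋯ f_{i-1}) ⦃f_i, g_j⦄ (f_{i+1} ⋯ f_k ⊗ g_{j+1} ⋯ g_l)`. -/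
def leibnizExpansion {V : Type} [Fintype V] (dv : V → A →ₗ[ℚ] A ⊗[ℚ] A)
    (t : V → V → A ⊗[ℚ] A) : A →ₗ[ℚ] A →ₗ[ℚ] A ⊗[ℚ] A :=
  ∑ u : V, ∑ v : V,
    ((TensorProduct.mk ℚ (A ⊗[ℚ] A) (A ⊗[ℚ] A)).compl₁₂ (dv u) (dv v)).compr₂ (sandwich (t u v))

theorem leibnizExpansion_apply {V : Type} [Fintype V] (dv : V → A →ₗ[ℚ] A ⊗[ℚ] A)
    (t : V → V → A ⊗[ℚ] A) (f g : A) :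
    leibnizExpansion dv t f g = ∑ u : V, ∑ v : V, sandwich (t u v) (dv u f ⊗ₜ[ℚ] dv v g) := by
  simp [leibnizExpansion, LinearMap.sum_apply]

theorem sandwich_mul_right (x w w' : A ⊗[ℚ] A) (c : A) :
    sandwich x (w ⊗ₜ[ℚ] (w' * ((1 : A) ⊗ₜ[ℚ] c))) =
      sandwich x (w ⊗ₜ[ℚ] w') * ((1 : A) ⊗ₜ[ℚ] c) := by
  induction w using TensorProduct.induction_on with
  | zero => simp
  | add a b ha hb => simp only [TensorProduct.add_tmul, map_add, add_mul, ha, hb]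
  | tmul p q =>
    induction w' using TensorProduct.induction_on with
    | zero => simp
    | add a b ha hb => simp only [TensorProduct.tmul_add, map_add, add_mul, ha, hb]
    | tmul r s =>
      simp [Algebra.TensorProduct.tmul_mul_tmul, sandwich_tmul, mul_assoc]

theorem sandwich_mul_left (x w w' : A ⊗[ℚ] A) (b : A) :
    sandwich x (w ⊗ₜ[ℚ] ((b ⊗ₜ[ℚ] (1 : A)) * w')) =
      (b ⊗ₜ[ℚ] (1 : A)) * sandwich x (w ⊗ₜ[ℚ] w') := by
  induction w using TensorProduct.induction_on with
  | zero => simp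
  | add a b ha hb => simp only [TensorProduct.add_tmul, map_add, mul_add, ha, hb]
  | tmul p q =>
    induction w' using TensorProduct.induction_on with
    | zero => simp
    | add a b ha hb => simp only [TensorProduct.tmul_add, map_add, mul_add, ha, hb]
    | tmul r s =>
      simp only [Algebra.TensorProduct.tmul_mul_tmul, sandwich_tmul, ← mul_assoc, one_mul]

theorem comm_mul (x y : A ⊗[ℚ] A) :
    TensorProduct.comm ℚ A A (x * y) = TensorProduct.comm ℚ A A x * TensorProduct.comm ℚ A A y :=
  map_mul (Algebra.TensorProduct.comm ℚ A A) x y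

theorem comm_sandwich (x w w' : A ⊗[ℚ] A) :
    TensorProduct.comm ℚ A A (sandwich x (w ⊗ₜ[ℚ] w')) =
      sandwich (TensorProduct.comm ℚ A A x) (w' ⊗ₜ[ℚ] w) := by
  induction w using TensorProduct.induction_on with
  | zero => simp
  | add a b ha hb => simp only [TensorProduct.add_tmul, TensorProduct.tmul_add, map_add, ha, hb]
  | tmul p q =>
    induction w' using TensorProduct.induction_on with
    | zero => simp
    | add a b ha hb => simp only [TensorProduct.add_tmul, TensorProduct.tmul_add, map_add, ha, hb]
    | tmul r s => simp [sandwich_tmul, comm_mul]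

theorem sandwich_neg (x : A ⊗[ℚ] A) (w : (A ⊗[ℚ] A) ⊗[ℚ] (A ⊗[ℚ] A)) :
    sandwich (-x) w = -sandwich x w := by
  induction w using TensorProduct.induction_on with
  | zero => simp
  | add a b ha hb => simp only [map_add, ha, hb]; abel
  | tmul w w' =>
    induction w using TensorProduct.induction_on with
    | zero => simp
    | add a b ha hb => simp only [TensorProduct.add_tmul, map_add, ha, hb]; abel
    | tmul p q =>
      induction w' using TensorProduct.induction_on with
      | zero => simp
      | add a b ha hb => simp only [TensorProduct.tmul_add, map_add, ha, hb]; abel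
      | tmul r s => simp [sandwich_tmul]

theorem leibnizExpansion_isDoubleBracket {V : Type} [Fintype V]
    (dv : V → A →ₗ[ℚ] A ⊗[ℚ] A) (t : V → V → A ⊗[ℚ] A)
    (hdv : ∀ v a b, dv v (a * b) =
      dv v a * ((1 : A) ⊗ₜ[ℚ] b) + (a ⊗ₜ[ℚ] (1 : A)) * dv v b)
    (ht : ∀ u v, t v u = -TensorProduct.comm ℚ A A (t u v)) :
    IsDoubleBracket (leibnizExpansion dv t) where
  leibniz a b c := by
    simp only [leibnizExpansion_apply, hdv, TensorProduct.tmul_add, map_add, sandwich_mul_right,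
      sandwich_mul_left, Finset.sum_add_distrib, Finset.sum_mul, Finset.mul_sum]
  skew a b := by
    simp only [leibnizExpansion_apply, map_sum, comm_sandwich, ← Finset.sum_neg_distrib]
    rw [Finset.sum_comm]
    refine Finset.sum_congr rfl fun u _ => Finset.sum_congr rfl fun v _ => ?_
    rw [ht u v, sandwich_neg]

end DoubleBrackets

/-! ### Upper triangular matrices over `A ⊗ A`

A linear map `δ : A → A ⊗ A` is a derivation for the outer bimodule structure iff
`a ↦ !![a ⊗ 1, δ a; 0, 1 ⊗ a]` is multiplicative. -/

section Triangular

variable {E : Type} [Ring E]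

/-- The `k × k` matrix of upper triangular `2 × 2` matrices with blocks `P`, `N`, `R`. -/
def triMatrix {k : ℕ} (P N R : Matrix (Fin k) (Fin k) E) :
    Matrix (Fin k) (Fin k) (Matrix (Fin 2) (Fin 2) E) :=
  Matrix.of fun i j => !![P i j, N i j; 0, R i j]

theorem triMatrix_mul {k : ℕ} (P N R P' N' R' : Matrix (Fin k) (Fin k) E) :
    triMatrix P N R * triMatrix P' N' R' =
      triMatrix (P * P') (P * N' + N * R') (R * R') := by
  ext i j a b
  fin_cases a <;> fin_cases b <;>
    simp [triMatrix, Matrix.mul_apply, Matrix.sum_apply, Finset.sum_add_distrib]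

theorem triMatrix_one {k : ℕ} : triMatrix (1 : Matrix (Fin k) (Fin k) E) 0 1 = 1 := by
  ext i j a b
  by_cases h : i = j
  · subst h
    fin_cases a <;> fin_cases b <;> simp [triMatrix]
  · fin_cases a <;> fin_cases b <;> simp [triMatrix, h]

end Triangular

/-! ### The free skew field -/

section FreeSkewField

/-- A square matrix is full if it is not a product of a `k × r` and an `r × k` matrix with
`r < k`. -/
def IsFullMatrix {R : Type} [Ring R] {k : ℕ} (M : Matrix (Fin k) (Fin k) R) : Prop :=
  ∀ r : ℕ, r < k → ∀ (B : Matrix (Fin k) (Fin r) R) (C : Matrix (Fin r) (Fin k) R), B * C ≠ M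

/-- Generators of the free skew field: the variables, and the entries of formal inverses of all
full square matrices over the free algebra. -/
inductive SkewFieldGen (V : Type) : Type
  | var (v : V) : SkewFieldGen V
  | inv (k : ℕ) (M : Matrix (Fin k) (Fin k) (FreeAlgebra ℚ V)) (hM : IsFullMatrix M)
      (i j : Fin k) : SkewFieldGen V

/-- The inclusion of the free algebra on the variables into the free algebra on all generators. -/
def varHom (V : Type) : FreeAlgebra ℚ V →ₐ[ℚ] FreeAlgebra ℚ (SkewFieldGen V) :=
  FreeAlgebra.lift ℚ fun v => FreeAlgebra.ι ℚ (SkewFieldGen.var v)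

/-- The relations `M * M⁻¹ = 1` and `M⁻¹ * M = 1` for all full matrices `M`. -/
inductive SkewFieldRel (V : Type) :
    FreeAlgebra ℚ (SkewFieldGen V) → FreeAlgebra ℚ (SkewFieldGen V) → Prop
  | mul_inv (k : ℕ) (M : Matrix (Fin k) (Fin k) (FreeAlgebra ℚ V)) (hM : IsFullMatrix M)
      (i j : Fin k) :
      SkewFieldRel V
        (∑ l : Fin k, varHom V (M i l) * FreeAlgebra.ι ℚ (SkewFieldGen.inv k M hM l j))
        ((1 : Matrix (Fin k) (Fin k) (FreeAlgebra ℚ (SkewFieldGen V))) i j)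
  | inv_mul (k : ℕ) (M : Matrix (Fin k) (Fin k) (FreeAlgebra ℚ V)) (hM : IsFullMatrix M)
      (i j : Fin k) :
      SkewFieldRel V
        (∑ l : Fin k, FreeAlgebra.ι ℚ (SkewFieldGen.inv k M hM i l) * varHom V (M l j))
        ((1 : Matrix (Fin k) (Fin k) (FreeAlgebra ℚ (SkewFieldGen V))) i j)

/-- The free skew field over `ℚ` on a set `V` of variables (the universal field of fractions of
`ℚ⟨V⟩`), in Cohn's construction: the universal localization of the free algebra `ℚ⟨V⟩` at the set
of all full square matrices. -/
def FreeSkewField (V : Type) : Type :=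
  RingQuot (SkewFieldRel V)

instance (V : Type) : Ring (FreeSkewField V) :=
  inferInstanceAs (Ring (RingQuot (SkewFieldRel V)))

instance (V : Type) : Algebra ℚ (FreeSkewField V) :=
  inferInstanceAs (Algebra ℚ (RingQuot (SkewFieldRel V)))

namespace FreeSkewField

variable {V : Type}

/-- The quotient map. -/
def mk (V : Type) : FreeAlgebra ℚ (SkewFieldGen V) →ₐ[ℚ] FreeSkewField V :=
  RingQuot.mkAlgHom ℚ (SkewFieldRel V)

/-- The embedding of the free algebra into the free skew field. -/
def ofFree (V : Type) : FreeAlgebra ℚ V →ₐ[ℚ] FreeSkewField V :=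
  (mk V).comp (varHom V)

/-- A variable, as an element of the free skew field. -/
def var (v : V) : FreeSkewField V :=
  ofFree V (FreeAlgebra.ι ℚ v)

/-- The inverse of a full matrix, over the free skew field. -/
def invMatrix (k : ℕ) (M : Matrix (Fin k) (Fin k) (FreeAlgebra ℚ V)) (hM : IsFullMatrix M) :
    Matrix (Fin k) (Fin k) (FreeSkewField V) :=
  Matrix.of fun i j => mk V (FreeAlgebra.ι ℚ (SkewFieldGen.inv k M hM i j))

theorem map_mul_invMatrix (k : ℕ) (M : Matrix (Fin k) (Fin k) (FreeAlgebra ℚ V))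
    (hM : IsFullMatrix M) : M.map (ofFree V) * invMatrix k M hM = 1 := by
  ext i j
  have h := RingQuot.mkAlgHom_rel ℚ (SkewFieldRel.mul_inv k M hM i j)
  change mk V _ = mk V _ at h
  rw [map_sum] at h
  simp only [map_mul] at h
  rw [Matrix.mul_apply]
  refine h.trans ?_
  by_cases hij : i = j
  · subst hij; simp
  · simp [hij]

theorem invMatrix_mul_map (k : ℕ) (M : Matrix (Fin k) (Fin k) (FreeAlgebra ℚ V))
    (hM : IsFullMatrix M) : invMatrix k M hM * M.map (ofFree V) = 1 := by
  ext i j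
  have h := RingQuot.mkAlgHom_rel ℚ (SkewFieldRel.inv_mul k M hM i j)
  change mk V _ = mk V _ at h
  rw [map_sum] at h
  simp only [map_mul] at h
  rw [Matrix.mul_apply]
  refine h.trans ?_
  by_cases hij : i = j
  · subst hij; simp
  · simp [hij]

/-- The universal property: a homomorphism from the free algebra, with given inverses of the images
of all full matrices, extends to the free skew field. -/
def lift {R : Type} [Ring R] [Algebra ℚ R] (φ : FreeAlgebra ℚ V →ₐ[ℚ] R)
    (J : ∀ (k : ℕ) (M : Matrix (Fin k) (Fin k) (FreeAlgebra ℚ V)), IsFullMatrix M →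
      Matrix (Fin k) (Fin k) R)
    (h₁ : ∀ k M hM, M.map φ * J k M hM = 1) (h₂ : ∀ k M hM, J k M hM * M.map φ = 1) :
    FreeSkewField V →ₐ[ℚ] R :=
  RingQuot.liftAlgHom ℚ (s := SkewFieldRel V)
    ⟨FreeAlgebra.lift ℚ fun x => match x with
        | SkewFieldGen.var v => φ (FreeAlgebra.ι ℚ v)
        | SkewFieldGen.inv k M hM i j => J k M hM i j, by
      have key : ∀ p : FreeAlgebra ℚ V,
          (FreeAlgebra.lift ℚ fun x => match x with
            | SkewFieldGen.var v => φ (FreeAlgebra.ι ℚ v)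
            | SkewFieldGen.inv k M hM i j => J k M hM i j) (varHom V p) = φ p := by
        intro p
        rw [← AlgHom.comp_apply]
        congr 1
        ext v
        simp [varHom]
      intro x y hxy
      cases hxy with
      | mul_inv k M hM i j =>
        have h := congrFun (congrFun (h₁ k M hM) i) j
        rw [Matrix.mul_apply] at h
        simp only [map_sum, map_mul, key, FreeAlgebra.lift_ι_apply]
        refine Eq.trans h ?_
        by_cases hij : i = j
        · subst hij; simp
        · simp [hij]
      | inv_mul k M hM i j =>
        have h := congrFun (congrFun (h₂ k M hM) i) j
        rw [Matrix.mul_apply] at h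
        simp only [map_sum, map_mul, key, FreeAlgebra.lift_ι_apply]
        refine Eq.trans h ?_
        by_cases hij : i = j
        · subst hij; simp
        · simp [hij]⟩

theorem lift_mk {R : Type} [Ring R] [Algebra ℚ R] (φ : FreeAlgebra ℚ V →ₐ[ℚ] R)
    (J : ∀ (k : ℕ) (M : Matrix (Fin k) (Fin k) (FreeAlgebra ℚ V)), IsFullMatrix M →
      Matrix (Fin k) (Fin k) R)
    (h₁ : ∀ k M hM, M.map φ * J k M hM = 1) (h₂ : ∀ k M hM, J k M hM * M.map φ = 1)
    (p : FreeAlgebra ℚ (SkewFieldGen V)) :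
    lift φ J h₁ h₂ (mk V p) = FreeAlgebra.lift ℚ (fun x => match x with
        | SkewFieldGen.var v => φ (FreeAlgebra.ι ℚ v)
        | SkewFieldGen.inv k M hM i j => J k M hM i j) p := by
  unfold lift mk
  exact RingQuot.liftAlgHom_mkAlgHom_apply _ _ _ _

theorem isFullMatrix_single {p : FreeAlgebra ℚ V} (hp : p ≠ 0) :
    IsFullMatrix (Matrix.of fun _ _ : Fin 1 => p) := by
  intro r hr B C h
  obtain rfl : r = 0 := by omega
  have h' := congrFun (congrFun h 0) 0
  simp [Matrix.mul_apply] at h'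
  exact hp h'.symm

/-- A nonzero element of the free algebra, as an invertible element of the free skew field. -/
def unitOfFree (p : FreeAlgebra ℚ V) (hp : p ≠ 0) : (FreeSkewField V)ˣ where
  val := ofFree V p
  inv := invMatrix 1 (Matrix.of fun _ _ => p) (isFullMatrix_single hp) 0 0
  val_inv := by
    have h := congrFun (congrFun
      (map_mul_invMatrix 1 (Matrix.of fun _ _ => p) (isFullMatrix_single hp)) 0) 0
    simpa [Matrix.mul_apply] using h
  inv_val := by
    have h := congrFun (congrFun
      (invMatrix_mul_map 1 (Matrix.of fun _ _ => p) (isFullMatrix_single hp)) 0) 0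
    simpa [Matrix.mul_apply] using h

/-- A variable, as an invertible element of the free skew field. -/
def varUnit (v : V) : (FreeSkewField V)ˣ :=
  unitOfFree (FreeAlgebra.ι ℚ v) (FreeAlgebra.ι_ne_zero v)

theorem map_left_mul {k : ℕ} (P Q : Matrix (Fin k) (Fin k) (FreeSkewField V)) :
    (P.map fun a => a ⊗ₜ[ℚ] (1 : FreeSkewField V)) * (Q.map fun a => a ⊗ₜ[ℚ] 1) =
      (P * Q).map fun a => a ⊗ₜ[ℚ] 1 := by
  ext i j
  simp [Matrix.mul_apply, TensorProduct.sum_tmul]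

theorem map_right_mul {k : ℕ} (P Q : Matrix (Fin k) (Fin k) (FreeSkewField V)) :
    (P.map fun a => (1 : FreeSkewField V) ⊗ₜ[ℚ] a) * (Q.map fun a => 1 ⊗ₜ[ℚ] a) =
      (P * Q).map fun a => 1 ⊗ₜ[ℚ] a := by
  ext i j
  simp [Matrix.mul_apply, TensorProduct.tmul_sum]

theorem map_left_one {k : ℕ} :
    ((1 : Matrix (Fin k) (Fin k) (FreeSkewField V)).map fun a =>
      a ⊗ₜ[ℚ] (1 : FreeSkewField V)) = 1 := by
  ext i j
  by_cases h : i = j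
  · subst h; simp [Algebra.TensorProduct.one_def]
  · simp [h]

theorem map_right_one {k : ℕ} :
    ((1 : Matrix (Fin k) (Fin k) (FreeSkewField V)).map fun a =>
      (1 : FreeSkewField V) ⊗ₜ[ℚ] a) = 1 := by
  ext i j
  by_cases h : i = j
  · subst h; simp [Algebra.TensorProduct.one_def]
  · simp [h]

theorem algebraMap_tmul_one {A : Type} [Ring A] [Algebra ℚ A] (r : ℚ) :
    algebraMap ℚ A r ⊗ₜ[ℚ] (1 : A) = (1 : A) ⊗ₜ[ℚ] algebraMap ℚ A r := by
  rw [Algebra.algebraMap_eq_smul_one, TensorProduct.smul_tmul]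

section Partial

variable [DecidableEq V]

/-- On the free algebra, `p ↦ !![p ⊗ 1, ∂ᵥ p; 0, 1 ⊗ p]`, where `∂ᵥ` is the outer derivation with
`∂ᵥ v = 1 ⊗ 1` which kills the other variables. -/
def foxFree (v : V) : FreeAlgebra ℚ V →ₐ[ℚ]
    Matrix (Fin 2) (Fin 2) (FreeSkewField V ⊗[ℚ] FreeSkewField V) :=
  FreeAlgebra.lift ℚ fun w =>
    !![var w ⊗ₜ[ℚ] 1, if w = v then 1 else 0; 0, 1 ⊗ₜ[ℚ] var w]

theorem foxFree_eq (v : V) (p : FreeAlgebra ℚ V) :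
    foxFree v p = !![ofFree V p ⊗ₜ[ℚ] 1, foxFree v p 0 1; 0, 1 ⊗ₜ[ℚ] ofFree V p] := by
  induction p using FreeAlgebra.induction with
  | grade0 r =>
    ext a b
    fin_cases a <;> fin_cases b <;>
      simp [Matrix.algebraMap_matrix_apply, Algebra.TensorProduct.algebraMap_apply,
        algebraMap_tmul_one]
  | grade1 w =>
    simp [foxFree, var]
  | add p q hp hq =>
    rw [map_add, hp, hq]
    ext a b
    fin_cases a <;> fin_cases b <;> simp [TensorProduct.add_tmul, TensorProduct.tmul_add]
  | mul p q hp hq =>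
    rw [map_mul, hp, hq]
    ext a b
    fin_cases a <;> fin_cases b <;> simp [Matrix.mul_apply, Fin.sum_univ_two]

/-- The inverse of the image of a full matrix. -/
def foxInv (v : V) (k : ℕ) (M : Matrix (Fin k) (Fin k) (FreeAlgebra ℚ V))
    (hM : IsFullMatrix M) : Matrix (Fin k) (Fin k)
      (Matrix (Fin 2) (Fin 2) (FreeSkewField V ⊗[ℚ] FreeSkewField V)) :=
  triMatrix ((invMatrix k M hM).map fun a => a ⊗ₜ[ℚ] 1)
    (-((invMatrix k M hM).map (fun a => a ⊗ₜ[ℚ] 1) * (M.map fun p => foxFree v p 0 1) *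
      (invMatrix k M hM).map fun a => 1 ⊗ₜ[ℚ] a))
    ((invMatrix k M hM).map fun a => 1 ⊗ₜ[ℚ] a)

theorem map_foxFree (v : V) (k : ℕ) (M : Matrix (Fin k) (Fin k) (FreeAlgebra ℚ V)) :
    M.map (foxFree v) = triMatrix ((M.map (ofFree V)).map fun a => a ⊗ₜ[ℚ] 1)
      (M.map fun p => foxFree v p 0 1) ((M.map (ofFree V)).map fun a => 1 ⊗ₜ[ℚ] a) := by
  ext i j : 2
  rw [Matrix.map_apply, foxFree_eq]
  simp [triMatrix]

theorem map_mul_foxInv (v : V) (k : ℕ) (M : Matrix (Fin k) (Fin k) (FreeAlgebra ℚ V))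
    (hM : IsFullMatrix M) : M.map (foxFree v) * foxInv v k M hM = 1 := by
  rw [map_foxFree, foxInv, triMatrix_mul, map_left_mul, map_right_mul, map_mul_invMatrix,
    map_left_one, map_right_one, mul_neg, ← mul_assoc, ← mul_assoc, map_left_mul,
    map_mul_invMatrix, map_left_one, one_mul, neg_add_cancel, triMatrix_one]

theorem foxInv_mul_map (v : V) (k : ℕ) (M : Matrix (Fin k) (Fin k) (FreeAlgebra ℚ V))
    (hM : IsFullMatrix M) : foxInv v k M hM * M.map (foxFree v) = 1 := by
  rw [map_foxFree, foxInv, triMatrix_mul, map_left_mul, map_right_mul, invMatrix_mul_map,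
    map_left_one, map_right_one, neg_mul, mul_assoc, map_right_mul,
    invMatrix_mul_map, map_right_one, mul_one, add_neg_cancel, triMatrix_one]

/-- The homomorphism `a ↦ !![a ⊗ 1, ∂ᵥ a; 0, 1 ⊗ a]` on the free skew field. -/
def fox (v : V) : FreeSkewField V →ₐ[ℚ]
    Matrix (Fin 2) (Fin 2) (FreeSkewField V ⊗[ℚ] FreeSkewField V) :=
  lift (foxFree v) (foxInv v) (map_mul_foxInv v) (foxInv_mul_map v)

/-- The outer derivation `∂ᵥ : a ↦ ∂ᵥ a` of the free skew field with values in its tensor square,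
with `∂ᵥ v = 1 ⊗ 1` and `∂ᵥ w = 0` for the other variables. -/
def partialDer (v : V) :
    FreeSkewField V →ₗ[ℚ] FreeSkewField V ⊗[ℚ] FreeSkewField V where
  toFun a := fox v a 0 1
  map_add' a b := by simp
  map_smul' r a := by simp

theorem fox_eq (v : V) (a : FreeSkewField V) :
    fox v a = !![a ⊗ₜ[ℚ] 1, partialDer v a; 0, 1 ⊗ₜ[ℚ] a] := by
  obtain ⟨p, rfl⟩ : ∃ p, mk V p = a := RingQuot.mkAlgHom_surjective ℚ (SkewFieldRel V) a
  change fox v (mk V p) = !![mk V p ⊗ₜ[ℚ] 1, fox v (mk V p) 0 1; 0, 1 ⊗ₜ[ℚ] mk V p]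
  induction p using FreeAlgebra.induction with
  | grade0 r =>
    rw [AlgHom.commutes, AlgHom.commutes]
    ext a b
    fin_cases a <;> fin_cases b <;>
      simp [Matrix.algebraMap_matrix_apply, Algebra.TensorProduct.algebraMap_apply,
        algebraMap_tmul_one]
  | grade1 w =>
    cases w with
    | var w =>
      have h : mk V (FreeAlgebra.ι ℚ (SkewFieldGen.var w)) = ofFree V (FreeAlgebra.ι ℚ w) := by
        simp [ofFree, varHom]
      have h' : fox v (ofFree V (FreeAlgebra.ι ℚ w)) = foxFree v (FreeAlgebra.ι ℚ w) := by
        rw [← h, fox, lift_mk]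
        simp
      rw [h, h']
      exact foxFree_eq v _
    | inv k M hM i j =>
      have h' : fox v (mk V (FreeAlgebra.ι ℚ (SkewFieldGen.inv k M hM i j))) =
          foxInv v k M hM i j := by
        rw [fox, lift_mk]
        simp
      rw [h']
      simp [foxInv, triMatrix, invMatrix]
  | add p q hp hq =>
    rw [map_add, map_add, hp, hq]
    ext a b
    fin_cases a <;> fin_cases b <;> simp [TensorProduct.add_tmul, TensorProduct.tmul_add]
  | mul p q hp hq =>
    rw [map_mul, map_mul, hp, hq]
    ext a b
    fin_cases a <;> fin_cases b <;> simp [Matrix.mul_apply, Fin.sum_univ_two]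

theorem partialDer_mul (v : V) (a b : FreeSkewField V) :
    partialDer v (a * b) = partialDer v a * (1 ⊗ₜ[ℚ] b) + (a ⊗ₜ[ℚ] 1) * partialDer v b := by
  have h : fox v (a * b) 0 1 = (fox v a * fox v b) 0 1 := by rw [map_mul]
  rw [fox_eq v a, fox_eq v b] at h
  change fox v (a * b) 0 1 = _
  rw [h]
  simp [Matrix.mul_apply, Fin.sum_univ_two, add_comm]

theorem partialDer_var (v w : V) : partialDer v (var w) = if w = v then 1 else 0 := by
  have h : var w = mk V (FreeAlgebra.ι ℚ (SkewFieldGen.var w)) := by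
    simp [var, ofFree, varHom]
  change fox v (var w) 0 1 = _
  rw [h, fox, lift_mk]
  simp [foxFree]

variable [Fintype V]

/-- The double bracket on the free skew field with prescribed values `t u v` on the variables. -/
def bracket (t : V → V → FreeSkewField V ⊗[ℚ] FreeSkewField V) :
    FreeSkewField V →ₗ[ℚ] FreeSkewField V →ₗ[ℚ] FreeSkewField V ⊗[ℚ] FreeSkewField V :=
  leibnizExpansion partialDer t

theorem bracket_var (t : V → V → FreeSkewField V ⊗[ℚ] FreeSkewField V) (u v : V) :
    bracket t (var u) (var v) = t u v := by
  have hs : ∀ x : FreeSkewField V ⊗[ℚ] FreeSkewField V, sandwich x (1 ⊗ₜ[ℚ] 1) = x := by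
    intro x
    rw [Algebra.TensorProduct.one_def, sandwich_tmul, ← Algebra.TensorProduct.one_def, one_mul,
      mul_one]
  rw [bracket, leibnizExpansion_apply, Finset.sum_eq_single u, Finset.sum_eq_single v]
  · simp [partialDer_var, hs]
  · intro b _ hb
    simp [partialDer_var, Ne.symm hb]
  · simp
  · intro b _ hb
    simp [partialDer_var, Ne.symm hb]
  · simp

theorem bracket_isDoubleBracket (t : V → V → FreeSkewField V ⊗[ℚ] FreeSkewField V)
    (ht : ∀ u v, t v u = -TensorProduct.comm ℚ _ _ (t u v)) : IsDoubleBracket (bracket t) :=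
  leibnizExpansion_isDoubleBracket partialDer t partialDer_mul ht

end Partial

end FreeSkewField

end FreeSkewField

/-! ### The group algebra of a free group -/

section FreeGroupAlgebra

/-- The algebra homomorphism from the group algebra of a free group with prescribed invertible
images of the generators. -/
def evalGroupAlgebra {V R : Type} [Ring R] [Algebra ℚ R] (w : V → Rˣ) :
    MonoidAlgebra ℚ (FreeGroup V) →ₐ[ℚ] R :=
  MonoidAlgebra.lift ℚ R (FreeGroup V) ((Units.coeHom R).comp (FreeGroup.lift w))

/-- An element of a group, as an invertible element of the group algebra. -/
def groupUnit {G : Type} [Group G] (g : G) : (MonoidAlgebra ℚ G)ˣ :=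
  Units.map (MonoidAlgebra.of ℚ G) (toUnits g)

/-- The invertible upper triangular matrix `!![x ⊗ 1, d; 0, 1 ⊗ x]`. -/
def triUnit {A : Type} [Ring A] [Algebra ℚ A] (x : Aˣ) (d : A ⊗[ℚ] A) :
    (Matrix (Fin 2) (Fin 2) (A ⊗[ℚ] A))ˣ where
  val := !![(x : A) ⊗ₜ[ℚ] 1, d; 0, 1 ⊗ₜ[ℚ] (x : A)]
  inv := !![((x⁻¹ : Aˣ) : A) ⊗ₜ[ℚ] 1,
    -((((x⁻¹ : Aˣ) : A) ⊗ₜ[ℚ] 1) * d * (1 ⊗ₜ[ℚ] ((x⁻¹ : Aˣ) : A)));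
    0, 1 ⊗ₜ[ℚ] ((x⁻¹ : Aˣ) : A)]
  val_inv := by
    ext a b
    fin_cases a <;> fin_cases b <;>
      simp [Matrix.mul_apply, Fin.sum_univ_two, ← mul_assoc, Algebra.TensorProduct.one_def]
    simp [← Algebra.TensorProduct.one_def]
  inv_val := by
    ext a b
    fin_cases a <;> fin_cases b <;>
      simp [Matrix.mul_apply, Fin.sum_univ_two, mul_assoc, Algebra.TensorProduct.one_def]
    simp [← Algebra.TensorProduct.one_def]

variable {V : Type} [DecidableEq V]

/-- The homomorphism `a ↦ !![a ⊗ 1, ∂ᵥ a; 0, 1 ⊗ a]` on the group algebra of a free group. -/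
def groupFox (v : V) : MonoidAlgebra ℚ (FreeGroup V) →ₐ[ℚ] Matrix (Fin 2) (Fin 2)
    (MonoidAlgebra ℚ (FreeGroup V) ⊗[ℚ] MonoidAlgebra ℚ (FreeGroup V)) :=
  evalGroupAlgebra fun w => triUnit (groupUnit (FreeGroup.of w)) (if w = v then 1 else 0)

/-- The outer derivation `∂ᵥ` of the group algebra of a free group with values in its tensor square,
with `∂ᵥ v = 1 ⊗ 1` and `∂ᵥ w = 0` for the other generators. -/
def groupPartialDer (v : V) : MonoidAlgebra ℚ (FreeGroup V) →ₗ[ℚ]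
    MonoidAlgebra ℚ (FreeGroup V) ⊗[ℚ] MonoidAlgebra ℚ (FreeGroup V) where
  toFun a := groupFox v a 0 1
  map_add' a b := by simp
  map_smul' r a := by simp

theorem groupFox_of (v : V) (g : FreeGroup V) :
    groupFox v (MonoidAlgebra.of ℚ _ g) =
      !![MonoidAlgebra.of ℚ _ g ⊗ₜ[ℚ] 1, groupFox v (MonoidAlgebra.of ℚ _ g) 0 1;
        0, 1 ⊗ₜ[ℚ] MonoidAlgebra.of ℚ _ g] := by
  induction g using FreeGroup.induction_on with
  | C1 =>
    rw [map_one, map_one]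
    ext a b
    fin_cases a <;> fin_cases b <;> simp [Algebra.TensorProduct.one_def]
  | of w => simp [groupFox, evalGroupAlgebra, triUnit, groupUnit]
  | inv_of w _ =>
    have h : groupFox v (MonoidAlgebra.of ℚ _ (FreeGroup.of w)⁻¹) =
        (((triUnit (groupUnit (FreeGroup.of w)) (if w = v then 1 else 0))⁻¹ :
          (Matrix (Fin 2) (Fin 2) _)ˣ) : Matrix (Fin 2) (Fin 2) _) := by
      simp [groupFox, evalGroupAlgebra]
    rw [h]
    ext a b
    fin_cases a <;> fin_cases b <;> simp [triUnit, groupUnit, Units.inv_mk]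
  | mul x y hx hy =>
    rw [map_mul, map_mul, hx, hy]
    ext a b
    fin_cases a <;> fin_cases b <;> simp [Matrix.mul_apply, Fin.sum_univ_two]

theorem groupFox_eq (v : V) (a : MonoidAlgebra ℚ (FreeGroup V)) :
    groupFox v a = !![a ⊗ₜ[ℚ] 1, groupPartialDer v a; 0, 1 ⊗ₜ[ℚ] a] := by
  change groupFox v a = !![a ⊗ₜ[ℚ] 1, groupFox v a 0 1; 0, 1 ⊗ₜ[ℚ] a]
  induction a using MonoidAlgebra.induction_on with
  | of g => exact groupFox_of v g
  | add p q hp hq =>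
    rw [map_add, hp, hq]
    ext a b
    fin_cases a <;> fin_cases b <;> simp [TensorProduct.add_tmul, TensorProduct.tmul_add]
  | smul r p hp =>
    rw [map_smul, hp]
    ext a b
    fin_cases a <;> fin_cases b <;> simp [TensorProduct.smul_tmul']

theorem groupPartialDer_mul (v : V) (a b : MonoidAlgebra ℚ (FreeGroup V)) :
    groupPartialDer v (a * b) =
      groupPartialDer v a * (1 ⊗ₜ[ℚ] b) + (a ⊗ₜ[ℚ] 1) * groupPartialDer v b := by
  have h : groupFox v (a * b) 0 1 = (groupFox v a * groupFox v b) 0 1 := by rw [map_mul]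
  rw [groupFox_eq v a, groupFox_eq v b] at h
  change groupFox v (a * b) 0 1 = _
  rw [h]
  simp [Matrix.mul_apply, Fin.sum_univ_two, add_comm]

variable [Fintype V]

/-- The double bracket on the group algebra of a free group with prescribed values `t u v` on the
generators. -/
def groupBracket
    (t : V → V → MonoidAlgebra ℚ (FreeGroup V) ⊗[ℚ] MonoidAlgebra ℚ (FreeGroup V)) :
    MonoidAlgebra ℚ (FreeGroup V) →ₗ[ℚ] MonoidAlgebra ℚ (FreeGroup V) →ₗ[ℚ]
      MonoidAlgebra ℚ (FreeGroup V) ⊗[ℚ] MonoidAlgebra ℚ (FreeGroup V) :=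
  leibnizExpansion groupPartialDer t

theorem groupBracket_isDoubleBracket
    (t : V → V → MonoidAlgebra ℚ (FreeGroup V) ⊗[ℚ] MonoidAlgebra ℚ (FreeGroup V))
    (ht : ∀ u v, t v u = -TensorProduct.comm ℚ _ _ (t u v)) :
    IsDoubleBracket (groupBracket t) :=
  leibnizExpansion_isDoubleBracket groupPartialDer t groupPartialDer_mul ht

end FreeGroupAlgebra

/-! ### The network of the pentagram map on the torus -/

namespace PentagramNetwork

/-- The six edges attached to a square face of the network: its left, bottom, right and top edges
`alpha`, `beta`, `gamma`, `delta`, and the edges `eps`, `epsBar` leaving its upper right and lower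
right corners. -/
inductive EdgeKind : Type
  | alpha | beta | gamma | delta | eps | epsBar
  deriving DecidableEq

instance : Fintype EdgeKind where
  elems := {.alpha, .beta, .gamma, .delta, .eps, .epsBar}
  complete k := by cases k <;> simp

/-- The edges of the toric network with `n` square faces, the faces being indexed by `ℤ / n`.
For each `i`, with corners `LL`, `UL`, `LR`, `UR` of the `i`-th square face:
`alpha : LL i → UL i`, `beta : LL i → LR i`, `gamma : UR i → LR i`, `delta : UL i → UR i`,
`eps : UR i → LL (i + 2)`, `epsBar : LR i → UL (i + 1)`.
The vertices `LL` and `UR` are white, `UL` and `LR` are black. -/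
abbrev Edge (n : ℕ) : Type := EdgeKind × ZMod n

section LocalBracket

variable {n : ℕ} {A : Type} [Ring A] [Algebra ℚ A]

open EdgeKind in
/-- The local rules at the vertices, for edge weights `w`: at a white vertex with outgoing edges
`y`, `z` (in counter-clockwise order, starting from the incoming edge) the bracket is
`⦃y, z⦄ = 1/2 (y ⊗ z)`, and at a black vertex with incoming edges `b`, `c` (in clockwise order,
starting from the outgoing edge) it is `⦃b, c⦄ = 1/2 (c ⊗ b)`. All other brackets
between the three edges at a vertex vanish. -/
def vertexBracket (w : Edge n → A) : Edge n → Edge n → A ⊗[ℚ] A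
  | (beta, i), (alpha, j) => if j = i then (1 / 2 : ℚ) • (w (beta, i) ⊗ₜ[ℚ] w (alpha, i)) else 0
  | (gamma, i), (eps, j) => if j = i then (1 / 2 : ℚ) • (w (gamma, i) ⊗ₜ[ℚ] w (eps, i)) else 0
  | (beta, i), (gamma, j) => if j = i then (1 / 2 : ℚ) • (w (gamma, i) ⊗ₜ[ℚ] w (beta, i)) else 0
  | (alpha, i), (epsBar, j) =>
      if j = i - 1 then (1 / 2 : ℚ) • (w (epsBar, i - 1) ⊗ₜ[ℚ] w (alpha, i)) else 0
  | _, _ => 0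

/-- The values of the double bracket on the edge weights. -/
def edgeBracket (w : Edge n → A) (e f : Edge n) : A ⊗[ℚ] A :=
  vertexBracket w e f - TensorProduct.comm ℚ A A (vertexBracket w f e)

theorem edgeBracket_skew (w : Edge n → A) (e f : Edge n) :
    edgeBracket w f e = -TensorProduct.comm ℚ A A (edgeBracket w e f) := by
  simp [edgeBracket]

end LocalBracket

section Paths

variable (n : ℕ)

/-- Paths in the doubled quiver, as Laurent monomials in the edge weights. -/
abbrev PathGroup : Type := FreeGroup (Edge n)

/-- The monomial of a single edge. -/
def edge (k : EdgeKind) (i : ZMod n) : PathGroup n := FreeGroup.of (k, i)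

/-- The weight `a_i` of the left edge of a square, after gauge transformations which make the weights
of all edges not bounding a square equal to `1`. -/
def a (i : ZMod n) : PathGroup n := edge n .alpha i * (edge n .epsBar (i - 1))⁻¹

/-- The weight `b_i` of the bottom edge. -/
def b (i : ZMod n) : PathGroup n := edge n .beta i

/-- The weight `c_i` of the right edge. -/
def c (i : ZMod n) : PathGroup n := (edge n .eps i)⁻¹ * edge n .gamma i

/-- The weight `d_i` of the top edge. -/
def d (i : ZMod n) : PathGroup n := edge n .epsBar (i - 1) * edge n .delta i * edge n .eps i

/-- The loop `x_i = a_i c_{i-1}⁻¹ d_{i-1}⁻¹ c_{i-2}⁻¹`. -/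
def x (i : ZMod n) : PathGroup n :=
  a n i * (c n (i - 1))⁻¹ * (d n (i - 1))⁻¹ * (c n (i - 2))⁻¹

/-- The loop `y_i = b_i c_i⁻¹ d_i⁻¹ c_{i-1}⁻¹ d_{i-1}⁻¹ c_{i-2}⁻¹`. -/
def y (i : ZMod n) : PathGroup n :=
  b n i * (c n i)⁻¹ * (d n i)⁻¹ * (c n (i - 1))⁻¹ * (d n (i - 1))⁻¹ * (c n (i - 2))⁻¹

/-- The path `z_k = d_1 c_1 ⋯ d_{k-1} c_{k-1} d_k` for `k ≥ 1` (with the value `1` at `k = 0`, which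
is not used). -/
def z : ℕ → PathGroup n
  | 0 => 1
  | 1 => d n 1
  | k + 2 => z (k + 1) * c n ((k + 1 : ℕ) : ZMod n) * d n ((k + 2 : ℕ) : ZMod n)

/-- The representative of `i` among `1, …, n`. -/
def rep {n : ℕ} (i : ZMod n) : ℕ := (i - 1).val + 1

/-- The based loop `X_i = z_{i-2} x_i z_{i-2}⁻¹`, the index of `z` being read cyclically in
`1, …, n`. -/
def X (i : ZMod n) : PathGroup n := z n (rep (i - 2)) * x n i * (z n (rep (i - 2)))⁻¹

/-- The based loop `Y_i = z_{i-2} y_i z_{i-2}⁻¹`. -/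
def Y (i : ZMod n) : PathGroup n := z n (rep (i - 2)) * y n i * (z n (rep (i - 2)))⁻¹

/-- The based loop `Z = z_n c_n`. -/
def Z : PathGroup n := z n n * c n (n : ZMod n)

/-- The names of the generators `X_i`, `Y_i`, `Z` of the algebra of based loops. -/
inductive LoopGen : Type
  | X (i : ZMod n) : LoopGen
  | Y (i : ZMod n) : LoopGen
  | Z : LoopGen

/-- The algebra of loops with a common base point (the upper left corner of the first square): the
group algebra of the free group on `X_1, …, X_n, Y_1, …, Y_n, Z`. -/
abbrev LoopAlgebra : Type := MonoidAlgebra ℚ (FreeGroup (LoopGen n))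

/-- The generators as paths. -/
def loopPath : LoopGen n → PathGroup n
  | .X i => X n i
  | .Y i => Y n i
  | .Z => Z n

/-- The free skew field on the edges of the network. -/
abbrev EdgeField : Type := FreeSkewField (Edge n)

/-- The weight of a path. -/
def weight : PathGroup n →* (EdgeField n)ˣ := FreeGroup.lift FreeSkewField.varUnit

/-- The inclusion of the algebra of based loops into the free skew field. -/
def loops : LoopAlgebra n →ₐ[ℚ] EdgeField n :=
  evalGroupAlgebra fun g => weight n (loopPath n g)

variable [NeZero n]

/-- The double bracket of the network on the free skew field on its edges. -/
def networkBracket :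
    EdgeField n →ₗ[ℚ] EdgeField n →ₗ[ℚ] EdgeField n ⊗[ℚ] EdgeField n :=
  FreeSkewField.bracket (edgeBracket FreeSkewField.var)

theorem networkBracket_isDoubleBracket : IsDoubleBracket (networkBracket n) :=
  FreeSkewField.bracket_isDoubleBracket _ (edgeBracket_skew _)

end Paths

/-! ### The pentagram map on the algebra of based loops -/

section PentagramMap

variable (n : ℕ)

theorem bTilde_isUnit (i : ZMod n) :
    IsUnit ((weight n (b n i) : EdgeField n) +
      weight n (a n i) * weight n (d n i) * weight n (c n i)) := by
  let p : FreeAlgebra ℚ (Edge n) := FreeAlgebra.ι ℚ (EdgeKind.beta, i) +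
    FreeAlgebra.ι ℚ (EdgeKind.alpha, i) * FreeAlgebra.ι ℚ (EdgeKind.delta, i) *
      FreeAlgebra.ι ℚ (EdgeKind.gamma, i)
  have hp : p ≠ 0 := by
    intro h
    have h' := congrArg (FreeAlgebra.lift ℚ fun e : Edge n =>
      if e.1 = EdgeKind.beta then (1 : ℚ) else 0) h
    simp [p] at h'
  have h : ((weight n (b n i) : EdgeField n) +
      weight n (a n i) * weight n (d n i) * weight n (c n i)) =
        (FreeSkewField.unitOfFree p hp : EdgeField n) := by
    have hu : weight n (a n i) * weight n (d n i) * weight n (c n i) =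
        FreeSkewField.varUnit (EdgeKind.alpha, i) * FreeSkewField.varUnit (EdgeKind.delta, i) *
          FreeSkewField.varUnit (EdgeKind.gamma, i) := by
      simp only [weight, a, d, c, edge, map_mul, map_inv, FreeGroup.lift_apply_of]
      group
    rw [← Units.val_mul, ← Units.val_mul, hu]
    simp [weight, b, edge, FreeSkewField.varUnit, FreeSkewField.unitOfFree, p]
  rw [h]
  exact Units.isUnit _

/-- The weight `b̃_i = b_i + a_i d_i c_i` after the square move. -/
def bTilde (i : ZMod n) : (EdgeField n)ˣ := (bTilde_isUnit n i).unit

/-- The weight `ã_i = d_i c_i b̃_i⁻¹` after the square move. -/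
def aTilde (i : ZMod n) : (EdgeField n)ˣ := weight n (d n i) * weight n (c n i) * (bTilde n i)⁻¹

/-- The weight `c̃_i = b̃_i⁻¹ a_i d_i` after the square move. -/
def cTilde (i : ZMod n) : (EdgeField n)ˣ := (bTilde n i)⁻¹ * weight n (a n i) * weight n (d n i)

/-- The weight `d̃_i = ã_i b_i c_i⁻¹` after the square move. -/
def dTilde (i : ZMod n) : (EdgeField n)ˣ := aTilde n i * weight n (b n i) * (weight n (c n i))⁻¹

/-- The staircase monomial `ξ_k = ã_1 b̃_1 ⋯ ã_k b̃_k`. -/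
def xi : ℕ → (EdgeField n)ˣ
  | 0 => 1
  | k + 1 => xi k * aTilde n ((k + 1 : ℕ) : ZMod n) * bTilde n ((k + 1 : ℕ) : ZMod n)

/-- The image `T(X_i)` of `X_i` under the pentagram map, `1 ≤ i ≤ n`: the weight of the left edge of
the `i`-th square after the square moves at all square faces, the white-swap and black-swap moves,
and the gauge transformations which normalize the weights. -/
def pentX (i : ZMod n) : (EdgeField n)ˣ :=
  xi n (rep i) * (cTilde n i * (aTilde n (i + 2))⁻¹ * (bTilde n (i + 1))⁻¹ * (aTilde n (i + 1))⁻¹) *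
    (xi n (rep i))⁻¹

/-- The image `T(Y_i)` of `Y_i` under the pentagram map, `1 ≤ i ≤ n`. -/
def pentY (i : ZMod n) : (EdgeField n)ˣ :=
  xi n (rep i) * (dTilde n (i + 1) * (aTilde n (i + 3))⁻¹ * (bTilde n (i + 2))⁻¹ *
    (aTilde n (i + 2))⁻¹ * (bTilde n (i + 1))⁻¹ * (aTilde n (i + 1))⁻¹) * (xi n (rep i))⁻¹

/-- The images of the generators under the pentagram map followed by a shift of the indices by `2`:
with `S(X_i) = X_{i-1}` and `S(Y_i) = Y_{i-1}` (indices read cyclically) the image of `X_i` is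
`T(X_{i-2})` and the image of `Y_i` is `T(Y_{i-2})`. The pentagram map and the shift fix `Z`. -/
def shiftedPentGen : LoopGen n → (EdgeField n)ˣ
  | .X i => pentX n (i - 2)
  | .Y i => pentY n (i - 2)
  | .Z => weight n (Z n)

/-- The homomorphism `S² ∘ T` from the algebra of based loops to the free skew field. -/
def shiftedPent : LoopAlgebra n →ₐ[ℚ] EdgeField n :=
  evalGroupAlgebra (shiftedPentGen n)

end PentagramMap

/-! ### The quotient `Z = 1` -/

section Quotient

variable (n : ℕ)

/-- The coordinates `X_i`, `Y_i`, which remain when `Z` is set to `1`. -/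
inductive Coord : Type
  | X (i : ZMod n) : Coord
  | Y (i : ZMod n) : Coord
  deriving DecidableEq

/-- The coordinates correspond to two copies of `ℤ / n`. -/
def coordEquiv : ZMod n ⊕ ZMod n ≃ Coord n where
  toFun := Sum.elim Coord.X Coord.Y
  invFun
    | .X i => Sum.inl i
    | .Y i => Sum.inr i
  left_inv s := by cases s <;> rfl
  right_inv s := by cases s <;> rfl

instance [NeZero n] : Fintype (Coord n) := Fintype.ofEquiv _ (coordEquiv n)

/-- The free skew field on the coordinates `X_i`, `Y_i`. It contains the quotient
of the algebra of based loops by `Z - 1`. -/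
abbrev CoordField : Type := FreeSkewField (Coord n)

/-- The images in the quotient `Z = 1` of the generators of the loop algebra. -/
def quotGen : LoopGen n → (CoordField n)ˣ
  | .X i => FreeSkewField.varUnit (Coord.X i)
  | .Y i => FreeSkewField.varUnit (Coord.Y i)
  | .Z => 1

/-- The quotient map from the algebra of based loops, which sets `Z` to `1`. -/
def quot : LoopAlgebra n →ₐ[ℚ] CoordField n :=
  evalGroupAlgebra (quotGen n)

/-- The path of a coordinate. -/
def coordPath : Coord n → PathGroup n
  | .X i => X n i
  | .Y i => Y n i

/-- The edge weights `X_i` on the left and `Y_i` on the bottom of the `i`-th square face, and `1` on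
all other edges. On based loops this is the quotient map which sets `Z` to `1`. -/
def collapseGen : Edge n → (CoordField n)ˣ
  | (.alpha, i) => FreeSkewField.varUnit (Coord.X i)
  | (.beta, i) => FreeSkewField.varUnit (Coord.Y i)
  | _ => 1

/-- Evaluation of Laurent polynomials in the edge weights at these weights. -/
def collapse : MonoidAlgebra ℚ (PathGroup n) →ₐ[ℚ] CoordField n :=
  evalGroupAlgebra (collapseGen n)

/-- The element `σ_i = X_i + Y_i`. -/
def sigma (i : ZMod n) : (CoordField n)ˣ :=
  FreeSkewField.unitOfFree (FreeAlgebra.ι ℚ (Coord.X i) + FreeAlgebra.ι ℚ (Coord.Y i)) (by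
    intro h
    have h' := congrArg (FreeAlgebra.lift ℚ fun e : Coord n =>
      match e with
      | .X _ => (1 : ℚ)
      | .Y _ => 0) h
    simp at h')

/-- The images of the generators under the pentagram map, for `Z = 1`:
`T(X_i) = (X_i + Y_i)⁻¹ X_i (X_{i+2} + Y_{i+2})` and
`T(Y_i) = (X_{i+1} + Y_{i+1})⁻¹ Y_{i+1} (X_{i+3} + Y_{i+3})`. -/
def quotPentGen : LoopGen n → (CoordField n)ˣ
  | .X i => (sigma n i)⁻¹ * FreeSkewField.varUnit (Coord.X i) * sigma n (i + 2)
  | .Y i => (sigma n (i + 1))⁻¹ * FreeSkewField.varUnit (Coord.Y (i + 1)) * sigma n (i + 3)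
  | .Z => 1

/-- The pentagram map on the quotient `Z = 1`, composed with the quotient map. -/
def quotPent : LoopAlgebra n →ₐ[ℚ] CoordField n :=
  evalGroupAlgebra (quotPentGen n)

variable [NeZero n]

/-- The double bracket of the network on Laurent polynomials in the edge weights. -/
def pathBracket : MonoidAlgebra ℚ (PathGroup n) →ₗ[ℚ] MonoidAlgebra ℚ (PathGroup n) →ₗ[ℚ]
    MonoidAlgebra ℚ (PathGroup n) ⊗[ℚ] MonoidAlgebra ℚ (PathGroup n) :=
  groupBracket (edgeBracket fun e => MonoidAlgebra.of ℚ (PathGroup n) (FreeGroup.of e))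

/-- The double brackets of `X_i` and `Y_i`, with `Z` set to `1`. -/
def coordBracket (u v : Coord n) : CoordField n ⊗[ℚ] CoordField n :=
  TensorProduct.map (collapse n).toLinearMap (collapse n).toLinearMap
    (pathBracket n (MonoidAlgebra.of ℚ _ (coordPath n u)) (MonoidAlgebra.of ℚ _ (coordPath n v)))

/-- The double bracket on the free skew field on `X_i`, `Y_i` with these values on the generators. -/
def quotBracket :
    CoordField n →ₗ[ℚ] CoordField n →ₗ[ℚ] CoordField n ⊗[ℚ] CoordField n :=
  FreeSkewField.bracket (coordBracket n)

end Quotient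

end PentagramNetwork

end

noncomputable section

set_option linter.unusedSimpArgs false
set_option linter.unnecessarySeqFocus false

/-! ### Double derivations along a group homomorphism -/

section DoubleDerivations

variable {A : Type} [Ring A] [Algebra ℚ A] {G : Type} [Group G]

/-! Contracting the edges ε and ε̄ gives a quiver whose edges are the sides a, b, c, d of the faces.
Sides of different faces have zero double bracket, and within a face the brackets are those of
`letterBracket`. For a vertex p let ∂_p be the outer derivation with ∂_p u = u ⊗ 1 if u ends at p,
minus 1 ⊗ u if u starts at p (`endDer`). Along a path the contributions of interior vertices cancel,
so on a loop g based at x one has ∂_x g = g ⊗ 1 − 1 ⊗ g, and ∂_p g = 0 for p ≠ x.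

Put (p ⊗ q) ⋆ (r ⊗ s) = rq ⊗ ps (`swapMul`). For outer derivations θ, θ' the products ∂_p g ⋆ θ h
and θ' g ⋆ ∂_p h are double derivations. On based loops the first is killed by multiplication and
the second by multiplication modulo commutators. A homomorphism is almost Poisson
(`IsAlmostPoisson`) if it preserves the brackets of the sides up to such products; by
`inducedBracket_of_isPath` it then preserves the induced bracket of loops with a common base point.

The theorem follows from three facts. The weights in the skew field of edges are Poisson on the nose
(`networkBracket_edgeUnits`), and the weights X_i, Y_i, 1, 1 of the sides after setting Z = 1 are
almost Poisson (`coordUnits_isAlmostPoisson`). Square moves preserve almost Poisson homomorphisms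
(`IsAlmostPoisson.squareMove`): the brackets of the new sides differ from the required ones by
multiples of ∑ ∂_p ⋆ ∂_p. Finally, on based loops the pentagram map is a square move followed by
conjugation by one fixed unit (`shiftedPentGen_eq`, `quotPentGen_eq`), which the induced bracket
does not see (`inducedBracket_conj`).

The bracket of two based loops is again a combination of based loops because the brackets of the
sides are compatible with the gauge transformation contracting the staircase d₁c₁d₂c₂⋯
(`wordAlg_loopBracket`). -/

theorem IsDoubleBracket.leibniz_left {D : A →ₗ[ℚ] A →ₗ[ℚ] A ⊗[ℚ] A} (hD : IsDoubleBracket D)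
    (a b c : A) :
    D (a * b) c = D a c * (b ⊗ₜ[ℚ] (1 : A)) + ((1 : A) ⊗ₜ[ℚ] a) * D b c := by
  rw [hD.skew c (a * b), hD.leibniz, hD.skew c a, hD.skew c b]
  simp [comm_mul, add_comm]

/-- An outer derivation along a homomorphism from a group to the units of an algebra. -/
def IsOuterDer (φ : G →* Aˣ) (δ : G → A ⊗[ℚ] A) : Prop :=
  ∀ g h, δ (g * h) = δ g * ((1 : A) ⊗ₜ[ℚ] (φ h : A)) + ((φ g : A) ⊗ₜ[ℚ] (1 : A)) * δ h

namespace IsOuterDer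

variable {φ : G →* Aˣ} {δ ε : G → A ⊗[ℚ] A}

theorem one (hδ : IsOuterDer φ δ) : δ 1 = 0 := by
  have h := hδ 1 1
  simp only [mul_one, map_one, Units.val_one, ← Algebra.TensorProduct.one_def, one_mul] at h
  simpa using h

theorem inv (hδ : IsOuterDer φ δ) (g : G) :
    δ g⁻¹ = -(((φ g⁻¹ : A) ⊗ₜ[ℚ] (1 : A)) * δ g * ((1 : A) ⊗ₜ[ℚ] (φ g⁻¹ : A))) := by
  have h := hδ g⁻¹ g
  rw [inv_mul_cancel, hδ.one] at h
  have h2 := congrArg (fun t => t * ((1 : A) ⊗ₜ[ℚ] (φ g⁻¹ : A))) h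
  simp only [zero_mul, add_mul, mul_assoc (δ g⁻¹), Algebra.TensorProduct.tmul_mul_tmul, mul_one,
    ← Units.val_mul, ← map_mul, mul_inv_cancel, map_one, Units.val_one,
    ← Algebra.TensorProduct.one_def] at h2
  exact eq_neg_of_add_eq_zero_left h2.symm

theorem sum {ι : Type} (s : Finset ι) {δ : ι → G → A ⊗[ℚ] A} (h : ∀ i, IsOuterDer φ (δ i)) :
    IsOuterDer φ fun g => ∑ i ∈ s, δ i g := by
  intro g k
  simp only [h _ g k, Finset.sum_add_distrib, Finset.sum_mul, Finset.mul_sum]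

theorem smul (hδ : IsOuterDer φ δ) (r : ℚ) : IsOuterDer φ fun g => r • δ g := by
  intro g k
  simp [hδ g k]

theorem ext {V : Type} {φ : FreeGroup V →* Aˣ} {δ ε : FreeGroup V → A ⊗[ℚ] A}
    (hδ : IsOuterDer φ δ) (hε : IsOuterDer φ ε)
    (h : ∀ v, δ (FreeGroup.of v) = ε (FreeGroup.of v)) (g : FreeGroup V) : δ g = ε g := by
  induction g using FreeGroup.induction_on with
  | C1 => rw [hδ.one, hε.one]
  | of v => exact h v
  | inv_of v hv => rw [hδ.inv, hε.inv, h v]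
  | mul x y hx hy => rw [hδ, hε, hx, hy]

end IsOuterDer

/-- The upper triangular representation of the outer derivation with given values on generators. -/
def outerDerHom {V : Type} (φ : FreeGroup V →* Aˣ) (t : V → A ⊗[ℚ] A) :
    FreeGroup V →* (Matrix (Fin 2) (Fin 2) (A ⊗[ℚ] A))ˣ :=
  FreeGroup.lift fun v => triUnit (φ (FreeGroup.of v)) (t v)

/-- The outer derivation along `φ` with given values on generators. -/
def outerDer {V : Type} (φ : FreeGroup V →* Aˣ) (t : V → A ⊗[ℚ] A) (g : FreeGroup V) :
    A ⊗[ℚ] A :=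
  (outerDerHom φ t g : Matrix (Fin 2) (Fin 2) (A ⊗[ℚ] A)) 0 1

theorem outerDerHom_eq {V : Type} (φ : FreeGroup V →* Aˣ) (t : V → A ⊗[ℚ] A) (g : FreeGroup V) :
    (outerDerHom φ t g : Matrix (Fin 2) (Fin 2) (A ⊗[ℚ] A)) =
      !![(φ g : A) ⊗ₜ[ℚ] 1, outerDer φ t g; 0, 1 ⊗ₜ[ℚ] (φ g : A)] := by
  unfold outerDer
  induction g using FreeGroup.induction_on with
  | C1 => ext i j; fin_cases i <;> fin_cases j <;> simp [Algebra.TensorProduct.one_def]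
  | of v => simp [outerDerHom, triUnit]
  | inv_of v _ =>
    rw [map_inv, map_inv, outerDerHom, FreeGroup.lift_apply_of]
    ext i j
    fin_cases i <;> fin_cases j <;> simp [triUnit, Units.inv_mk]
  | mul x y hx hy =>
    rw [map_mul, Units.val_mul, hx, hy]
    ext i j
    fin_cases i <;> fin_cases j <;> simp [Matrix.mul_apply, Fin.sum_univ_two]

theorem outerDer_isOuterDer {V : Type} (φ : FreeGroup V →* Aˣ) (t : V → A ⊗[ℚ] A) :
    IsOuterDer φ (outerDer φ t) := by
  intro g h
  change ((outerDerHom φ t (g * h) : Matrix (Fin 2) (Fin 2) (A ⊗[ℚ] A))) 0 1 = _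
  rw [map_mul, Units.val_mul, outerDerHom_eq, outerDerHom_eq]
  simp [Matrix.mul_apply, Fin.sum_univ_two, add_comm]

@[simp]
theorem outerDer_of {V : Type} (φ : FreeGroup V →* Aˣ) (t : V → A ⊗[ℚ] A) (v : V) :
    outerDer φ t (FreeGroup.of v) = t v := by
  simp [outerDer, outerDerHom, triUnit]

/-- A double derivation along a homomorphism from a group to the units of an algebra: an outer
derivation in the second argument and an inner derivation in the first one. -/
structure IsDoubleDer (φ : G →* Aˣ) (B : G → G → A ⊗[ℚ] A) : Prop where
  right : ∀ g h k, B g (h * k) =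
    B g h * ((1 : A) ⊗ₜ[ℚ] (φ k : A)) + ((φ h : A) ⊗ₜ[ℚ] (1 : A)) * B g k
  left : ∀ g h k, B (g * h) k =
    B g k * ((φ h : A) ⊗ₜ[ℚ] (1 : A)) + ((1 : A) ⊗ₜ[ℚ] (φ g : A)) * B h k

namespace IsDoubleDer

variable {φ : G →* Aˣ} {B C : G → G → A ⊗[ℚ] A}

theorem outer (hB : IsDoubleDer φ B) (g : G) : IsOuterDer φ (B g) := hB.right g

theorem outer_comm (hB : IsDoubleDer φ B) (h : G) :
    IsOuterDer φ fun g => TensorProduct.comm ℚ A A (B g h) := by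
  intro g k
  simp [hB.left, comm_mul]

theorem one_right (hB : IsDoubleDer φ B) (g : G) : B g 1 = 0 := (hB.outer g).one

theorem one_left (hB : IsDoubleDer φ B) (g : G) : B 1 g = 0 :=
  (TensorProduct.comm ℚ A A).map_eq_zero_iff.1 (hB.outer_comm g).one

theorem inv_right (hB : IsDoubleDer φ B) (g h : G) : B g h⁻¹ =
    -(((φ h⁻¹ : A) ⊗ₜ[ℚ] (1 : A)) * B g h * ((1 : A) ⊗ₜ[ℚ] (φ h⁻¹ : A))) :=
  (hB.outer g).inv h

theorem inv_left (hB : IsDoubleDer φ B) (g h : G) : B g⁻¹ h =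
    -(((1 : A) ⊗ₜ[ℚ] (φ g⁻¹ : A)) * B g h * ((φ g⁻¹ : A) ⊗ₜ[ℚ] (1 : A))) := by
  have h := (hB.outer_comm h).inv g
  apply (TensorProduct.comm ℚ A A).injective
  simp only [map_neg, comm_mul, TensorProduct.comm_tmul]
  exact h

theorem add (hB : IsDoubleDer φ B) (hC : IsDoubleDer φ C) :
    IsDoubleDer φ fun g h => B g h + C g h where
  right g h k := by simp only [hB.right, hC.right, add_mul, mul_add]; abel
  left g h k := by simp only [hB.left, hC.left, add_mul, mul_add]; abel

theorem sub (hB : IsDoubleDer φ B) (hC : IsDoubleDer φ C) :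
    IsDoubleDer φ fun g h => B g h - C g h where
  right g h k := by simp only [hB.right, hC.right, sub_mul, mul_sub]; abel
  left g h k := by simp only [hB.left, hC.left, sub_mul, mul_sub]; abel

theorem sum {ι : Type} (s : Finset ι) {B : ι → G → G → A ⊗[ℚ] A}
    (hB : ∀ i, IsDoubleDer φ (B i)) : IsDoubleDer φ fun g h => ∑ i ∈ s, B i g h where
  right g h k := by
    simp only [(hB _).right, Finset.sum_add_distrib, Finset.sum_mul, Finset.mul_sum]
  left g h k := by
    simp only [(hB _).left, Finset.sum_add_distrib, Finset.sum_mul, Finset.mul_sum]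

/-- The transposed double derivation. -/
theorem transpose (hB : IsDoubleDer φ B) :
    IsDoubleDer φ fun g h => -TensorProduct.comm ℚ A A (B h g) where
  right g h k := by simp [hB.left, comm_mul]; abel
  left g h k := by simp [hB.right, comm_mul]; abel

/-- Exchanging the tensor factors turns the inner derivation in the first argument into an outer
one, so uniqueness of outer derivations applies to each argument in turn. -/
theorem ext {V : Type} {φ : FreeGroup V →* Aˣ} {B C : FreeGroup V → FreeGroup V → A ⊗[ℚ] A}
    (hB : IsDoubleDer φ B) (hC : IsDoubleDer φ C)
    (h : ∀ u v, B (FreeGroup.of u) (FreeGroup.of v) = C (FreeGroup.of u) (FreeGroup.of v))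
    (g k : FreeGroup V) : B g k = C g k := by
  have h1 : ∀ u k, B (FreeGroup.of u) k = C (FreeGroup.of u) k := fun u =>
    (hB.outer _).ext (hC.outer _) (h u)
  apply (TensorProduct.comm ℚ A A).injective
  exact (hB.outer_comm k).ext (hC.outer_comm k) (fun u => by rw [h1]) g

end IsDoubleDer

theorem IsDoubleBracket.isDoubleDer {D : A →ₗ[ℚ] A →ₗ[ℚ] A ⊗[ℚ] A} (hD : IsDoubleBracket D)
    (φ : G →* Aˣ) : IsDoubleDer φ fun g h => D (φ g : A) (φ h : A) where
  right g h k := by simp [hD.leibniz]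
  left g h k := by simp [hD.leibniz_left]

/-- The image of a double bracket under an algebra homomorphism. -/
theorem IsDoubleBracket.isDoubleDer_map {A' : Type} [Ring A'] [Algebra ℚ A']
    {D : A →ₗ[ℚ] A →ₗ[ℚ] A ⊗[ℚ] A} (hD : IsDoubleBracket D) (f : A →ₐ[ℚ] A') (ι : G →* Aˣ)
    (φ : G →* A'ˣ) (hι : ∀ g, f (ι g : A) = φ g) :
    IsDoubleDer φ fun g k => Algebra.TensorProduct.map f f (D (ι g : A) (ι k : A)) where
  right g h k := by simp [hD.leibniz, hι]
  left g h k := by simp [hD.leibniz_left, hι]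

/-- The product `(p ⊗ q) ⋆ (r ⊗ s) = r q ⊗ p s` on `A ⊗ A`. -/
def swapMul : A ⊗[ℚ] A →ₗ[ℚ] A ⊗[ℚ] A →ₗ[ℚ] A ⊗[ℚ] A :=
  (TensorProduct.mk ℚ (A ⊗[ℚ] A) (A ⊗[ℚ] A)).compr₂ (sandwich 1)

theorem swapMul_tmul (p q r s : A) :
    swapMul (p ⊗ₜ[ℚ] q) (r ⊗ₜ[ℚ] s) = (r * q) ⊗ₜ[ℚ] (p * s) := by
  simp [swapMul, sandwich_tmul]

theorem comm_swapMul (x y : A ⊗[ℚ] A) :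
    TensorProduct.comm ℚ A A (swapMul x y) = swapMul y x := by
  simp [swapMul, comm_sandwich, Algebra.TensorProduct.one_def]

theorem swapMul_mul_right (x y : A ⊗[ℚ] A) (c : A) :
    swapMul x (y * ((1 : A) ⊗ₜ[ℚ] c)) = swapMul x y * ((1 : A) ⊗ₜ[ℚ] c) :=
  sandwich_mul_right 1 x y c

theorem swapMul_mul_left (x y : A ⊗[ℚ] A) (b : A) :
    swapMul x ((b ⊗ₜ[ℚ] (1 : A)) * y) = (b ⊗ₜ[ℚ] (1 : A)) * swapMul x y :=
  sandwich_mul_left 1 x y b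

theorem swapMul_tmul_one_right (x : A ⊗[ℚ] A) (a : A) :
    swapMul x (a ⊗ₜ[ℚ] (1 : A)) = (a ⊗ₜ[ℚ] (1 : A)) * TensorProduct.comm ℚ A A x := by
  induction x using TensorProduct.induction_on with
  | zero => simp
  | add x y hx hy => simp only [map_add, LinearMap.add_apply, mul_add, hx, hy]
  | tmul p q => simp [swapMul_tmul]

theorem swapMul_one_tmul_right (x : A ⊗[ℚ] A) (a : A) :
    swapMul x ((1 : A) ⊗ₜ[ℚ] a) = TensorProduct.comm ℚ A A x * ((1 : A) ⊗ₜ[ℚ] a) := by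
  induction x using TensorProduct.induction_on with
  | zero => simp
  | add x y hx hy => simp only [map_add, LinearMap.add_apply, add_mul, hx, hy]
  | tmul p q => simp [swapMul_tmul]

theorem swapMul_tmul_one_left (x : A ⊗[ℚ] A) (a : A) :
    swapMul (a ⊗ₜ[ℚ] (1 : A)) x = ((1 : A) ⊗ₜ[ℚ] a) * x := by
  rw [← comm_swapMul, swapMul_tmul_one_right, comm_mul]
  simp

theorem swapMul_one_tmul_left (x : A ⊗[ℚ] A) (a : A) :
    swapMul ((1 : A) ⊗ₜ[ℚ] a) x = x * (a ⊗ₜ[ℚ] (1 : A)) := by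
  rw [← comm_swapMul, swapMul_one_tmul_right, comm_mul]
  simp

/-- This produces the correction terms allowed in `IsAlmostPoisson`. Since ⋆ is exchanged with its
opposite by the flip, the inner rule on the left is the outer rule on the right. -/
theorem IsOuterDer.swapMul {φ : G →* Aˣ} {δ ε : G → A ⊗[ℚ] A} (hδ : IsOuterDer φ δ)
    (hε : IsOuterDer φ ε) : IsDoubleDer φ fun g h => swapMul (δ g) (ε h) := by
  have key : ∀ {δ ε : G → A ⊗[ℚ] A} (_ : IsOuterDer φ ε) (g h k : G),
      _root_.swapMul (δ g) (ε (h * k)) =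
        _root_.swapMul (δ g) (ε h) * ((1 : A) ⊗ₜ[ℚ] (φ k : A)) +
          ((φ h : A) ⊗ₜ[ℚ] (1 : A)) * _root_.swapMul (δ g) (ε k) := by
    intro δ ε hε g h k
    rw [hε, map_add, swapMul_mul_right, swapMul_mul_left]
  refine ⟨key hε, fun g h k => ?_⟩
  apply (TensorProduct.comm ℚ A A).injective
  simp only [map_add, comm_mul, comm_swapMul, TensorProduct.comm_tmul]
  exact key hδ k g h

/-! ### Brackets modulo commutators -/

theorem cyclicClass_mul_comm (a b : A) : cyclicClass (a * b) = cyclicClass (b * a) := by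
  rw [← sub_eq_zero, ← map_sub]
  exact (Submodule.Quotient.mk_eq_zero _).2 (Submodule.subset_span ⟨a, b, rfl⟩)

theorem cyclicClass_conj (p : Aˣ) (a : A) :
    cyclicClass ((p : A) * a * ((p⁻¹ : Aˣ) : A)) = cyclicClass a := by
  rw [cyclicClass_mul_comm, ← mul_assoc, Units.inv_mul, one_mul]

theorem cyclicClass_mul'_comm (x : A ⊗[ℚ] A) :
    cyclicClass (LinearMap.mul' ℚ A (TensorProduct.comm ℚ A A x)) =
      cyclicClass (LinearMap.mul' ℚ A x) := by
  induction x using TensorProduct.induction_on with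
  | zero => simp
  | add x y hx hy => simp only [map_add, hx, hy]
  | tmul p q => simp [cyclicClass_mul_comm p q]

theorem inducedBracket_skew {D : A →ₗ[ℚ] A →ₗ[ℚ] A ⊗[ℚ] A} (hD : IsDoubleBracket D) (a b : A) :
    inducedBracket D b a = -inducedBracket D a b := by
  rw [inducedBracket, singleBracket, hD.skew, map_neg, map_neg, cyclicClass_mul'_comm]
  rfl

/-- Both μ(x (a ⊗ 1)) and μ((1 ⊗ a) x) insert `a` between the two tensor factors of x, so the two
Leibniz terms merely change places. Hence the single bracket depends on its first argument only
modulo commutators. -/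
theorem singleBracket_mul_comm {D : A →ₗ[ℚ] A →ₗ[ℚ] A ⊗[ℚ] A} (hD : IsDoubleBracket D)
    (a b c : A) : singleBracket D (a * b) c = singleBracket D (b * a) c := by
  have key : ∀ (x : A ⊗[ℚ] A) (a : A), LinearMap.mul' ℚ A (x * (a ⊗ₜ[ℚ] (1 : A))) =
      LinearMap.mul' ℚ A (((1 : A) ⊗ₜ[ℚ] a) * x) := by
    intro x a
    induction x using TensorProduct.induction_on with
    | zero => simp
    | add x y hx hy => simp only [add_mul, mul_add, map_add, hx, hy]
    | tmul p q => simp [mul_assoc]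
  simp only [singleBracket, hD.leibniz_left, map_add, key]
  exact add_comm _ _

theorem inducedBracket_conj {D : A →ₗ[ℚ] A →ₗ[ℚ] A ⊗[ℚ] A} (hD : IsDoubleBracket D) (p : Aˣ)
    (a b : A) :
    inducedBracket D ((p : A) * a * ((p⁻¹ : Aˣ) : A)) ((p : A) * b * ((p⁻¹ : Aˣ) : A)) =
      inducedBracket D a b := by
  have key : ∀ a c : A,
      inducedBracket D ((p : A) * a * ((p⁻¹ : Aˣ) : A)) c = inducedBracket D a c := by
    intro a c
    rw [inducedBracket, singleBracket_mul_comm hD, ← mul_assoc, Units.inv_mul, one_mul]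
    rfl
  rw [key, inducedBracket_skew hD, key, ← inducedBracket_skew hD]

/-- Here (a ⊗ 1 − 1 ⊗ a) ⋆ (r ⊗ s) = r ⊗ as − ra ⊗ s. The vanishing is exact on this side; with the
inner term as the second factor it holds only modulo commutators. -/
theorem mul'_swapMul_inner_left (x : A ⊗[ℚ] A) (a : A) :
    LinearMap.mul' ℚ A (swapMul (a ⊗ₜ[ℚ] (1 : A) - (1 : A) ⊗ₜ[ℚ] a) x) = 0 := by
  induction x using TensorProduct.induction_on with
  | zero => simp
  | add x y hx hy => simp only [map_add, hx, hy, add_zero]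
  | tmul p q => simp [swapMul_tmul, mul_assoc]

theorem cyclicClass_mul'_swapMul_inner_right (x : A ⊗[ℚ] A) (a : A) :
    cyclicClass (LinearMap.mul' ℚ A (swapMul x (a ⊗ₜ[ℚ] (1 : A) - (1 : A) ⊗ₜ[ℚ] a))) = 0 := by
  rw [← cyclicClass_mul'_comm, comm_swapMul, mul'_swapMul_inner_left, map_zero]

end DoubleDerivations

/-! ### Values on generators of brackets on the group algebra of a free group -/

section FreeGroupBracket

variable {V : Type} [DecidableEq V]

theorem groupPartialDer_of (v w : V) :
    groupPartialDer v (MonoidAlgebra.of ℚ _ (FreeGroup.of w)) = if w = v then 1 else 0 := by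
  change groupFox v _ 0 1 = _
  simp [groupFox, evalGroupAlgebra, triUnit]

theorem groupBracket_of [Fintype V]
    (t : V → V → MonoidAlgebra ℚ (FreeGroup V) ⊗[ℚ] MonoidAlgebra ℚ (FreeGroup V)) (u v : V) :
    groupBracket t (MonoidAlgebra.of ℚ _ (FreeGroup.of u)) (MonoidAlgebra.of ℚ _ (FreeGroup.of v)) =
      t u v := by
  rw [groupBracket, leibnizExpansion_apply, Finset.sum_eq_single u, Finset.sum_eq_single v]
  · simp only [groupPartialDer_of, if_true]
    rw [Algebra.TensorProduct.one_def, sandwich_tmul, ← Algebra.TensorProduct.one_def, one_mul,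
      mul_one]
  · intro b _ hb
    simp only [groupPartialDer_of, Ne.symm hb, if_false, TensorProduct.tmul_zero, map_zero]
  · simp
  · intro b _ hb
    simp only [groupPartialDer_of, Ne.symm hb, if_false, TensorProduct.zero_tmul, map_zero,
      Finset.sum_const_zero]
  · simp

end FreeGroupBracket

theorem evalGroupAlgebra_of {V R : Type} [Ring R] [Algebra ℚ R] (w : V → Rˣ) (g : FreeGroup V) :
    evalGroupAlgebra w (MonoidAlgebra.of ℚ _ g) = (FreeGroup.lift w g : R) := by
  simp [evalGroupAlgebra]

/-! ### Paths in a quiver -/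

section Quiver

variable {E V : Type}

/-- `IsPath s t x y g` means that `g` is the class of a path from `x` to `y` in the double of the
quiver with edges `E`, where the edge `e` goes from `s e` to `t e`. -/
inductive IsPath (s t : E → V) : V → V → FreeGroup E → Prop
  | refl (x : V) : IsPath s t x x 1
  | of (e : E) : IsPath s t (s e) (t e) (FreeGroup.of e)
  | inv {x y : V} {g : FreeGroup E} : IsPath s t x y g → IsPath s t y x g⁻¹
  | mul {x y z : V} {g h : FreeGroup E} :
      IsPath s t x y g → IsPath s t y z h → IsPath s t x z (g * h)

variable [DecidableEq V] {A : Type} [Ring A] [Algebra ℚ A]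

/-- The values on edges of the derivation which marks the passages of a path through the vertex
`v`. -/
def endDer (s t : E → V) (φ : FreeGroup E →* Aˣ) (v : V) (e : E) : A ⊗[ℚ] A :=
  (if t e = v then (φ (FreeGroup.of e) : A) ⊗ₜ[ℚ] (1 : A) else 0) -
    if s e = v then (1 : A) ⊗ₜ[ℚ] (φ (FreeGroup.of e) : A) else 0

/-- At an interior vertex the end of one piece and the start of the next contribute opposite terms,
so only the two ends of the path remain. For a loop at `v` the result is the inner expression g ⊗ 1
− 1 ⊗ g. -/
theorem IsPath.outerDer_endDer {s t : E → V} {x y : V} {g : FreeGroup E} (h : IsPath s t x y g)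
    (φ : FreeGroup E →* Aˣ) (v : V) :
    outerDer φ (endDer s t φ v) g = (if y = v then (φ g : A) ⊗ₜ[ℚ] (1 : A) else 0) -
      if x = v then (1 : A) ⊗ₜ[ℚ] (φ g : A) else 0 := by
  have hd := outerDer_isOuterDer φ (endDer s t φ v)
  induction h with
  | refl x => simp [hd.one]
  | of e => simp [endDer]
  | inv _ ih =>
    rw [hd.inv, ih]
    split_ifs <;> simp [mul_sub, sub_mul]
  | mul _ _ ih1 ih2 =>
    rw [hd, ih1, ih2]
    split_ifs <;> simp [mul_sub, sub_mul] <;> abel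

end Quiver

namespace PentagramNetwork

/-! ### The gauge-fixed network -/

/-- The four sides of a square face. -/
inductive Side : Type
  | left | bottom | right | top
  deriving DecidableEq

instance : Fintype Side where
  elems := {.left, .bottom, .right, .top}
  complete k := by cases k <;> simp

/-- The edges of the gauge-fixed network: the sides of the square faces. -/
abbrev Letter (n : ℕ) : Type := Side × ZMod n

/-- The vertices of the gauge-fixed network. The white vertex `white i` is the upper right corner of
face `i`, identified with the lower left corner of face `i + 2`; the black vertex `black i` is the
upper left corner of face `i`, identified with the lower right corner of face `i - 1`. -/
inductive Vertex (n : ℕ) : Type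
  | white (i : ZMod n) : Vertex n
  | black (i : ZMod n) : Vertex n
  deriving DecidableEq

/-- The vertices correspond to two copies of `ℤ / n`. -/
def vertexEquiv (n : ℕ) : ZMod n ⊕ ZMod n ≃ Vertex n where
  toFun := Sum.elim Vertex.white Vertex.black
  invFun
    | .white i => Sum.inl i
    | .black i => Sum.inr i
  left_inv s := by cases s <;> rfl
  right_inv s := by cases s <;> rfl

instance (n : ℕ) [NeZero n] : Fintype (Vertex n) := Fintype.ofEquiv _ (vertexEquiv n)

section Letters

variable {n : ℕ}

/-- The initial vertex of a side. -/
def source : Letter n → Vertex n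
  | (.left, i) => .white (i - 2)
  | (.bottom, i) => .white (i - 2)
  | (.right, i) => .white i
  | (.top, i) => .black i

/-- The final vertex of a side. -/
def target : Letter n → Vertex n
  | (.left, i) => .black i
  | (.bottom, i) => .black (i + 1)
  | (.right, i) => .black (i + 1)
  | (.top, i) => .white i

variable {A : Type} [Ring A] [Algebra ℚ A]

/-- One half of the double brackets of the sides of a face. -/
def halfLetterBracket (w : Letter n → A) : Letter n → Letter n → A ⊗[ℚ] A
  | (.bottom, i), (.left, j) =>
      if i = j then (1 / 2 : ℚ) • (w (.bottom, i) ⊗ₜ[ℚ] w (.left, i)) else 0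
  | (.bottom, i), (.right, j) =>
      if i = j then (1 / 2 : ℚ) • (w (.right, i) ⊗ₜ[ℚ] w (.bottom, i)) else 0
  | (.left, i), (.top, j) =>
      if i = j then (1 / 2 : ℚ) • ((1 : A) ⊗ₜ[ℚ] (w (.left, i) * w (.top, i))) else 0
  | (.right, i), (.top, j) =>
      if i = j then (1 / 2 : ℚ) • ((w (.top, i) * w (.right, i)) ⊗ₜ[ℚ] (1 : A)) else 0
  | _, _ => 0

/-- The double brackets of the sides of the faces. -/
def letterBracket (w : Letter n → A) (u v : Letter n) : A ⊗[ℚ] A :=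
  halfLetterBracket w u v - TensorProduct.comm ℚ A A (halfLetterBracket w v u)

theorem letterBracket_skew (w : Letter n → A) (u v : Letter n) :
    letterBracket w v u = -TensorProduct.comm ℚ A A (letterBracket w u v) := by
  simp [letterBracket]

theorem map_letterBracket {A' : Type} [Ring A'] [Algebra ℚ A'] (f : A →ₐ[ℚ] A')
    (w : Letter n → A) (u v : Letter n) :
    Algebra.TensorProduct.map f f (letterBracket w u v) = letterBracket (fun x => f (w x)) u v := by
  have h : ∀ u v, Algebra.TensorProduct.map f f (halfLetterBracket w u v) =
      halfLetterBracket (fun x => f (w x)) u v := by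
    rintro ⟨k, i⟩ ⟨l, j⟩
    cases k <;> cases l <;> simp [halfLetterBracket] <;> split_ifs <;> simp
  have hc : ∀ x : A ⊗[ℚ] A, Algebra.TensorProduct.map f f (TensorProduct.comm ℚ A A x) =
      TensorProduct.comm ℚ A' A' (Algebra.TensorProduct.map f f x) := by
    intro x
    induction x using TensorProduct.induction_on with
    | zero => simp
    | add x y hx hy => simp only [map_add, hx, hy]
    | tmul p q => simp
  simp only [letterBracket, map_sub, hc, h]

/-- The path of a side. -/
def letterPath (n : ℕ) : Letter n → PathGroup n
  | (.left, i) => a n i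
  | (.bottom, i) => b n i
  | (.right, i) => c n i
  | (.top, i) => d n i

/-- The sides a_i and d_i share the edge ε̄_{i−1}, and c_i and d_i share ε_i. Every nonzero bracket
of edges involves edges occurring in the sides of a single face, so different faces decouple. -/
theorem _root_.IsDoubleDer.eval_letterPath {φ : PathGroup n →* Aˣ}
    {B : PathGroup n → PathGroup n → A ⊗[ℚ] A} (hB : IsDoubleDer φ B)
    (h : ∀ e f, B (FreeGroup.of e) (FreeGroup.of f) =
      edgeBracket (fun e => (φ (FreeGroup.of e) : A)) e f) (u v : Letter n) :
    B (letterPath n u) (letterPath n v) =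
      letterBracket (fun x => (φ (letterPath n x) : A)) u v := by
  obtain ⟨k, i⟩ := u
  obtain ⟨l, j⟩ := v
  by_cases hij : i = j
  · subst hij
    cases k <;> cases l <;>
    simp [letterPath, a, b, c, d, edge, hB.left, hB.right, hB.inv_left, hB.inv_right, h,
      edgeBracket, vertexBracket, letterBracket, halfLetterBracket, mul_assoc]
  · have hji : ¬ j = i := fun h => hij h.symm
    cases k <;> cases l <;>
    simp [letterPath, a, b, c, d, edge, hB.left, hB.right, hB.inv_left, hB.inv_right, h,
      edgeBracket, vertexBracket, letterBracket, halfLetterBracket, hij, hji]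

end Letters

/-! ### Based loops as words in the sides, and the contraction of the staircase -/

section Words

variable (n : ℕ)

/-- The group of paths of the gauge-fixed network, as Laurent monomials in the sides. -/
abbrev LetterGroup : Type := FreeGroup (Letter n)

/-- The staircase path `d_1 c_1 ⋯ d_k c_k`. -/
def stair : ℕ → LetterGroup n
  | 0 => 1
  | k + 1 => stair k * FreeGroup.of (.top, ((k + 1 : ℕ) : ZMod n)) *
      FreeGroup.of (.right, ((k + 1 : ℕ) : ZMod n))

variable {n}

/-- The path along the staircase from the base point to a vertex. -/
def treePath : Vertex n → LetterGroup n
  | .black i => stair n (i - 1).val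
  | .white i => stair n (i - 1).val * FreeGroup.of (.top, i)

/-- The generating based loops, as words in the sides. -/
def word : LoopGen n → LetterGroup n
  | .X i => treePath (.white (i - 2)) * (FreeGroup.of (.left, i) *
      (FreeGroup.of (.right, i - 1))⁻¹ * (FreeGroup.of (.top, i - 1))⁻¹ *
      (FreeGroup.of (.right, i - 2))⁻¹) * (treePath (.white (i - 2)))⁻¹
  | .Y i => treePath (.white (i - 2)) * (FreeGroup.of (.bottom, i) * (FreeGroup.of (.right, i))⁻¹ *
      (FreeGroup.of (.top, i))⁻¹ * (FreeGroup.of (.right, i - 1))⁻¹ *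
      (FreeGroup.of (.top, i - 1))⁻¹ * (FreeGroup.of (.right, i - 2))⁻¹) *
      (treePath (.white (i - 2)))⁻¹
  | .Z => stair n n

/-- The inclusion of the group of based loops. -/
def wordHom : FreeGroup (LoopGen n) →* LetterGroup n := FreeGroup.lift word

/-- How often the sides wind around the staircase. -/
def winding : Letter n → ℕ
  | (.left, i) => (if i - 2 = 0 then 1 else 0) + if i - 1 = 0 then 1 else 0
  | (.bottom, i) =>
      ((if i - 2 = 0 then 1 else 0) + if i - 1 = 0 then 1 else 0) + if i = 0 then 1 else 0
  | (.right, i) => if i = 0 then 1 else 0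
  | (.top, _) => 0

/-- The based loop of a side, up to powers of `Z`. -/
def sideLoop : Letter n → FreeGroup (LoopGen n)
  | (.left, i) => FreeGroup.of (.X i)
  | (.bottom, i) => FreeGroup.of (.Y i)
  | (.right, _) => 1
  | (.top, _) => 1

/-- The gauge transformation which contracts the staircase. -/
def contract : LetterGroup n →* FreeGroup (LoopGen n) :=
  FreeGroup.lift fun u => sideLoop u * FreeGroup.of .Z ^ winding u

variable [NeZero n]

/-- The side c_i is the next step of the staircase, except for i = n, that is i = 0 in ℤ/n, where
the staircase closes up and one factor Z = d₁c₁⋯d_nc_n splits off. -/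
theorem treePath_white_mul_right (i : ZMod n) :
    treePath (.white i) * FreeGroup.of (.right, i) =
      stair n n ^ (if i = 0 then 1 else 0) * treePath (.black (i + 1)) := by
  have hc : (((i - 1).val + 1 : ℕ) : ZMod n) = i := by simp
  have h : treePath (.white i) * FreeGroup.of (.right, i) = stair n ((i - 1).val + 1) := by
    rw [stair, hc]; rfl
  have hlt : (i - 1).val < n := ZMod.val_lt _
  have hv : i.val = ((i - 1).val + 1) % n := by rw [← ZMod.val_natCast, hc]
  rw [h, treePath, add_sub_cancel_right]
  -- The two cases separate an ordinary step from the wrap-around, which occurs exactly when i = 0.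
  rcases Nat.lt_or_ge ((i - 1).val + 1) n with hk | hk
  · rw [Nat.mod_eq_of_lt hk] at hv
    have hi : i ≠ 0 := by
      rintro rfl
      simp at hv
    simp [hi, hv]
  · have hk' : (i - 1).val + 1 = n := by omega
    rw [hk', Nat.mod_self] at hv
    rw [hk', if_pos ((ZMod.val_eq_zero i).1 hv), hv]
    simp [stair]

/-- The loop X_i or Y_i returns along the staircase after the side a_i or b_i. Expressing each c and
d through tree paths makes the return telescope, and each passage through c_n costs a factor Z. This
is what `winding` counts. -/
theorem treePath_conj (u : Letter n) :
    treePath (source u) * FreeGroup.of u * (treePath (target u))⁻¹ =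
      wordHom (sideLoop u) * stair n n ^ winding u := by
  have hr (i : ZMod n) : FreeGroup.of (.right, i) = (treePath (.white i))⁻¹ *
      (stair n n ^ (if i = 0 then 1 else 0) * treePath (.black (i + 1))) := by
    rw [← treePath_white_mul_right, inv_mul_cancel_left]
  have ht (i : ZMod n) : FreeGroup.of (.top, i) =
      (treePath (.black i))⁻¹ * treePath (.white i) := by
    rw [eq_inv_mul_iff_mul_eq]; rfl
  obtain ⟨k, i⟩ := u
  have e1 : i - 1 + 1 = i := by ring
  have e2 : i - 2 + 1 = i - 1 := by ring
  cases k with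
  | left =>
    simp only [source, target, sideLoop, winding, wordHom, FreeGroup.lift_apply_of, word, hr, ht,
      e1, e2, pow_add]
    group
  | bottom =>
    simp only [source, target, sideLoop, winding, wordHom, FreeGroup.lift_apply_of, word, hr, ht,
      e1, e2, pow_add]
    group
  | right =>
    simp only [source, target, sideLoop, winding, hr, map_one]
    group
  | top =>
    simp only [source, target, sideLoop, winding, ht, map_one]
    group

theorem wordHom_contract_of (u : Letter n) :
    wordHom (contract (FreeGroup.of u)) =
      treePath (source u) * FreeGroup.of u * (treePath (target u))⁻¹ := by
  simp [treePath_conj, contract, wordHom, word]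

/-- The tree paths at interior vertices cancel. In particular a loop at the base point, whose tree
path is trivial, is fixed by contraction followed by inclusion. -/
theorem wordHom_contract_of_isPath {x y : Vertex n} {g : LetterGroup n}
    (h : IsPath source target x y g) :
    wordHom (contract g) = treePath x * g * (treePath y)⁻¹ := by
  induction h with
  | refl x => simp
  | of u => exact wordHom_contract_of u
  | inv _ ih => rw [map_inv, map_inv, ih]; group
  | mul _ _ ih1 ih2 => rw [map_mul, map_mul, ih1, ih2]; group

omit [NeZero n] in
theorem isPath_stair (k : ℕ) :
    IsPath source target (.black 1) (.black ((k : ZMod n) + 1)) (stair n k) := by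
  induction k with
  | zero =>
    rw [Nat.cast_zero, zero_add]
    exact IsPath.refl _
  | succ k ih =>
    rw [← Nat.cast_succ] at ih
    exact (ih.mul (IsPath.of (Side.top, ((k + 1 : ℕ) : ZMod n)))).mul (IsPath.of (Side.right, _))

theorem isPath_treePath (x : Vertex n) : IsPath source target (.black 1) x (treePath x) := by
  have h (i : ZMod n) :
      IsPath source target (.black 1) (.black i) (stair n (i - 1).val) := by
    simpa using isPath_stair (n := n) (i - 1).val
  cases x with
  | black i => exact h i
  | white i => exact (h i).mul (IsPath.of (Side.top, i))

/-- The base point. -/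
abbrev basePoint (n : ℕ) : Vertex n := .black 1

theorem isPath_word (x : LoopGen n) :
    IsPath source target (basePoint n) (basePoint n) (word x) := by
  have hl (i : ZMod n) :
      IsPath source target (.white (i - 2)) (.black i) (FreeGroup.of (.left, i)) :=
    IsPath.of (Side.left, i)
  have hb (i : ZMod n) :
      IsPath source target (.white (i - 2)) (.black (i + 1)) (FreeGroup.of (.bottom, i)) :=
    IsPath.of (Side.bottom, i)
  have hr (i : ZMod n) :
      IsPath source target (.black (i + 1)) (.white i) (FreeGroup.of (.right, i))⁻¹ :=
    (IsPath.of (Side.right, i)).inv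
  have ht (i : ZMod n) :
      IsPath source target (.white i) (.black i) (FreeGroup.of (.top, i))⁻¹ :=
    (IsPath.of (Side.top, i)).inv
  have hr1 (i : ZMod n) :
      IsPath source target (.black i) (.white (i - 1)) (FreeGroup.of (.right, i - 1))⁻¹ := by
    simpa using hr (i - 1)
  have hr2 (i : ZMod n) :
      IsPath source target (.black (i - 1)) (.white (i - 2)) (FreeGroup.of (.right, i - 2))⁻¹ := by
    have e : i - 2 + 1 = i - 1 := by ring
    simpa [e] using hr (i - 2)
  have hp := isPath_treePath (n := n)
  cases x with
  | X i =>
    exact ((hp _).mul ((((hl i).mul (hr1 i)).mul (ht (i - 1))).mul (hr2 i))).mul (hp _).inv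
  | Y i =>
    exact ((hp _).mul ((((((hb i).mul (hr i)).mul (ht i)).mul (hr1 i)).mul (ht (i - 1))).mul
      (hr2 i))).mul (hp _).inv
  | Z => simpa [word] using isPath_stair (n := n) n

theorem isPath_wordHom (g : FreeGroup (LoopGen n)) :
    IsPath source target (basePoint n) (basePoint n) (wordHom g) := by
  induction g using FreeGroup.induction_on with
  | C1 => simpa using IsPath.refl _
  | of x => simpa [wordHom] using isPath_word x
  | inv_of x h => simpa using h.inv
  | mul g h hg hh => simpa using hg.mul hh

omit [NeZero n] in
@[simp]
theorem treePath_basePoint : treePath (basePoint n) = 1 := by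
  simp [treePath, stair]

end Words
end PentagramNetwork

/-! ### Evaluation of group algebras -/

section Eval

variable {G : Type} [Group G] {A : Type} [Ring A] [Algebra ℚ A]

/-- The elements of a group, as invertible elements of the group algebra. -/
def groupUnits (G : Type) [Group G] : G →* (MonoidAlgebra ℚ G)ˣ :=
  (Units.map (MonoidAlgebra.of ℚ G)).comp toUnits.toMonoidHom

@[simp]
theorem val_groupUnits (g : G) : (groupUnits G g : MonoidAlgebra ℚ G) = MonoidAlgebra.of ℚ G g :=
  rfl

/-- The algebra homomorphism on a group algebra induced by a homomorphism to units. -/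
def evalUnits (φ : G →* Aˣ) : MonoidAlgebra ℚ G →ₐ[ℚ] A :=
  MonoidAlgebra.lift ℚ A G ((Units.coeHom A).comp φ)

theorem evalUnits_of (φ : G →* Aˣ) (g : G) : evalUnits φ (MonoidAlgebra.of ℚ G g) = φ g := by
  simp [evalUnits]

end Eval

/-! ### Almost Poisson homomorphisms and induced brackets of loops -/

namespace PentagramNetwork

variable {n : ℕ} {A : Type} [Ring A] [Algebra ℚ A]

/-- A homomorphism from the group of paths of the gauge-fixed network to the units of an algebra is
almost Poisson for a double bracket if it preserves the double brackets of the sides, up to products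
with the derivations `endDer`. -/
def IsAlmostPoisson [NeZero n] (D : A →ₗ[ℚ] A →ₗ[ℚ] A ⊗[ℚ] A) (ψ : LetterGroup n →* Aˣ) : Prop :=
  ∃ Θ Θ' : Vertex n → Letter n → A ⊗[ℚ] A, ∀ u v,
    D (ψ (FreeGroup.of u) : A) (ψ (FreeGroup.of v) : A) =
      letterBracket (fun x => (ψ (FreeGroup.of x) : A)) u v +
        ∑ p, (swapMul (endDer source target ψ p u) (Θ p v) +
          swapMul (Θ' p u) (endDer source target ψ p v))

variable (n)

/-- The double bracket on the Laurent polynomials in the sides. -/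
def sideBracket [NeZero n] : MonoidAlgebra ℚ (LetterGroup n) →ₗ[ℚ]
    MonoidAlgebra ℚ (LetterGroup n) →ₗ[ℚ]
      MonoidAlgebra ℚ (LetterGroup n) ⊗[ℚ] MonoidAlgebra ℚ (LetterGroup n) :=
  groupBracket (letterBracket fun u => MonoidAlgebra.of ℚ (LetterGroup n) (FreeGroup.of u))

theorem sideBracket_isDoubleBracket [NeZero n] : IsDoubleBracket (sideBracket n) :=
  groupBracket_isDoubleBracket _ (letterBracket_skew _)

variable {n} [NeZero n]

/-- The image of the double bracket on Laurent polynomials in the sides. -/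
def evalSideBracket (ψ : LetterGroup n →* Aˣ) (g h : LetterGroup n) : A ⊗[ℚ] A :=
  Algebra.TensorProduct.map (evalUnits ψ) (evalUnits ψ)
    (sideBracket n (MonoidAlgebra.of ℚ _ g) (MonoidAlgebra.of ℚ _ h))

theorem evalSideBracket_isDoubleDer (ψ : LetterGroup n →* Aˣ) :
    IsDoubleDer ψ (evalSideBracket ψ) :=
  (sideBracket_isDoubleBracket n).isDoubleDer_map (evalUnits ψ) (groupUnits _) ψ (evalUnits_of ψ)

theorem evalSideBracket_of (ψ : LetterGroup n →* Aˣ) (u v : Letter n) :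
    evalSideBracket ψ (FreeGroup.of u) (FreeGroup.of v) =
      letterBracket (fun x => (ψ (FreeGroup.of x) : A)) u v := by
  rw [evalSideBracket, sideBracket, groupBracket_of, map_letterBracket]
  simp only [evalUnits_of]

theorem evalSideBracket_skew (ψ : LetterGroup n →* Aˣ) (g h : LetterGroup n) :
    evalSideBracket ψ h g = -TensorProduct.comm ℚ A A (evalSideBracket ψ g h) :=
  (evalSideBracket_isDoubleDer ψ).ext (evalSideBracket_isDoubleDer ψ).transpose
    (fun u v => by simp only [evalSideBracket_of, ← letterBracket_skew]) h g

theorem mul'_evalSideBracket (ψ : LetterGroup n →* Aˣ) (g h : LetterGroup n) :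
    LinearMap.mul' ℚ A (evalSideBracket ψ g h) =
      evalUnits ψ (singleBracket (sideBracket n) (MonoidAlgebra.of ℚ _ g)
        (MonoidAlgebra.of ℚ _ h)) := by
  rw [evalSideBracket, singleBracket]
  generalize sideBracket n (MonoidAlgebra.of ℚ _ g) (MonoidAlgebra.of ℚ _ h) = x
  induction x using TensorProduct.induction_on with
  | zero => simp
  | add x y hx hy => simp only [map_add, hx, hy]
  | tmul p q => simp

/-- The defining identity of `IsAlmostPoisson` compares two double derivations on generators, hence
holds on all paths. On loops at x only the correction at p = x survives; its first product vanishes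
after multiplication, its second modulo commutators. -/
theorem inducedBracket_of_isPath {D : A →ₗ[ℚ] A →ₗ[ℚ] A ⊗[ℚ] A} (hD : IsDoubleBracket D)
    {ψ : LetterGroup n →* Aˣ} (hψ : IsAlmostPoisson D ψ) {x : Vertex n} {g h : LetterGroup n}
    (hg : IsPath source target x x g) (hh : IsPath source target x x h) :
    inducedBracket D (ψ g : A) (ψ h : A) = cyclicClass (evalUnits ψ
      (singleBracket (sideBracket n) (MonoidAlgebra.of ℚ _ g) (MonoidAlgebra.of ℚ _ h))) := by
  obtain ⟨Θ, Θ', H⟩ := hψ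
  have key := (hD.isDoubleDer ψ).ext ((evalSideBracket_isDoubleDer ψ).add
    (IsDoubleDer.sum Finset.univ fun p =>
      ((outerDer_isOuterDer ψ (endDer source target ψ p)).swapMul
        (outerDer_isOuterDer ψ (Θ p))).add
      ((outerDer_isOuterDer ψ (Θ' p)).swapMul
        (outerDer_isOuterDer ψ (endDer source target ψ p)))))
    (by simpa [evalSideBracket_of] using H) g h
  rw [inducedBracket, singleBracket, key, ← mul'_evalSideBracket, map_add, map_add, map_sum,
    map_sum, add_eq_left]
  refine Finset.sum_eq_zero fun p _ => ?_
  rw [hg.outerDer_endDer, hh.outerDer_endDer]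
  split_ifs
  · rw [map_add, map_add, mul'_swapMul_inner_left, cyclicClass_mul'_swapMul_inner_right]
    simp
  · simp

/-! ### The bracket on the algebra of based loops -/

/-- The elements of the algebra of based loops, as Laurent polynomials in the sides. -/
def wordAlg (n : ℕ) : LoopAlgebra n →ₐ[ℚ] MonoidAlgebra ℚ (LetterGroup n) :=
  evalUnits ((groupUnits _).comp wordHom)

/-- The contraction of the staircase on the Laurent polynomials in the sides. -/
def contractAlg (n : ℕ) : MonoidAlgebra ℚ (LetterGroup n) →ₐ[ℚ] LoopAlgebra n :=
  evalUnits ((groupUnits _).comp contract)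

/-- The single bracket on the algebra of based loops. -/
def loopBracket (f g : LoopAlgebra n) : LoopAlgebra n :=
  contractAlg n (singleBracket (sideBracket n) (wordAlg n f) (wordAlg n g))

/-- The tensor product of the images of two monomials. -/
def monomialTensor (ι : LetterGroup n →* Aˣ) (g h : LetterGroup n) : A ⊗[ℚ] A :=
  (ι g : A) ⊗ₜ[ℚ] (ι h : A)

omit [NeZero n] in
theorem monomialTensor_mul (ι : LetterGroup n →* Aˣ) (g h g' h' : LetterGroup n) :
    monomialTensor ι g h * monomialTensor ι g' h' = monomialTensor ι (g * g') (h * h') := by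
  simp only [monomialTensor, Algebra.TensorProduct.tmul_mul_tmul, map_mul, Units.val_mul]

omit [NeZero n] in
theorem monomialTensor_mul_assoc (ι : LetterGroup n →* Aˣ) (g h g' h' : LetterGroup n)
    (x : A ⊗[ℚ] A) :
    monomialTensor ι g h * (monomialTensor ι g' h' * x) =
      monomialTensor ι (g * g') (h * h') * x := by
  rw [← mul_assoc, monomialTensor_mul]

omit [NeZero n] in
theorem comm_monomialTensor (ι : LetterGroup n →* Aˣ) (g h : LetterGroup n) :
    TensorProduct.comm ℚ _ _ (monomialTensor ι g h) = monomialTensor ι h g := by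
  simp [monomialTensor]

/-- In every term the left tensor factor is a path from the start of `v` to the end of `u`, and the
right one a path from the start of `u` to the end of `v`. A trivial factor 1 occurs only where these
two vertices coincide. -/
theorem halfLetterBracket_gauge (ι : LetterGroup n →* Aˣ) (u v : Letter n) :
    halfLetterBracket (fun x => (ι (wordHom (contract (FreeGroup.of x))) : A)) u v =
      monomialTensor ι (treePath (source v)) (treePath (source u)) *
        halfLetterBracket (fun x => (ι (FreeGroup.of x) : A)) u v *
          monomialTensor ι (treePath (target u))⁻¹ (treePath (target v))⁻¹ := by
  obtain ⟨k, i⟩ := u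
  obtain ⟨l, j⟩ := v
  by_cases hij : i = j
  · subst hij
    cases k <;> cases l <;>
    simp [halfLetterBracket, wordHom_contract_of, monomialTensor, source, target, mul_assoc]
  · cases k <;> cases l <;> simp [halfLetterBracket, hij]

theorem letterBracket_gauge (ι : LetterGroup n →* Aˣ) (u v : Letter n) :
    letterBracket (fun x => (ι (wordHom (contract (FreeGroup.of x))) : A)) u v =
      monomialTensor ι (treePath (source v)) (treePath (source u)) *
        letterBracket (fun x => (ι (FreeGroup.of x) : A)) u v *
          monomialTensor ι (treePath (target u))⁻¹ (treePath (target v))⁻¹ := by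
  simp only [letterBracket, halfLetterBracket_gauge, comm_mul, comm_monomialTensor, mul_sub,
    sub_mul]

/-- The double derivations `B` and `C` on a pair of paths agree up to the gauge transformation by
the staircase. -/
def IsGauged (ι : LetterGroup n →* Aˣ) (B C : LetterGroup n → LetterGroup n → A ⊗[ℚ] A)
    (x y x' y' : Vertex n) (g g' : LetterGroup n) : Prop :=
  B g g' = monomialTensor ι (treePath x') (treePath x) * C g g' *
    monomialTensor ι (treePath y)⁻¹ (treePath y')⁻¹

/-- Under the Leibniz rule the tree path ending one piece meets the inverse tree path starting the
next, so the relation passes from sides to paths in the second argument. -/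
theorem IsGauged.path_right {ι : LetterGroup n →* Aˣ}
    {B C : LetterGroup n → LetterGroup n → A ⊗[ℚ] A}
    (hB : IsDoubleDer (ι.comp (wordHom.comp contract)) B) (hC : IsDoubleDer ι C)
    {x y x' y' : Vertex n} {g g' : LetterGroup n}
    (hg : ∀ u, IsGauged ι B C x y (source u) (target u) g (FreeGroup.of u))
    (hg' : IsPath source target x' y' g') : IsGauged ι B C x y x' y' g g' := by
  have e1 : ∀ a : LetterGroup n, (ι a : A) ⊗ₜ[ℚ] (1 : A) = monomialTensor ι a 1 := fun _ => by
    simp [monomialTensor]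
  have e2 : ∀ a : LetterGroup n, (1 : A) ⊗ₜ[ℚ] (ι a : A) = monomialTensor ι 1 a := fun _ => by
    simp [monomialTensor]
  unfold IsGauged at hg ⊢
  induction hg' with
  | refl x =>
    rw [hB.one_right, hC.one_right]
    simp
  | of u => exact hg u
  | @inv _ _ h hp ih =>
    rw [hB.inv_right, hC.inv_right, ih]
    simp only [MonoidHom.comp_apply, map_inv wordHom, map_inv contract,
      wordHom_contract_of_isPath hp, e1, e2, mul_neg, neg_mul, mul_assoc, monomialTensor_mul,
      monomialTensor_mul_assoc, mul_inv_rev, inv_inv, inv_mul_cancel, inv_mul_cancel_left, mul_one,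
      one_mul]
  | @mul _ _ _ h k hp hq ih1 ih2 =>
    rw [hB.right, hC.right, ih1, ih2]
    simp only [MonoidHom.comp_apply, wordHom_contract_of_isPath hp, wordHom_contract_of_isPath hq,
      e1, e2, mul_add, add_mul, mul_assoc, monomialTensor_mul, monomialTensor_mul_assoc,
      inv_mul_cancel, inv_mul_cancel_left, mul_one, one_mul]

omit [NeZero n] in
theorem IsGauged.swap {ι : LetterGroup n →* Aˣ} {B C : LetterGroup n → LetterGroup n → A ⊗[ℚ] A}
    (hB : ∀ g h, B h g = -TensorProduct.comm ℚ A A (B g h))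
    (hC : ∀ g h, C h g = -TensorProduct.comm ℚ A A (C g h))
    {x x' y y' : Vertex n} {g g' : LetterGroup n} (h : IsGauged ι B C x y x' y' g g') :
    IsGauged ι B C x' y' x y g' g := by
  unfold IsGauged at h ⊢
  rw [hB, h, hC g g']
  simp only [comm_mul, comm_monomialTensor, mul_neg, neg_mul]

theorem evalSideBracket_gauge (ι : LetterGroup n →* Aˣ) {x x' y y' : Vertex n}
    {g g' : LetterGroup n} (hg : IsPath source target x y g)
    (hg' : IsPath source target x' y' g') :
    IsGauged ι (evalSideBracket (ι.comp (wordHom.comp contract))) (evalSideBracket ι)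
      x y x' y' g g' := by
  have hr := @IsGauged.path_right n A _ _ _ ι _ _
    (evalSideBracket_isDoubleDer (ι.comp (wordHom.comp contract))) (evalSideBracket_isDoubleDer ι)
  have hs := @IsGauged.swap n A _ _ ι _ _
    (evalSideBracket_skew (ι.comp (wordHom.comp contract))) (evalSideBracket_skew ι)
  -- Extension along paths is available only on the right, so the first argument is extended after
  -- swapping the pair, and then the second.
  refine hr (fun u => hs (hr (fun v => ?_) hg)) hg'
  unfold IsGauged
  rw [evalSideBracket_of, evalSideBracket_of]
  exact letterBracket_gauge ι u v

/-- The gauge factors are tree paths at the base point, which are trivial, so contracting the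
staircase does not change the bracket of two based loops. -/
theorem evalUnits_contract (ι : LetterGroup n →* Aˣ) {g g' : LetterGroup n}
    (hg : IsPath source target (basePoint n) (basePoint n) g)
    (hg' : IsPath source target (basePoint n) (basePoint n) g') :
    evalUnits (ι.comp (wordHom.comp contract)) (singleBracket (sideBracket n)
        (MonoidAlgebra.of ℚ _ g) (MonoidAlgebra.of ℚ _ g')) =
      evalUnits ι (singleBracket (sideBracket n)
        (MonoidAlgebra.of ℚ _ g) (MonoidAlgebra.of ℚ _ g')) := by
  rw [← mul'_evalSideBracket, ← mul'_evalSideBracket, evalSideBracket_gauge ι hg hg',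
    treePath_basePoint, inv_one, monomialTensor, map_one, Units.val_one,
    ← Algebra.TensorProduct.one_def, one_mul, mul_one]

omit [NeZero n] in
theorem evalUnits_groupUnits (x : MonoidAlgebra ℚ (LetterGroup n)) :
    evalUnits (groupUnits (LetterGroup n)) x = x := by
  induction x using MonoidAlgebra.induction_on with
  | of g => exact evalUnits_of _ g
  | add x y hx hy => simp only [map_add, hx, hy]
  | smul r x hx => simp only [map_smul, hx]

omit [NeZero n] in
theorem wordAlg_contractAlg (x : MonoidAlgebra ℚ (LetterGroup n)) :
    wordAlg n (contractAlg n x) =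
      evalUnits ((groupUnits (LetterGroup n)).comp (wordHom.comp contract)) x := by
  induction x using MonoidAlgebra.induction_on with
  | of g => simp [wordAlg, contractAlg, evalUnits_of, -MonoidAlgebra.of_apply]
  | add x y hx hy => simp only [map_add, hx, hy]
  | smul r x hx => simp only [map_smul, hx]

omit [NeZero n] in
theorem wordAlg_of (g : FreeGroup (LoopGen n)) :
    wordAlg n (MonoidAlgebra.of ℚ _ g) = MonoidAlgebra.of ℚ _ (wordHom g) := evalUnits_of _ _

/-- This is closure of the algebra of based loops under the single bracket: the bracket of two based
loops is unchanged by `wordHom.comp contract`, hence lies in the image of `wordAlg`. -/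
theorem wordAlg_loopBracket (f g : LoopAlgebra n) :
    wordAlg n (loopBracket f g) = singleBracket (sideBracket n) (wordAlg n f) (wordAlg n g) := by
  rw [loopBracket, wordAlg_contractAlg]
  induction f using MonoidAlgebra.induction_on with
  | of f =>
    induction g using MonoidAlgebra.induction_on with
    | of g =>
      rw [wordAlg_of, wordAlg_of, evalUnits_contract _ (isPath_wordHom f) (isPath_wordHom g),
        evalUnits_groupUnits]
    | add x y hx hy => simp only [singleBracket, map_add] at hx hy ⊢; rw [hx, hy]
    | smul r x hx => simp only [singleBracket, map_smul] at hx ⊢; rw [hx]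
  | add x y hx hy => simp only [singleBracket, map_add, LinearMap.add_apply] at hx hy ⊢; rw [hx, hy]
  | smul r x hx => simp only [singleBracket, map_smul, LinearMap.smul_apply] at hx ⊢; rw [hx]

omit [NeZero n] in
theorem evalGroupAlgebra_eq_conj {ψ : LetterGroup n →* Aˣ} {p : Aˣ} {θ : LoopGen n → Aˣ}
    (hθ : ∀ x, θ x = p * ψ (word x) * p⁻¹) (f : LoopAlgebra n) :
    evalGroupAlgebra θ f = p * evalUnits ψ (wordAlg n f) * ((p⁻¹ : Aˣ) : A) := by
  have h : ∀ g, FreeGroup.lift θ g = p * ψ (wordHom g) * p⁻¹ := by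
    intro g
    have : FreeGroup.lift θ = (MulAut.conj p).toMonoidHom.comp (ψ.comp wordHom) := by
      ext x
      simp [hθ, wordHom]
    rw [this]
    simp
  induction f using MonoidAlgebra.induction_on with
  | of g => rw [evalGroupAlgebra_of, wordAlg_of, evalUnits_of, h]; simp
  | add x y hx hy => simp only [map_add, hx, hy, mul_add, add_mul]
  | smul r x hx => simp only [map_smul, hx, mul_smul_comm, smul_mul_assoc]

/-- This is the common source of all the induced bracket identities. Conjugation by `p` drops out on
both sides, and what remains is the statement for loops. -/
theorem inducedBracket_evalGroupAlgebra {D : A →ₗ[ℚ] A →ₗ[ℚ] A ⊗[ℚ] A} (hD : IsDoubleBracket D)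
    {ψ : LetterGroup n →* Aˣ} (hψ : IsAlmostPoisson D ψ) {p : Aˣ} {θ : LoopGen n → Aˣ}
    (hθ : ∀ x, θ x = p * ψ (word x) * p⁻¹) (f g : LoopAlgebra n) :
    inducedBracket D (evalGroupAlgebra θ f) (evalGroupAlgebra θ g) =
      cyclicClass (evalGroupAlgebra θ (loopBracket f g)) := by
  simp only [evalGroupAlgebra_eq_conj hθ]
  rw [inducedBracket_conj hD, cyclicClass_conj, wordAlg_loopBracket]
  induction f using MonoidAlgebra.induction_on with
  | of f =>
    induction g using MonoidAlgebra.induction_on with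
    | of g =>
      rw [wordAlg_of, wordAlg_of, evalUnits_of, evalUnits_of,
        inducedBracket_of_isPath hD hψ (isPath_wordHom f) (isPath_wordHom g)]
    | add x y hx hy => simp only [inducedBracket, singleBracket, map_add] at hx hy ⊢; rw [hx, hy]
    | smul r x hx => simp only [inducedBracket, singleBracket, map_smul] at hx ⊢; rw [hx]
  | add x y hx hy =>
    simp only [inducedBracket, singleBracket, map_add, LinearMap.add_apply] at hx hy ⊢; rw [hx, hy]
  | smul r x hx =>
    simp only [inducedBracket, singleBracket, map_smul, LinearMap.smul_apply] at hx ⊢; rw [hx]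

/-- Without correction terms the identity holds already for single brackets, before passing to the
cyclic space. -/
theorem evalUnits_loopBracket {D : A →ₗ[ℚ] A →ₗ[ℚ] A ⊗[ℚ] A} (hD : IsDoubleBracket D)
    {ψ : LetterGroup n →* Aˣ} (hψ : ∀ u v,
      D (ψ (FreeGroup.of u) : A) (ψ (FreeGroup.of v) : A) =
        letterBracket (fun x => (ψ (FreeGroup.of x) : A)) u v)
    (f g : LoopAlgebra n) :
    evalUnits ψ (wordAlg n (loopBracket f g)) =
      singleBracket D (evalUnits ψ (wordAlg n f)) (evalUnits ψ (wordAlg n g)) := by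
  rw [wordAlg_loopBracket]
  induction f using MonoidAlgebra.induction_on with
  | of f =>
    induction g using MonoidAlgebra.induction_on with
    | of g =>
      rw [wordAlg_of, wordAlg_of, evalUnits_of, evalUnits_of, ← mul'_evalSideBracket, singleBracket,
        (evalSideBracket_isDoubleDer ψ).ext (hD.isDoubleDer ψ)
          (by simpa [evalSideBracket_of, eq_comm] using hψ)]
    | add x y hx hy => simp only [singleBracket, map_add] at hx hy ⊢; rw [hx, hy]
    | smul r x hx => simp only [singleBracket, map_smul] at hx ⊢; rw [hx]
  | add x y hx hy => simp only [singleBracket, map_add, LinearMap.add_apply] at hx hy ⊢; rw [hx, hy]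
  | smul r x hx => simp only [singleBracket, map_smul, LinearMap.smul_apply] at hx ⊢; rw [hx]

end PentagramNetwork

/-! ### The square move -/

section SquareMove

variable {G : Type} [Group G] {A : Type} [Ring A] [Algebra ℚ A]

/-- The brackets of the four sides `a`, `b`, `c`, `d` of a square face, and of the element
`e = b + a d c`. -/
structure IsFace (φ : G →* Aˣ) (B : G → G → A ⊗[ℚ] A) (a b c d e : G) : Prop where
  val_e : (φ b : A) = φ e - φ a * φ d * φ c
  e_left : ∀ g, B e g = B b g + B (a * d * c) g
  e_right : ∀ g, B g e = B g b + B g (a * d * c)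
  ba : B b a = (1 / 2 : ℚ) • ((φ b : A) ⊗ₜ[ℚ] (φ a : A))
  ab : B a b = -(1 / 2 : ℚ) • ((φ a : A) ⊗ₜ[ℚ] (φ b : A))
  bc : B b c = (1 / 2 : ℚ) • ((φ c : A) ⊗ₜ[ℚ] (φ b : A))
  cb : B c b = -(1 / 2 : ℚ) • ((φ b : A) ⊗ₜ[ℚ] (φ c : A))
  ad : B a d = (1 / 2 : ℚ) • ((1 : A) ⊗ₜ[ℚ] (φ a * φ d : A))
  da : B d a = -(1 / 2 : ℚ) • ((φ a * φ d : A) ⊗ₜ[ℚ] (1 : A))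
  cd : B c d = (1 / 2 : ℚ) • ((φ d * φ c : A) ⊗ₜ[ℚ] (1 : A))
  dc : B d c = -(1 / 2 : ℚ) • ((1 : A) ⊗ₜ[ℚ] (φ d * φ c : A))
  ac : B a c = 0
  ca : B c a = 0
  bd : B b d = 0
  db : B d b = 0
  aa : B a a = 0
  bb : B b b = 0
  cc : B c c = 0
  dd : B d d = 0

namespace IsFace

variable {φ : G →* Aˣ} {B : G → G → A ⊗[ℚ] A} {a b c d e : G}

/-- The face relations are stable under transposition, so each bracket computed once also gives the
bracket with its arguments exchanged. -/
theorem transpose (h : IsFace φ B a b c d e) :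
    IsFace φ (fun g h => -TensorProduct.comm ℚ A A (B h g)) a b c d e := by
  constructor <;>
    simp [h.val_e, h.e_left, h.e_right, h.ba, h.ab, h.bc, h.cb, h.ad, h.da, h.cd, h.dc, h.ac, h.ca,
      h.bd, h.db, h.aa, h.bb, h.cc, h.dd, add_comm]

variable (h : IsFace φ B a b c d e) (hB : IsDoubleDer φ B)
include h hB

theorem ea : B e a = (1 / 2 : ℚ) • ((φ b - φ a * φ d * φ c : A) ⊗ₜ[ℚ] (φ a : A)) := by
  simp only [h.e_left, hB.left, h.ba, h.da, h.aa, h.ca, map_mul, Units.val_mul,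
    TensorProduct.sub_tmul, mul_zero, zero_mul, add_zero, zero_add, smul_mul_assoc, mul_smul_comm,
    Algebra.TensorProduct.tmul_mul_tmul, mul_one, one_mul]
  module

theorem ec : B e c = (1 / 2 : ℚ) • ((φ c : A) ⊗ₜ[ℚ] (φ b - φ a * φ d * φ c : A)) := by
  simp only [h.e_left, hB.left, h.bc, h.dc, h.ac, h.cc, map_mul, Units.val_mul,
    TensorProduct.tmul_sub, mul_zero, zero_mul, add_zero, zero_add, smul_mul_assoc, mul_smul_comm,
    Algebra.TensorProduct.tmul_mul_tmul, mul_one, one_mul, mul_assoc]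
  module

theorem ed : B e d = (φ d * φ c : A) ⊗ₜ[ℚ] (φ a * φ d : A) := by
  simp only [h.e_left, hB.left, h.bd, h.ad, h.cd, h.dd, map_mul, Units.val_mul,
    mul_zero, zero_mul, add_zero, zero_add, smul_mul_assoc, mul_smul_comm,
    Algebra.TensorProduct.tmul_mul_tmul, mul_one, one_mul, mul_assoc]
  module

theorem eb : B e b = -(1 / 2 : ℚ) • ((φ a * φ d * φ c : A) ⊗ₜ[ℚ] (φ b : A) +
    (φ b : A) ⊗ₜ[ℚ] (φ a * φ d * φ c : A)) := by
  simp only [h.e_left, hB.left, h.bb, h.ab, h.cb, h.db, map_mul, Units.val_mul,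
    mul_zero, zero_mul, add_zero, zero_add, smul_mul_assoc, mul_smul_comm,
    Algebra.TensorProduct.tmul_mul_tmul, mul_one, one_mul, mul_assoc]
  module

theorem ee : B e e = 0 := by
  simp only [h.e_right e, hB.right, h.ea hB, h.eb hB, h.ec hB, h.ed hB, map_mul, Units.val_mul,
    mul_zero, zero_mul, add_zero, zero_add, smul_mul_assoc, mul_smul_comm, mul_add,
    TensorProduct.sub_tmul, TensorProduct.tmul_sub, mul_sub, sub_mul,
    Algebra.TensorProduct.tmul_mul_tmul, mul_one, one_mul, mul_assoc]
  module

/-- Replacing the weight of `b` by that of e − adc lets the factor `e` meet `e⁻¹`, after which the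
terms containing adc cancel. The same substitution drives the other brackets of the moved sides. -/
theorem e_aTilde : B e (d * c * e⁻¹) = (1 / 2 : ℚ) • ((φ d * φ c : A) ⊗ₜ[ℚ] (1 : A)) := by
  simp only [hB.right, hB.inv_right, h.ec hB, h.ed hB, h.ee hB, h.val_e, map_mul, Units.val_mul,
    mul_zero, zero_mul, add_zero, zero_add, smul_mul_assoc, mul_smul_comm, mul_add, neg_zero,
    TensorProduct.sub_tmul, TensorProduct.tmul_sub, mul_sub, sub_mul, add_mul,
    Algebra.TensorProduct.tmul_mul_tmul, mul_one, one_mul, mul_assoc, map_inv, Units.mul_inv]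
  module

theorem e_cTilde : B e (e⁻¹ * a * d) = (1 / 2 : ℚ) • ((1 : A) ⊗ₜ[ℚ] (φ a * φ d : A)) := by
  simp only [hB.right, hB.inv_right, h.ea hB, h.ed hB, h.ee hB, h.val_e, map_mul, Units.val_mul,
    mul_zero, zero_mul, add_zero, zero_add, smul_mul_assoc, mul_smul_comm, mul_add, neg_zero,
    TensorProduct.sub_tmul, TensorProduct.tmul_sub, mul_sub, sub_mul, add_mul,
    Algebra.TensorProduct.tmul_mul_tmul, mul_one, one_mul, mul_assoc, map_inv, Units.inv_mul]
  module

theorem e_dTilde : B e (d * c * e⁻¹ * b * c⁻¹) = 0 := by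
  simp only [hB.right, hB.inv_right, h.ec hB, h.ed hB, h.ee hB, h.eb hB, h.val_e, map_mul,
    Units.val_mul,
    mul_zero, zero_mul, add_zero, zero_add, smul_mul_assoc, mul_smul_comm, mul_add, neg_zero,
    TensorProduct.sub_tmul, TensorProduct.tmul_sub, mul_sub, sub_mul, add_mul, mul_neg, neg_mul,
    Algebra.TensorProduct.tmul_mul_tmul, mul_one, one_mul, mul_assoc, map_inv, Units.inv_mul,
    Units.mul_inv, Units.inv_mul_cancel_left, Units.mul_inv_cancel_left]
  module

theorem ae : B a e = -(1 / 2 : ℚ) • ((φ a : A) ⊗ₜ[ℚ] (φ b - φ a * φ d * φ c : A)) := by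
  have key := h.transpose.ea hB.transpose
  apply (TensorProduct.comm ℚ A A).injective
  rw [neg_eq_iff_eq_neg.1 key]
  simp

theorem ce : B c e = -(1 / 2 : ℚ) • ((φ b - φ a * φ d * φ c : A) ⊗ₜ[ℚ] (φ c : A)) := by
  have key := h.transpose.ec hB.transpose
  apply (TensorProduct.comm ℚ A A).injective
  rw [neg_eq_iff_eq_neg.1 key]
  simp

theorem de : B d e = -((φ a * φ d : A) ⊗ₜ[ℚ] (φ d * φ c : A)) := by
  have key := h.transpose.ed hB.transpose
  apply (TensorProduct.comm ℚ A A).injective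
  rw [neg_eq_iff_eq_neg.1 key]
  simp

theorem be : B b e = (1 / 2 : ℚ) • ((φ a * φ d * φ c : A) ⊗ₜ[ℚ] (φ b : A) +
    (φ b : A) ⊗ₜ[ℚ] (φ a * φ d * φ c : A)) := by
  have key := h.transpose.eb hB.transpose
  apply (TensorProduct.comm ℚ A A).injective
  rw [neg_eq_iff_eq_neg.1 key]
  simp

/-- The brackets of the sides of the face after the square move. -/
theorem bracket_moved :
    B (d * c * e⁻¹) (d * c * e⁻¹) = 0 ∧
    B (e⁻¹ * a * d) (e⁻¹ * a * d) = 0 ∧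
    B (d * c * e⁻¹) (e⁻¹ * a * d) = 0 ∧
    B (d * c * e⁻¹ * b * c⁻¹) (d * c * e⁻¹ * b * c⁻¹) = 0 ∧
    B (d * c * e⁻¹) (d * c * e⁻¹ * b * c⁻¹) =
      (1 / 2 : ℚ) • ((φ (d * c * e⁻¹) : A) ⊗ₜ[ℚ] (φ (d * c * e⁻¹ * b * c⁻¹) : A)) ∧
    B (e⁻¹ * a * d) (d * c * e⁻¹ * b * c⁻¹) =
      (1 / 2 : ℚ) • ((φ (d * c * e⁻¹ * b * c⁻¹) : A) ⊗ₜ[ℚ] (φ (e⁻¹ * a * d) : A)) := by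
  refine ⟨?_, ?_, ?_, ?_, ?_, ?_⟩
  all_goals
    simp only [hB.right, hB.left, hB.inv_right, hB.inv_left, h.ea hB, h.eb hB, h.ec hB, h.ed hB,
      h.ee hB, h.ae hB, h.be hB, h.ce hB, h.de hB, h.aa, h.ab, h.ac, h.ad, h.ba, h.bb, h.bc, h.bd,
      h.ca, h.cb, h.cc, h.cd, h.da, h.db, h.dc, h.dd, h.val_e, map_mul, Units.val_mul,
      mul_zero, zero_mul, add_zero, zero_add, smul_mul_assoc, mul_smul_comm, mul_add, neg_zero,
      TensorProduct.sub_tmul, TensorProduct.tmul_sub, mul_sub, sub_mul, add_mul, mul_neg, neg_mul,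
      Algebra.TensorProduct.tmul_mul_tmul, mul_one, one_mul, mul_assoc, map_inv, Units.inv_mul,
      Units.mul_inv, Units.inv_mul_cancel_left, Units.mul_inv_cancel_left]
    module

theorem aTilde_aTilde : B (d * c * e⁻¹) (d * c * e⁻¹) = 0 :=
  (h.bracket_moved hB).1

theorem cTilde_cTilde : B (e⁻¹ * a * d) (e⁻¹ * a * d) = 0 :=
  (h.bracket_moved hB).2.1

theorem aTilde_cTilde : B (d * c * e⁻¹) (e⁻¹ * a * d) = 0 :=
  (h.bracket_moved hB).2.2.1

theorem dTilde_dTilde : B (d * c * e⁻¹ * b * c⁻¹) (d * c * e⁻¹ * b * c⁻¹) = 0 :=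
  (h.bracket_moved hB).2.2.2.1

theorem aTilde_dTilde : B (d * c * e⁻¹) (d * c * e⁻¹ * b * c⁻¹) =
    (1 / 2 : ℚ) • ((φ (d * c * e⁻¹) : A) ⊗ₜ[ℚ] (φ (d * c * e⁻¹ * b * c⁻¹) : A)) :=
  (h.bracket_moved hB).2.2.2.2.1

theorem cTilde_dTilde : B (e⁻¹ * a * d) (d * c * e⁻¹ * b * c⁻¹) =
    (1 / 2 : ℚ) • ((φ (d * c * e⁻¹ * b * c⁻¹) : A) ⊗ₜ[ℚ] (φ (e⁻¹ * a * d) : A)) :=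
  (h.bracket_moved hB).2.2.2.2.2

theorem dTilde_aTilde : B (d * c * e⁻¹ * b * c⁻¹) (d * c * e⁻¹) =
    -(1 / 2 : ℚ) • ((φ (d * c * e⁻¹ * b * c⁻¹) : A) ⊗ₜ[ℚ] (φ (d * c * e⁻¹) : A)) := by
  have key := h.transpose.aTilde_dTilde hB.transpose
  apply (TensorProduct.comm ℚ A A).injective
  rw [neg_eq_iff_eq_neg.1 key]
  simp

theorem dTilde_cTilde : B (d * c * e⁻¹ * b * c⁻¹) (e⁻¹ * a * d) =
    -(1 / 2 : ℚ) • ((φ (e⁻¹ * a * d) : A) ⊗ₜ[ℚ] (φ (d * c * e⁻¹ * b * c⁻¹) : A)) := by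
  have key := h.transpose.cTilde_dTilde hB.transpose
  apply (TensorProduct.comm ℚ A A).injective
  rw [neg_eq_iff_eq_neg.1 key]
  simp

theorem aTilde_e : B (d * c * e⁻¹) e = -(1 / 2 : ℚ) • ((1 : A) ⊗ₜ[ℚ] (φ d * φ c : A)) := by
  have key := h.transpose.e_aTilde hB.transpose
  apply (TensorProduct.comm ℚ A A).injective
  rw [neg_eq_iff_eq_neg.1 key]
  simp

theorem cTilde_e : B (e⁻¹ * a * d) e = -(1 / 2 : ℚ) • ((φ a * φ d : A) ⊗ₜ[ℚ] (1 : A)) := by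
  have key := h.transpose.e_cTilde hB.transpose
  apply (TensorProduct.comm ℚ A A).injective
  rw [neg_eq_iff_eq_neg.1 key]
  simp

theorem dTilde_e : B (d * c * e⁻¹ * b * c⁻¹) e = 0 := by
  have key := h.transpose.e_dTilde hB.transpose
  apply (TensorProduct.comm ℚ A A).injective
  rw [neg_eq_iff_eq_neg.1 key]
  simp

theorem cTilde_aTilde : B (e⁻¹ * a * d) (d * c * e⁻¹) = 0 := by
  have key := h.transpose.aTilde_cTilde hB.transpose
  apply (TensorProduct.comm ℚ A A).injective
  rw [neg_eq_iff_eq_neg.1 key]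
  simp

end IsFace

end SquareMove

section

variable {A : Type} [Ring A] [Algebra ℚ A]

theorem IsDoubleDer.eq_zero_of_mem_closure {G : Type} [Group G] {φ : G →* Aˣ}
    {B : G → G → A ⊗[ℚ] A} (hB : IsDoubleDer φ B) {S T : Set G}
    (h : ∀ x ∈ S, ∀ y ∈ T, B x y = 0) {g k : G} (hg : g ∈ Subgroup.closure S)
    (hk : k ∈ Subgroup.closure T) : B g k = 0 := by
  have hr : ∀ x ∈ S, B x k = 0 := by
    intro x hx
    induction hk using Subgroup.closure_induction with
    | mem y hy => exact h x hx y hy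
    | one => exact hB.one_right x
    | mul y z _ _ hy hz => rw [hB.right, hy, hz]; simp
    | inv y _ hy => rw [hB.inv_right, hy]; simp
  induction hg using Subgroup.closure_induction with
  | mem x hx => exact hr x hx
  | one => exact hB.one_left k
  | mul y z _ _ hy hz => rw [hB.left, hy, hz]; simp
  | inv y _ hy => rw [hB.inv_left, hy]; simp

/-- Only the two endpoints of the edge contribute to the sum over vertices. -/
theorem sum_swapMul_endDer_left {E V : Type} [Fintype V] [DecidableEq V] (s t : E → V)
    (φ : FreeGroup E →* Aˣ) (e : E) (x : V → A ⊗[ℚ] A) :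
    ∑ v, swapMul (endDer s t φ v e) (x v) =
      ((1 : A) ⊗ₜ[ℚ] (φ (FreeGroup.of e) : A)) * x (t e) -
        x (s e) * ((φ (FreeGroup.of e) : A) ⊗ₜ[ℚ] (1 : A)) := by
  have h : ∀ (p : Prop) [Decidable p] (y z : A ⊗[ℚ] A),
      swapMul (if p then y else 0) z = if p then swapMul y z else 0 := by
    intro p _ y z
    split_ifs <;> simp
  simp only [endDer, map_sub, LinearMap.sub_apply, Finset.sum_sub_distrib, h, Finset.sum_ite_eq,
    Finset.mem_univ, if_true, swapMul_tmul_one_left, swapMul_one_tmul_left]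

end

/-! ### Square moves on the whole network -/

namespace PentagramNetwork

variable {n : ℕ}

/-- The edges of the network together with the edges which appear in the square moves. -/
abbrev SquareLetter (n : ℕ) : Type := Letter n ⊕ ZMod n

/-- The initial vertex. -/
def squareSource : SquareLetter n → Vertex n := Sum.elim source fun i => source (.bottom, i)

/-- The final vertex. -/
def squareTarget : SquareLetter n → Vertex n := Sum.elim target fun i => target (.bottom, i)

/-- The sides of the faces after the square moves, renumbered with a shift by `k`. -/
def movedWord (k : ZMod n) : Letter n → FreeGroup (SquareLetter n)
  | (.left, i) => (FreeGroup.of (.inr (i - 2 + k)))⁻¹ *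
      FreeGroup.of (.inl (.left, i - 2 + k)) * FreeGroup.of (.inl (.top, i - 2 + k))
  | (.bottom, i) => FreeGroup.of (.inl (.top, i - 1 + k)) *
      FreeGroup.of (.inl (.right, i - 1 + k)) * (FreeGroup.of (.inr (i - 1 + k)))⁻¹ *
      FreeGroup.of (.inl (.bottom, i - 1 + k)) * (FreeGroup.of (.inl (.right, i - 1 + k)))⁻¹
  | (.right, i) => FreeGroup.of (.inl (.top, i + 1 + k)) *
      FreeGroup.of (.inl (.right, i + 1 + k)) * (FreeGroup.of (.inr (i + 1 + k)))⁻¹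
  | (.top, i) => FreeGroup.of (.inr (i + k))

/-- The face to which a side belongs before the renumbering. -/
def movedFace (k : ZMod n) : Letter n → ZMod n
  | (.left, i) => i - 2 + k
  | (.bottom, i) => i - 1 + k
  | (.right, i) => i + 1 + k
  | (.top, i) => i + k

/-- The effect of the square moves and of the renumbering on vertices. -/
def movedVertex (k : ZMod n) : Vertex n ≃ Vertex n where
  toFun
    | .white i => .black (i + 1 + k)
    | .black i => .white (i - 2 + k)
  invFun
    | .white i => .black (i + 2 - k)
    | .black i => .white (i - 1 - k)
  left_inv x := by cases x <;> simp <;> ring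
  right_inv x := by cases x <;> simp <;> ring

/-- The moved sides form the same quiver with the two colours of vertices exchanged. Consequently
the derivations ∂_p of the old network restrict to those of the new one. -/
theorem isPath_movedWord (k : ZMod n) (u : Letter n) :
    IsPath squareSource squareTarget (movedVertex k (source u)) (movedVertex k (target u))
      (movedWord k u) := by
  have ha (j : ZMod n) : IsPath squareSource squareTarget (.white (j - 2)) (.black j)
      (FreeGroup.of (.inl (.left, j))) := IsPath.of (Sum.inl (Side.left, j))
  have hb (j : ZMod n) : IsPath squareSource squareTarget (.white (j - 2)) (.black (j + 1))
      (FreeGroup.of (.inl (.bottom, j))) := IsPath.of (Sum.inl (Side.bottom, j))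
  have hc (j : ZMod n) : IsPath squareSource squareTarget (.white j) (.black (j + 1))
      (FreeGroup.of (.inl (.right, j))) := IsPath.of (Sum.inl (Side.right, j))
  have hd (j : ZMod n) : IsPath squareSource squareTarget (.black j) (.white j)
      (FreeGroup.of (.inl (.top, j))) := IsPath.of (Sum.inl (Side.top, j))
  have he (j : ZMod n) : IsPath squareSource squareTarget (.white (j - 2)) (.black (j + 1))
      (FreeGroup.of (.inr j)) := IsPath.of (Sum.inr j)
  obtain ⟨l, i⟩ := u
  cases l with
  | left =>
    change IsPath _ _ (Vertex.black (i - 2 + 1 + k)) (Vertex.white (i - 2 + k)) _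
    rw [show i - 2 + 1 + k = i - 2 + k + 1 by ring]
    exact ((he _).inv.mul (ha _)).mul (hd _)
  | bottom =>
    change IsPath _ _ (Vertex.black (i - 2 + 1 + k)) (Vertex.white (i + 1 - 2 + k)) _
    rw [show i - 2 + 1 + k = i - 1 + k by ring, show i + 1 - 2 + k = i - 1 + k by ring]
    exact ((((hd _).mul (hc _)).mul (he _).inv).mul (hb _)).mul (hc _).inv
  | right =>
    change IsPath _ _ (Vertex.black (i + 1 + k)) (Vertex.white (i + 1 - 2 + k)) _
    rw [show i + 1 - 2 + k = i + 1 + k - 2 by ring]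
    exact ((hd _).mul (hc _)).mul (he _).inv
  | top =>
    change IsPath _ _ (Vertex.white (i - 2 + k)) (Vertex.black (i + 1 + k)) _
    rw [show i - 2 + k = i + k - 2 by ring, show i + 1 + k = i + k + 1 by ring]
    exact he _

/-- The letters of a face. -/
def faceLetters (j : ZMod n) : Set (FreeGroup (SquareLetter n)) :=
  {g | g = FreeGroup.of (.inr j) ∨ ∃ k : Side, g = FreeGroup.of (.inl (k, j))}

theorem movedWord_mem (k : ZMod n) (u : Letter n) :
    movedWord k u ∈ Subgroup.closure (faceLetters (movedFace k u)) := by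
  have hl (l : Side) (j : ZMod n) :
      FreeGroup.of (.inl (l, j)) ∈ Subgroup.closure (faceLetters j) :=
    Subgroup.subset_closure (Or.inr ⟨l, rfl⟩)
  have he (j : ZMod n) : FreeGroup.of (.inr j) ∈ Subgroup.closure (faceLetters j) :=
    Subgroup.subset_closure (Or.inl rfl)
  obtain ⟨l, i⟩ := u
  cases l
  · exact mul_mem (mul_mem (inv_mem (he _)) (hl _ _)) (hl _ _)
  · exact mul_mem (mul_mem (mul_mem (mul_mem (hl _ _) (hl _ _)) (inv_mem (he _))) (hl _ _))
      (inv_mem (hl _ _))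
  · exact mul_mem (mul_mem (hl _ _) (hl _ _)) (inv_mem (he _))
  · exact he _

variable {A : Type} [Ring A] [Algebra ℚ A]

/-- The brackets of the letters, with a square face around each of the additional letters. -/
structure IsSquareNetwork (φ : FreeGroup (SquareLetter n) →* Aˣ)
    (B : FreeGroup (SquareLetter n) → FreeGroup (SquareLetter n) → A ⊗[ℚ] A) : Prop where
  isDoubleDer : IsDoubleDer φ B
  val (j : ZMod n) : (φ (FreeGroup.of (.inr j)) : A) = φ (FreeGroup.of (.inl (.bottom, j))) +
    φ (FreeGroup.of (.inl (.left, j))) * φ (FreeGroup.of (.inl (.top, j))) *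
      φ (FreeGroup.of (.inl (.right, j)))
  letters (u v : Letter n) : B (FreeGroup.of (.inl u)) (FreeGroup.of (.inl v)) =
    letterBracket (fun x => (φ (FreeGroup.of (.inl x)) : A)) u v
  left (j : ZMod n) (g : FreeGroup (SquareLetter n)) : B (FreeGroup.of (.inr j)) g =
    B (FreeGroup.of (.inl (.bottom, j))) g + B (FreeGroup.of (.inl (.left, j)) *
      FreeGroup.of (.inl (.top, j)) * FreeGroup.of (.inl (.right, j))) g
  right (j : ZMod n) (g : FreeGroup (SquareLetter n)) : B g (FreeGroup.of (.inr j)) =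
    B g (FreeGroup.of (.inl (.bottom, j))) + B g (FreeGroup.of (.inl (.left, j)) *
      FreeGroup.of (.inl (.top, j)) * FreeGroup.of (.inl (.right, j)))

namespace IsSquareNetwork

variable {φ : FreeGroup (SquareLetter n) →* Aˣ}
  {B : FreeGroup (SquareLetter n) → FreeGroup (SquareLetter n) → A ⊗[ℚ] A}

theorem isFace (h : IsSquareNetwork φ B) (j : ZMod n) :
    IsFace φ B (FreeGroup.of (.inl (.left, j))) (FreeGroup.of (.inl (.bottom, j)))
      (FreeGroup.of (.inl (.right, j))) (FreeGroup.of (.inl (.top, j)))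
      (FreeGroup.of (.inr j)) := by
  refine ⟨by rw [h.val]; simp, h.left j, h.right j, ?_, ?_, ?_, ?_, ?_, ?_, ?_, ?_, ?_, ?_, ?_, ?_,
    ?_, ?_, ?_, ?_⟩ <;> simp [h.letters, letterBracket, halfLetterBracket]

/-- The additional letter has the same brackets as b + adc, which involves only its own face; the
decoupling of faces then extends to all words in the letters. -/
theorem eq_zero_of_face_ne (h : IsSquareNetwork φ B) {i j : ZMod n} (hij : i ≠ j)
    {g k : FreeGroup (SquareLetter n)} (hg : g ∈ Subgroup.closure (faceLetters i))
    (hk : k ∈ Subgroup.closure (faceLetters j)) : B g k = 0 := by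
  have hB := h.isDoubleDer
  have h0 (p q : Side) : B (FreeGroup.of (.inl (p, i))) (FreeGroup.of (.inl (q, j))) = 0 := by
    rw [h.letters]
    cases p <;> cases q <;> simp [letterBracket, halfLetterBracket, hij, hij.symm]
  have h1 (p : Side) : B (FreeGroup.of (.inl (p, i))) (FreeGroup.of (.inr j)) = 0 := by
    rw [h.right, hB.right, hB.right]
    simp [h0]
  have h2 (q : Side) : B (FreeGroup.of (.inr i)) (FreeGroup.of (.inl (q, j))) = 0 := by
    rw [h.left, hB.left, hB.left]
    simp [h0]
  have h3 : B (FreeGroup.of (.inr i)) (FreeGroup.of (.inr j)) = 0 := by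
    rw [h.left, hB.left, hB.left]
    simp [h1]
  refine hB.eq_zero_of_mem_closure ?_ hg hk
  rintro x (rfl | ⟨p, rfl⟩) y (rfl | ⟨q, rfl⟩)
  · exact h3
  · exact h2 q
  · exact h1 p
  · exact h0 p q

/-- A weight which distinguishes the vertical from the horizontal sides. -/
def verticalWeight : Letter n → ℚ
  | (.left, _) => 1
  | (.bottom, _) => 0
  | (.right, _) => 1
  | (.top, _) => 0

/-- A vertical and a horizontal side can meet in two ways. For instance a left and a bottom side may
share their start or their end. `letterBracket` is supported on one kind of meeting, and the bracket
of the moved sides, which requires a common old face, on the other. The sum of ∂_p ⋆ ∂_p with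
coefficient ±1/2 exchanges the two contributions. For two vertical or two horizontal sides all terms
vanish. -/
theorem movedWord_eq [NeZero n] (h : IsSquareNetwork φ B) (k : ZMod n)
    {ψ : LetterGroup n →* Aˣ} (hψ : ∀ u, ψ (FreeGroup.of u) = φ (movedWord k u)) (u v : Letter n) :
    B (movedWord k u) (movedWord k v) =
      letterBracket (fun x => (ψ (FreeGroup.of x) : A)) u v +
        ((verticalWeight u - verticalWeight v) / 2) •
          ∑ p, swapMul (endDer source target ψ p u) (endDer source target ψ p v) := by
  have hf : movedFace k u ≠ movedFace k v → B (movedWord k u) (movedWord k v) = 0 := fun hne =>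
    h.eq_zero_of_face_ne hne (movedWord_mem k u) (movedWord_mem k v)
  have hB := h.isDoubleDer
  rw [sum_swapMul_endDer_left]
  obtain ⟨l, i⟩ := u
  obtain ⟨m, j⟩ := v
  have key (r : A ⊗[ℚ] A) (hr : movedFace k (l, i) = movedFace k (m, j) →
      B (movedWord k (l, i)) (movedWord k (m, j)) = r) :
      B (movedWord k (l, i)) (movedWord k (m, j)) =
        if movedFace k (l, i) = movedFace k (m, j) then r else 0 := by
    split_ifs with hh
    · exact hr hh
    · exact hf hh
  -- Coincidences of endpoints and of old faces are all written as conditions on `j`. For small n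
  -- several of them can hold at once, so each is split independently of the others.
  have e₁ : j + 1 = i ↔ j = i - 1 := eq_sub_iff_add_eq.symm
  have e₂ : j - 2 = i ↔ j = i + 2 := sub_eq_iff_eq_add
  rcases l with _ | _ | _ | _ <;> rcases m with _ | _ | _ | _
  · rw [key 0]
    · simp [letterBracket, halfLetterBracket, verticalWeight]
    · simp only [movedFace, movedWord]
      intro hh
      rw [hh]
      exact (h.isFace _).cTilde_cTilde hB
  -- The value on a common old face is expressed in the weights of the new sides, so that it can be
  -- compared with the term from the shared vertex.
  · rw [key (
        (1 / 2 : ℚ) • ((ψ (FreeGroup.of (Side.bottom, j)) : A) ⊗ₜ[ℚ]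
          (ψ (FreeGroup.of (Side.left, i)) : A)))]
    · have e : i - 2 + k = j - 1 + k ↔ j = i - 1 := by
        constructor <;> intro hh <;> linear_combination -hh
      simp only [movedFace, e, e₁, e₂, letterBracket, halfLetterBracket, verticalWeight, endDer,
        source, target, Vertex.black.injEq, Vertex.white.injEq, reduceCtorEq, if_false,
        add_left_inj, sub_left_inj, map_zero, sub_zero, zero_sub, zero_mul, mul_zero]
      rcases eq_or_ne i j with rfl | hij
      · simp only [if_true]
        split_ifs <;> simp
      · simp only [hij, hij.symm, if_false]
        split_ifs <;> simp
    · simp only [movedFace, hψ, movedWord]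
      intro hh
      rw [hh, (h.isFace _).cTilde_dTilde hB]
  · rw [key 0]
    · simp [letterBracket, halfLetterBracket, verticalWeight]
    · simp only [movedFace, movedWord]
      intro hh
      rw [hh]
      exact (h.isFace _).cTilde_aTilde hB
  · rw [key (
        -(1 / 2 : ℚ) • (((ψ (FreeGroup.of (Side.top, j)) : A) *
          (ψ (FreeGroup.of (Side.left, i)) : A)) ⊗ₜ[ℚ] (1 : A)))]
    · have e : i - 2 + k = j + k ↔ j = i - 2 := by
        constructor <;> intro hh <;> linear_combination -hh
      simp only [movedFace, e, e₁, e₂, letterBracket, halfLetterBracket, verticalWeight, endDer,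
        source, target, Vertex.black.injEq, Vertex.white.injEq, reduceCtorEq, if_false,
        add_left_inj, sub_left_inj, map_zero, sub_zero, zero_sub, zero_mul, mul_zero]
      rcases eq_or_ne i j with rfl | hij
      · simp only [if_true]
        split_ifs <;> simp <;> module
      · simp only [hij, hij.symm, if_false]
        split_ifs <;> simp
    · simp only [movedFace, hψ, movedWord]
      intro hh
      rw [hh, (h.isFace _).cTilde_e hB]
      simp [mul_assoc]
  · rw [key (
        -(1 / 2 : ℚ) • ((ψ (FreeGroup.of (Side.left, j)) : A) ⊗ₜ[ℚ]
          (ψ (FreeGroup.of (Side.bottom, i)) : A)))]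
    · have e : i - 1 + k = j - 2 + k ↔ j = i + 1 := by
        constructor <;> intro hh <;> linear_combination -hh
      simp only [movedFace, e, e₁, e₂, letterBracket, halfLetterBracket, verticalWeight, endDer,
        source, target, Vertex.black.injEq, Vertex.white.injEq, reduceCtorEq, if_false,
        add_left_inj, sub_left_inj, map_zero, sub_zero, zero_sub, zero_mul, mul_zero]
      rcases eq_or_ne i j with rfl | hij
      · simp only [if_true]
        split_ifs <;> simp <;> module
      · simp only [hij, hij.symm, if_false]
        split_ifs <;> simp <;> module
    · simp only [movedFace, hψ, movedWord]
      intro hh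
      rw [hh, (h.isFace _).dTilde_cTilde hB]
  · rw [key 0]
    · simp [letterBracket, halfLetterBracket, verticalWeight]
    · simp only [movedFace, movedWord]
      intro hh
      rw [hh]
      exact (h.isFace _).dTilde_dTilde hB
  · rw [key (
        -(1 / 2 : ℚ) • ((ψ (FreeGroup.of (Side.bottom, i)) : A) ⊗ₜ[ℚ]
          (ψ (FreeGroup.of (Side.right, j)) : A)))]
    · have e : i - 1 + k = j + 1 + k ↔ j = i - 2 := by
        constructor <;> intro hh <;> linear_combination -hh
      simp only [movedFace, e, e₁, e₂, letterBracket, halfLetterBracket, verticalWeight, endDer,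
        source, target, Vertex.black.injEq, Vertex.white.injEq, reduceCtorEq, if_false,
        add_left_inj, sub_left_inj, map_zero, sub_zero, zero_sub, zero_mul, mul_zero]
      rcases eq_or_ne i j with rfl | hij
      · simp only [if_true]
        split_ifs <;> simp <;> module
      · simp only [hij, hij.symm, if_false]
        split_ifs <;> simp <;> module
    · simp only [movedFace, hψ, movedWord]
      intro hh
      rw [hh, (h.isFace _).dTilde_aTilde hB]
  · rw [key 0]
    · simp [letterBracket, halfLetterBracket, verticalWeight]
    · simp only [movedFace, movedWord]
      intro hh
      rw [hh]
      exact (h.isFace _).dTilde_e hB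
  · rw [key 0]
    · simp [letterBracket, halfLetterBracket, verticalWeight]
    · simp only [movedFace, movedWord]
      intro hh
      rw [hh]
      exact (h.isFace _).aTilde_cTilde hB
  · rw [key (
        (1 / 2 : ℚ) • ((ψ (FreeGroup.of (Side.right, i)) : A) ⊗ₜ[ℚ]
          (ψ (FreeGroup.of (Side.bottom, j)) : A)))]
    · have e : i + 1 + k = j - 1 + k ↔ j = i + 2 := by
        constructor <;> intro hh <;> linear_combination -hh
      simp only [movedFace, e, e₁, e₂, letterBracket, halfLetterBracket, verticalWeight, endDer,
        source, target, Vertex.black.injEq, Vertex.white.injEq, reduceCtorEq, if_false,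
        add_left_inj, sub_left_inj, map_zero, sub_zero, zero_sub, zero_mul, mul_zero]
      rcases eq_or_ne i j with rfl | hij
      · simp only [if_true]
        split_ifs <;> simp
      · simp only [hij, hij.symm, if_false]
        split_ifs <;> simp
    · simp only [movedFace, hψ, movedWord]
      intro hh
      rw [hh, (h.isFace _).aTilde_dTilde hB]
  · rw [key 0]
    · simp [letterBracket, halfLetterBracket, verticalWeight]
    · simp only [movedFace, movedWord]
      intro hh
      rw [hh]
      exact (h.isFace _).aTilde_aTilde hB
  · rw [key (
        -(1 / 2 : ℚ) • ((1 : A) ⊗ₜ[ℚ]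
          ((ψ (FreeGroup.of (Side.right, i)) : A) * (ψ (FreeGroup.of (Side.top, j)) : A))))]
    · have e : i + 1 + k = j + k ↔ j = i + 1 := by
        constructor <;> intro hh <;> linear_combination -hh
      simp only [movedFace, e, e₁, e₂, letterBracket, halfLetterBracket, verticalWeight, endDer,
        source, target, Vertex.black.injEq, Vertex.white.injEq, reduceCtorEq, if_false,
        add_left_inj, sub_left_inj, map_zero, sub_zero, zero_sub, zero_mul, mul_zero]
      rcases eq_or_ne i j with rfl | hij
      · simp only [if_true]
        split_ifs <;> simp <;> module
      · simp only [hij, hij.symm, if_false]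
        split_ifs <;> simp
    · simp only [movedFace, hψ, movedWord]
      intro hh
      rw [hh, (h.isFace _).aTilde_e hB]
      simp [mul_assoc]
  · rw [key (
        (1 / 2 : ℚ) • ((1 : A) ⊗ₜ[ℚ]
          ((ψ (FreeGroup.of (Side.top, i)) : A) * (ψ (FreeGroup.of (Side.left, j)) : A))))]
    · have e : i + k = j - 2 + k ↔ j = i + 2 := by
        constructor <;> intro hh <;> linear_combination -hh
      simp only [movedFace, e, e₁, e₂, letterBracket, halfLetterBracket, verticalWeight, endDer,
        source, target, Vertex.black.injEq, Vertex.white.injEq, reduceCtorEq, if_false,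
        add_left_inj, sub_left_inj, map_zero, sub_zero, zero_sub, zero_mul, mul_zero]
      rcases eq_or_ne i j with rfl | hij
      · simp only [if_true]
        split_ifs <;> simp <;> module
      · simp only [hij, hij.symm, if_false]
        split_ifs <;> simp <;> module
    · simp only [movedFace, hψ, movedWord]
      intro hh
      rw [hh, (h.isFace _).e_cTilde hB]
      simp [mul_assoc]
  · rw [key 0]
    · simp [letterBracket, halfLetterBracket, verticalWeight]
    · simp only [movedFace, movedWord]
      intro hh
      rw [hh]
      exact (h.isFace _).e_dTilde hB
  · rw [key (
        (1 / 2 : ℚ) • (((ψ (FreeGroup.of (Side.right, j)) : A) *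
          (ψ (FreeGroup.of (Side.top, i)) : A)) ⊗ₜ[ℚ] (1 : A)))]
    · have e : i + k = j + 1 + k ↔ j = i - 1 := by
        constructor <;> intro hh <;> linear_combination -hh
      simp only [movedFace, e, e₁, e₂, letterBracket, halfLetterBracket, verticalWeight, endDer,
        source, target, Vertex.black.injEq, Vertex.white.injEq, reduceCtorEq, if_false,
        add_left_inj, sub_left_inj, map_zero, sub_zero, zero_sub, zero_mul, mul_zero]
      rcases eq_or_ne i j with rfl | hij
      · simp only [if_true]
        split_ifs <;> simp <;> module
      · simp only [hij, hij.symm, if_false]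
        split_ifs <;> simp <;> module
    · simp only [movedFace, hψ, movedWord]
      intro hh
      rw [hh, (h.isFace _).e_aTilde hB]
      simp [mul_assoc]
  · rw [key 0]
    · simp [letterBracket, halfLetterBracket, verticalWeight]
    · simp only [movedFace, movedWord]
      intro hh
      rw [hh]
      exact (h.isFace _).ee hB

end IsSquareNetwork

/-- The letters before the square moves, together with the elements `e`. -/
def squareUnits (φ : LetterGroup n →* Aˣ) (e : ZMod n → Aˣ) : FreeGroup (SquareLetter n) →* Aˣ :=
  FreeGroup.lift (Sum.elim (fun u => φ (FreeGroup.of u)) e)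

/-- The weights of the sides of the faces after the square moves. -/
def movedUnits (φ : LetterGroup n →* Aˣ) (e : ZMod n → Aˣ) (k : ZMod n) : LetterGroup n →* Aˣ :=
  FreeGroup.lift fun u => squareUnits φ e (movedWord k u)

/-- Square moves preserve the double brackets of the sides, up to products with derivations which
mark the passage through a vertex. -/
theorem IsAlmostPoisson.squareMove [NeZero n] {D : A →ₗ[ℚ] A →ₗ[ℚ] A ⊗[ℚ] A}
    (hD : IsDoubleBracket D) {φ : LetterGroup n →* Aˣ} (hφ : IsAlmostPoisson D φ) {e : ZMod n → Aˣ}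
    (he : ∀ j, (e j : A) = φ (FreeGroup.of (.bottom, j)) + φ (FreeGroup.of (.left, j)) *
      φ (FreeGroup.of (.top, j)) * φ (FreeGroup.of (.right, j))) (k : ZMod n) :
    IsAlmostPoisson D (movedUnits φ e k) := by
  obtain ⟨Θ, Θ', H⟩ := hφ
  set φ₅ := squareUnits φ e with hφ₅
  have hl (u : Letter n) : φ₅ (FreeGroup.of (.inl u)) = φ (FreeGroup.of u) := by
    simp [hφ₅, squareUnits]
  have hr (j : ZMod n) : φ₅ (FreeGroup.of (.inr j)) = e j := by
    simp [hφ₅, squareUnits]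
  let adc (j : ZMod n) : FreeGroup (SquareLetter n) := FreeGroup.of (.inl (.left, j)) *
      FreeGroup.of (.inl (.top, j)) * FreeGroup.of (.inl (.right, j))
  -- The value on the additional letter is forced by e_j = b_j + a_j d_j c_j.
  let ext (θ : Letter n → A ⊗[ℚ] A) : SquareLetter n → A ⊗[ℚ] A :=
    Sum.elim θ fun j => θ (.bottom, j) + outerDer φ θ (FreeGroup.of (.left, j) *
      FreeGroup.of (.top, j) * FreeGroup.of (.right, j))
  have hext (θ : Letter n → A ⊗[ℚ] A) (j : ZMod n) :
      outerDer φ₅ (ext θ) (FreeGroup.of (.inr j)) =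
        outerDer φ₅ (ext θ) (FreeGroup.of (.inl (.bottom, j))) + outerDer φ₅ (ext θ) (adc j) := by
    have h1 := outerDer_isOuterDer φ₅ (ext θ)
    have h2 := outerDer_isOuterDer φ θ
    rw [h1, h1]
    simp only [outerDer_of, ext, Sum.elim_inl, Sum.elim_inr, h2 _ _, hl, map_mul, Units.val_mul]
  -- The path adc runs parallel to b, so ∂_p is given by the same endpoints on both and is
  -- compatible with their sum.
  have hend (p : Vertex n) (j : ZMod n) :
      outerDer φ₅ (endDer squareSource squareTarget φ₅ p) (FreeGroup.of (.inr j)) =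
        outerDer φ₅ (endDer squareSource squareTarget φ₅ p) (FreeGroup.of (.inl (.bottom, j))) +
          outerDer φ₅ (endDer squareSource squareTarget φ₅ p) (adc j) := by
    have hadc : IsPath squareSource squareTarget (source (.bottom, j)) (target (.bottom, j))
        (adc j) :=
      ((IsPath.of (Sum.inl (Side.left, j))).mul (IsPath.of (Sum.inl (Side.top, j)))).mul
        (IsPath.of (Sum.inl (Side.right, j)))
    rw [hadc.outerDer_endDer, outerDer_of, outerDer_of]
    simp only [endDer, squareSource, squareTarget, Sum.elim_inl, Sum.elim_inr, hr, he, hl, adc,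
      map_mul, Units.val_mul, TensorProduct.add_tmul, TensorProduct.tmul_add]
    split_ifs <;> abel
  let E (p : Vertex n) := outerDer φ₅ (endDer squareSource squareTarget φ₅ p)
  let N (g h : FreeGroup (SquareLetter n)) : A ⊗[ℚ] A :=
    ∑ p, (swapMul (E p g) (outerDer φ₅ (ext (Θ p)) h) +
      swapMul (outerDer φ₅ (ext (Θ' p)) g) (E p h))
  have hN : IsDoubleDer φ₅ N := IsDoubleDer.sum Finset.univ fun p =>
    ((outerDer_isOuterDer φ₅ _).swapMul (outerDer_isOuterDer φ₅ _)).add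
      ((outerDer_isOuterDer φ₅ _).swapMul (outerDer_isOuterDer φ₅ _))
  -- Subtracting the corrections `N` from `D` leaves a double derivation with exactly the brackets
  -- of the faces, to which the square move formulas apply.
  have hB : IsSquareNetwork φ₅ fun g h => D (φ₅ g : A) (φ₅ h : A) - N g h := by
    refine ⟨(hD.isDoubleDer φ₅).sub hN, fun j => ?_, fun u v => ?_, fun j g => ?_, fun j g => ?_⟩
    · simp only [hr, hl, he]
    · have hE (p : Vertex n) (u : Letter n) :
          E p (FreeGroup.of (.inl u)) = endDer source target φ p u := by
        simp [E, endDer, squareSource, squareTarget, hl]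
      simp only [N, hE, outerDer_of, ext, Sum.elim_inl, hl, H]
      abel
    · have h1 : (φ₅ (FreeGroup.of (.inr j)) : A) =
          φ₅ (FreeGroup.of (.inl (.bottom, j))) + φ₅ (adc j) := by
        simp [hr, he, hl, adc]
      have h2 : N (FreeGroup.of (.inr j)) g =
          N (FreeGroup.of (.inl (.bottom, j))) g + N (adc j) g := by
        simp only [N, E, hend, hext, map_add, LinearMap.add_apply, ← Finset.sum_add_distrib]
        exact Finset.sum_congr rfl fun p _ => by abel
      simp only [h1, h2, map_add, LinearMap.add_apply]
      abel
    · have h1 : (φ₅ (FreeGroup.of (.inr j)) : A) =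
          φ₅ (FreeGroup.of (.inl (.bottom, j))) + φ₅ (adc j) := by
        simp [hr, he, hl, adc]
      have h2 : N g (FreeGroup.of (.inr j)) =
          N g (FreeGroup.of (.inl (.bottom, j))) + N g (adc j) := by
        simp only [N, E, hend, hext, map_add, LinearMap.add_apply, ← Finset.sum_add_distrib]
        exact Finset.sum_congr rfl fun p _ => by abel
      simp only [h1, h2, map_add, LinearMap.add_apply]
      abel
  have hψ (u : Letter n) : movedUnits φ e k (FreeGroup.of u) = φ₅ (movedWord k u) := by
    simp [movedUnits, hφ₅]
  have hE (p : Vertex n) (u : Letter n) : E (movedVertex k p) (movedWord k u) =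
      endDer source target (movedUnits φ e k) p u := by
    simp only [E, (isPath_movedWord k u).outerDer_endDer, endDer, hψ,
      EmbeddingLike.apply_eq_iff_eq]
  -- The old corrections are transported along `movedVertex`. In the new correction with coefficient
  -- (w(u) − w(v))/2 the part with w(v) is absorbed into the factor depending on `v`, and the part
  -- with w(u) into the factor depending on `u`.
  refine ⟨fun p v => outerDer φ₅ (ext (Θ (movedVertex k p))) (movedWord k v) -
      (IsSquareNetwork.verticalWeight v / 2) • endDer source target (movedUnits φ e k) p v,
    fun p u => outerDer φ₅ (ext (Θ' (movedVertex k p))) (movedWord k u) +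
      (IsSquareNetwork.verticalWeight u / 2) • endDer source target (movedUnits φ e k) p u,
    fun u v => ?_⟩
  have key := hB.movedWord_eq k hψ u v
  simp only [sub_eq_iff_eq_add] at key
  have hN' : N (movedWord k u) (movedWord k v) = ∑ p,
      (swapMul (endDer source target (movedUnits φ e k) p u)
          (outerDer φ₅ (ext (Θ (movedVertex k p))) (movedWord k v)) +
        swapMul (outerDer φ₅ (ext (Θ' (movedVertex k p))) (movedWord k u))
          (endDer source target (movedUnits φ e k) p v)) := by
    simp only [← hE]
    exact ((movedVertex k).sum_comp _).symm
  rw [hψ, hψ, key, hN', add_assoc]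
  congr 1
  rw [Finset.smul_sum, ← Finset.sum_add_distrib]
  refine Finset.sum_congr rfl fun p _ => ?_
  simp only [map_add, map_sub, map_smul, LinearMap.add_apply, LinearMap.smul_apply]
  module

end PentagramNetwork

/-! ### Words in the sides as paths in the original network -/

namespace PentagramNetwork

section LetterPaths

variable (n : ℕ)

/-- The words in the sides, as paths in the network. -/
def letterHom : LetterGroup n →* PathGroup n := FreeGroup.lift (letterPath n)

theorem letterHom_stair (k : ℕ) :
    letterHom n (stair n k) * d n ((k + 1 : ℕ) : ZMod n) = z n (k + 1) := by
  induction k with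
  | zero => simp [stair, z]
  | succ k ih =>
    rw [z, ← ih, stair]
    simp only [letterHom, letterPath, map_mul, FreeGroup.lift_apply_of]

theorem letterHom_treePath_white [NeZero n] (i : ZMod n) :
    letterHom n (treePath (.white i)) = z n (rep i) := by
  have h := letterHom_stair n (i - 1).val
  rw [show (((i - 1).val + 1 : ℕ) : ZMod n) = i by simp] at h
  rw [rep, ← h, treePath, map_mul]
  simp [letterHom, letterPath]

theorem letterHom_word [NeZero n] (x : LoopGen n) : letterHom n (word x) = loopPath n x := by
  cases x with
  | X i =>
    rw [word, map_mul, map_mul, map_inv, letterHom_treePath_white]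
    simp [letterHom, letterPath, loopPath, X, PentagramNetwork.x]
  | Y i =>
    rw [word, map_mul, map_mul, map_inv, letterHom_treePath_white]
    simp [letterHom, letterPath, loopPath, Y, y]
  | Z =>
    obtain ⟨m, rfl⟩ : ∃ m, n = m + 1 := Nat.exists_eq_succ_of_ne_zero (NeZero.ne n)
    rw [word, loopPath, Z, ← letterHom_stair, stair]
    simp only [letterHom, letterPath, map_mul, FreeGroup.lift_apply_of]

end LetterPaths

/-! ### The pentagram map on the free skew field of the edges -/

section EdgeField

variable (n : ℕ)

/-- The weights of the sides in the free skew field on the edges. -/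
def edgeUnits : LetterGroup n →* (EdgeField n)ˣ := (weight n).comp (letterHom n)

theorem edgeUnits_of (u : Letter n) : edgeUnits n (FreeGroup.of u) = weight n (letterPath n u) := by
  simp [edgeUnits, letterHom]

theorem networkBracket_edgeUnits [NeZero n] (u v : Letter n) :
    networkBracket n (edgeUnits n (FreeGroup.of u)) (edgeUnits n (FreeGroup.of v)) =
      letterBracket (fun x => (edgeUnits n (FreeGroup.of x) : EdgeField n)) u v := by
  simp only [edgeUnits_of]
  refine ((networkBracket_isDoubleBracket n).isDoubleDer (weight n)).eval_letterPath
    (fun e f => ?_) u v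
  have h (e : Edge n) : (weight n (FreeGroup.of e) : EdgeField n) = FreeSkewField.var e := by
    rw [weight, FreeGroup.lift_apply_of]
    rfl
  simp only [h]
  exact FreeSkewField.bracket_var _ e f

theorem loops_eq [NeZero n] (f : LoopAlgebra n) :
    loops n f = evalUnits (edgeUnits n) (wordAlg n f) := by
  rw [loops, evalGroupAlgebra_eq_conj (ψ := edgeUnits n) (p := 1)]
  · simp
  · intro x
    simp [edgeUnits, letterHom_word]

theorem loops_loopBracket [NeZero n] (f g : LoopAlgebra n) :
    loops n (loopBracket f g) = singleBracket (networkBracket n) (loops n f) (loops n g) := by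
  simp only [loops_eq]
  exact evalUnits_loopBracket (networkBracket_isDoubleBracket n) (networkBracket_edgeUnits n) f g

theorem edgeUnits_isAlmostPoisson [NeZero n] :
    IsAlmostPoisson (networkBracket n) (edgeUnits n) :=
  ⟨0, 0, fun u v => by simp [networkBracket_edgeUnits]⟩

theorem val_bTilde (i : ZMod n) : (bTilde n i : EdgeField n) =
    edgeUnits n (FreeGroup.of (.bottom, i)) + edgeUnits n (FreeGroup.of (.left, i)) *
      edgeUnits n (FreeGroup.of (.top, i)) * edgeUnits n (FreeGroup.of (.right, i)) := by
  simp only [edgeUnits_of, letterPath]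
  exact IsUnit.unit_spec _

/-- The images of the sides under the pentagram map followed by the shift of the indices by `2`. -/
def pentUnits : LetterGroup n →* (EdgeField n)ˣ := movedUnits (edgeUnits n) (bTilde n) 0

theorem pentUnits_left (i : ZMod n) :
    pentUnits n (FreeGroup.of (.left, i)) = cTilde n (i - 2) := by
  simp [pentUnits, movedUnits, movedWord, squareUnits, edgeUnits_of, letterPath, cTilde]

theorem pentUnits_bottom (i : ZMod n) :
    pentUnits n (FreeGroup.of (.bottom, i)) = dTilde n (i - 1) := by
  simp [pentUnits, movedUnits, movedWord, squareUnits, edgeUnits_of, letterPath, dTilde, aTilde]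

theorem pentUnits_right (i : ZMod n) :
    pentUnits n (FreeGroup.of (.right, i)) = aTilde n (i + 1) := by
  simp [pentUnits, movedUnits, movedWord, squareUnits, edgeUnits_of, letterPath, aTilde]

theorem pentUnits_top (i : ZMod n) : pentUnits n (FreeGroup.of (.top, i)) = bTilde n i := by
  simp [pentUnits, movedUnits, movedWord, squareUnits]

/-- This regroups (ã₁b̃₁)(ã₂b̃₂)⋯ã_{k+1} as ã₁(b̃₁ã₂)(b̃₂ã₃)⋯: the new staircase has top sides b̃_i
and right sides ã_{i+1}. -/
theorem xi_mul_aTilde (k : ℕ) :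
    xi n k * aTilde n ((k + 1 : ℕ) : ZMod n) = aTilde n 1 * pentUnits n (stair n k) := by
  induction k with
  | zero => simp [xi, stair]
  | succ k ih =>
    rw [xi, ih, stair, map_mul, map_mul, pentUnits_top, pentUnits_right, mul_assoc, mul_assoc,
      mul_assoc, Nat.cast_succ (k + 1)]

theorem xi_rep [NeZero n] (i : ZMod n) :
    xi n (rep i) = aTilde n 1 * pentUnits n (treePath (.white i)) := by
  have hi : (((i - 1).val + 1 : ℕ) : ZMod n) = i := by simp
  rw [rep, xi, xi_mul_aTilde, hi, treePath, map_mul, pentUnits_top, mul_assoc]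

/-- Each product ã_i b̃_i equals d_i c_i, so the moved staircase monomial is the old one. At k = n
this accounts for T(Z) = Z. -/
theorem xi_eq (k : ℕ) : xi n k = edgeUnits n (stair n k) := by
  induction k with
  | zero => simp [xi, stair]
  | succ k ih =>
    rw [xi, ih, stair, map_mul, map_mul, edgeUnits_of, edgeUnits_of, aTilde]
    simp [letterPath, mul_assoc]

/-- The shift by two makes the prefix ξ in the image of X_i or Y_i match the tree path to the white
vertex i − 2 that begins the corresponding word, so one conjugating unit ã₁ serves all generators.
-/
theorem shiftedPentGen_eq [NeZero n] (x : LoopGen n) :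
    shiftedPentGen n x = aTilde n 1 * pentUnits n (word x) * (aTilde n 1)⁻¹ := by
  cases x with
  | X i =>
    have e1 : i - 2 + 2 = i := by ring
    have e2 : i - 2 + 1 = i - 1 := by ring
    simp only [shiftedPentGen, pentX, xi_rep, word, map_mul, map_inv, pentUnits_left,
      pentUnits_right, pentUnits_top, e1, e2, sub_add_cancel]
    group
  | Y i =>
    have e1 : i - 2 + 2 = i := by ring
    have e2 : i - 2 + 1 = i - 1 := by ring
    have e3 : i - 2 + 3 = i + 1 := by ring
    simp only [shiftedPentGen, pentY, xi_rep, word, map_mul, map_inv, pentUnits_bottom,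
      pentUnits_right, pentUnits_top, e1, e2, e3, sub_add_cancel]
    group
  | Z =>
    -- For a full turn the last factor is ã_{n+1} = ã₁, so the two sides differ by a conjugation.
    have h := xi_mul_aTilde n n
    rw [Nat.cast_succ, ZMod.natCast_self, zero_add] at h
    rw [word, ← h, mul_inv_cancel_right, xi_eq, shiftedPentGen, edgeUnits, MonoidHom.comp_apply]
    congr 1
    exact (letterHom_word n .Z).symm

theorem inducedBracket_shiftedPent [NeZero n] (f g : LoopAlgebra n) :
    inducedBracket (networkBracket n) (shiftedPent n f) (shiftedPent n g) =
      cyclicClass (shiftedPent n (loopBracket f g)) :=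
  inducedBracket_evalGroupAlgebra (networkBracket_isDoubleBracket n)
    ((edgeUnits_isAlmostPoisson n).squareMove (networkBracket_isDoubleBracket n)
      (val_bTilde n) 0) (shiftedPentGen_eq n) f g

end EdgeField

/-! ### The double bracket on the coordinates after setting Z = 1 -/

section CoordField

variable (n : ℕ)

/-- The weights of the sides in the free skew field on the coordinates. -/
def coordUnits : LetterGroup n →* (CoordField n)ˣ := FreeGroup.lift fun
  | (.left, i) => FreeSkewField.varUnit (Coord.X i)
  | (.bottom, i) => FreeSkewField.varUnit (Coord.Y i)
  | (.right, _) => 1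
  | (.top, _) => 1

theorem coordUnits_eq : coordUnits n = (FreeGroup.lift (collapseGen n)).comp (letterHom n) := by
  ext ⟨k, i⟩ : 1
  cases k <;>
    simp [coordUnits, letterHom, letterPath, a, b, c, d, edge, collapseGen]

theorem coordUnits_left (i : ZMod n) :
    coordUnits n (FreeGroup.of (.left, i)) = FreeSkewField.varUnit (Coord.X i) := by
  simp [coordUnits]

theorem coordUnits_bottom (i : ZMod n) :
    coordUnits n (FreeGroup.of (.bottom, i)) = FreeSkewField.varUnit (Coord.Y i) := by
  simp [coordUnits]

theorem coordUnits_right (i : ZMod n) : coordUnits n (FreeGroup.of (.right, i)) = 1 := by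
  simp [coordUnits]

theorem coordUnits_top (i : ZMod n) : coordUnits n (FreeGroup.of (.top, i)) = 1 := by
  simp [coordUnits]

theorem coordUnits_stair (k : ℕ) : coordUnits n (stair n k) = 1 := by
  induction k with
  | zero => simp [stair]
  | succ k ih => rw [stair, map_mul, map_mul, ih, coordUnits_top, coordUnits_right]; simp

theorem coordUnits_treePath (p : Vertex n) : coordUnits n (treePath p) = 1 := by
  cases p <;> simp [treePath, coordUnits_stair, coordUnits_top]

theorem quotGen_eq (x : LoopGen n) : quotGen n x = coordUnits n (word x) := by
  cases x <;>
    simp [quotGen, word, coordUnits_treePath, coordUnits_stair, coordUnits_left, coordUnits_bottom,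
      coordUnits_right, coordUnits_top]

/-- The generator of the algebra of loops which belongs to a coordinate. -/
def coordGen : Coord n → LoopGen n
  | .X i => .X i
  | .Y i => .Y i

variable [NeZero n]

/-- Both sides are double derivations along `coordUnits`, so it suffices to compare them on sides,
whose brackets are computed in the path algebra and then collapsed. -/
theorem map_pathBracket_letterHom (g h : LetterGroup n) :
    Algebra.TensorProduct.map (collapse n) (collapse n)
      (pathBracket n (MonoidAlgebra.of ℚ _ (letterHom n g))
        (MonoidAlgebra.of ℚ _ (letterHom n h))) = evalSideBracket (coordUnits n) g h := by
  have hD : IsDoubleBracket (pathBracket n) :=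
    groupBracket_isDoubleBracket _ (edgeBracket_skew _)
  have hc (g : PathGroup n) : collapse n (MonoidAlgebra.of ℚ _ g) =
      FreeGroup.lift (collapseGen n) g := evalGroupAlgebra_of _ _
  have hl (u v : Letter n) : pathBracket n (MonoidAlgebra.of ℚ _ (letterPath n u))
      (MonoidAlgebra.of ℚ _ (letterPath n v)) =
        letterBracket (fun x => MonoidAlgebra.of ℚ _ (letterPath n x)) u v :=
    (hD.isDoubleDer (groupUnits (PathGroup n))).eval_letterPath
      (fun e f => groupBracket_of _ e f) u v
  refine IsDoubleDer.ext (φ := coordUnits n) (B := fun g h =>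
    Algebra.TensorProduct.map (collapse n) (collapse n)
      (pathBracket n (MonoidAlgebra.of ℚ _ (letterHom n g))
        (MonoidAlgebra.of ℚ _ (letterHom n h)))) ?_ (evalSideBracket_isDoubleDer (coordUnits n))
    (fun u v => ?_) g h
  · refine hD.isDoubleDer_map (collapse n) ((groupUnits (PathGroup n)).comp (letterHom n))
      (coordUnits n) fun g => ?_
    rw [coordUnits_eq]
    exact hc _
  · have h (u : Letter n) : letterHom n (FreeGroup.of u) = letterPath n u := by simp [letterHom]
    rw [evalSideBracket_of, h, h, hl, map_letterBracket]
    congr 1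
    funext x
    rw [hc, coordUnits_eq, MonoidHom.comp_apply, h]

theorem coordBracket_eq (u v : Coord n) :
    coordBracket n u v =
      evalSideBracket (coordUnits n) (word (coordGen n u)) (word (coordGen n v)) := by
  have h (u : Coord n) : coordPath n u = letterHom n (word (coordGen n u)) := by
    rw [letterHom_word]
    cases u <;> rfl
  rw [← map_pathBracket_letterHom, ← h, ← h]
  rfl

theorem quotBracket_isDoubleBracket : IsDoubleBracket (quotBracket n) :=
  FreeSkewField.bracket_isDoubleBracket _ fun u v => by
    rw [coordBracket_eq, coordBracket_eq, evalSideBracket_skew]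

/-- Sides c and d go to 1 and contribute nothing; on a and b this is the definition of the bracket.
The right side involves based loops instead of sides, a discrepancy which is resolved in
`coordUnits_isAlmostPoisson`. -/
theorem quotBracket_coordUnits (u v : Letter n) :
    quotBracket n (coordUnits n (FreeGroup.of u)) (coordUnits n (FreeGroup.of v)) =
      evalSideBracket (coordUnits n) (wordHom (sideLoop u)) (wordHom (sideLoop v)) := by
  have hD := quotBracket_isDoubleBracket n
  have hR := evalSideBracket_isDoubleDer (coordUnits n)
  have h1 (x : CoordField n) : quotBracket n 1 x = 0 := by
    have h := hD.leibniz_left 1 1 x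
    rw [mul_one, ← Algebra.TensorProduct.one_def, mul_one, one_mul] at h
    simpa using h
  have h2 (x : CoordField n) : quotBracket n x 1 = 0 := by
    rw [hD.skew, h1]; simp
  have hc (x y : Coord n) : quotBracket n (FreeSkewField.varUnit x) (FreeSkewField.varUnit y) =
      evalSideBracket (coordUnits n) (word (coordGen n x)) (word (coordGen n y)) := by
    rw [← coordBracket_eq]
    exact FreeSkewField.bracket_var _ x y
  obtain ⟨k, i⟩ := u
  obtain ⟨l, j⟩ := v
  cases k <;> cases l <;>
    simp [coordUnits_left, coordUnits_bottom, coordUnits_right, coordUnits_top, sideLoop, hc, h1,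
      h2, wordHom, coordGen, hR.one_left, hR.one_right]

end CoordField
end PentagramNetwork

/-! ### The quotient Z = 1 is almost Poisson -/

namespace PentagramNetwork

section CoordBracket

variable {n : ℕ} [NeZero n]

/-- The indicator function of the black vertices. -/
def blackWeight : Vertex n → ℚ
  | .white _ => 0
  | .black _ => 1

theorem sum_smul_endDer (w : Vertex n → ℚ) {A : Type} [Ring A] [Algebra ℚ A]
    (φ : LetterGroup n →* Aˣ) (u : Letter n) :
    ∑ p, w p • endDer source target φ p u =
      w (target u) • ((φ (FreeGroup.of u) : A) ⊗ₜ[ℚ] (1 : A)) -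
        w (source u) • ((1 : A) ⊗ₜ[ℚ] (φ (FreeGroup.of u) : A)) := by
  simp only [endDer, smul_sub, smul_ite, smul_zero, Finset.sum_sub_distrib, Finset.sum_ite_eq,
    Finset.mem_univ, if_true]

theorem evalSideBracket_stair (k : ℕ) (g : LetterGroup n) :
    evalSideBracket (coordUnits n) (stair n k) g = ∑ j ∈ Finset.range k,
      (evalSideBracket (coordUnits n) (FreeGroup.of (.top, ((j + 1 : ℕ) : ZMod n))) g +
        evalSideBracket (coordUnits n) (FreeGroup.of (.right, ((j + 1 : ℕ) : ZMod n))) g) := by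
  have hR := evalSideBracket_isDoubleDer (coordUnits n)
  induction k with
  | zero => simp [stair, hR.one_left]
  | succ k ih =>
    rw [Finset.sum_range_succ, ← ih, stair, hR.left, hR.left]
    simp only [map_mul, coordUnits_stair, coordUnits_top, coordUnits_right, Units.val_one,
      ← Algebra.TensorProduct.one_def, one_mul, mul_one, add_assoc]

theorem sum_range_natCast_succ {M : Type} [AddCommMonoid M] (f : ZMod n → M) :
    ∑ j ∈ Finset.range n, f ((j + 1 : ℕ) : ZMod n) = ∑ i, f i := by
  refine Finset.sum_nbij' (fun j => ((j + 1 : ℕ) : ZMod n)) (fun i => (i - 1).val)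
    (by simp) (fun i _ => by simpa using ZMod.val_lt _) (fun j hj => ?_) (by simp) (by simp)
  simp [ZMod.val_cast_of_lt (Finset.mem_range.1 hj)]

/-- Of the whole staircase only the sides d and c of the face of `u` contribute. After collapse
their brackets with `u` record precisely whether `u` ends or starts at a black vertex. -/
theorem evalSideBracket_stair_of (u : Letter n) :
    evalSideBracket (coordUnits n) (stair n n) (FreeGroup.of u) =
      -(1 / 2 : ℚ) • ∑ p, blackWeight p • endDer source target (coordUnits n) p u := by
  rw [sum_smul_endDer, evalSideBracket_stair, sum_range_natCast_succ fun i =>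
    evalSideBracket (coordUnits n) (FreeGroup.of (.top, i)) (FreeGroup.of u) +
      evalSideBracket (coordUnits n) (FreeGroup.of (.right, i)) (FreeGroup.of u)]
  obtain ⟨k, i⟩ := u
  rw [Finset.sum_eq_single i]
  · cases k <;> simp [evalSideBracket_of, letterBracket, halfLetterBracket, coordUnits_top,
      coordUnits_right, source, target, blackWeight]
  · intro j _ hj
    cases k <;> simp [evalSideBracket_of, letterBracket, halfLetterBracket, hj, hj.symm]
  · simp

theorem evalSideBracket_stair_eq (g : LetterGroup n) :
    evalSideBracket (coordUnits n) (stair n n) g =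
      -(1 / 2 : ℚ) • ∑ p, blackWeight p •
        outerDer (coordUnits n) (endDer source target (coordUnits n) p) g := by
  refine ((evalSideBracket_isDoubleDer (coordUnits n)).outer (stair n n)).ext
    ((IsOuterDer.sum Finset.univ fun p => (outerDer_isOuterDer _ _).smul _).smul _) (fun u => ?_) g
  simp [evalSideBracket_stair_of]

/-- The base point is black, so exactly one of the derivations ∂_p counted by `blackWeight` survives
on a based loop. -/
theorem evalSideBracket_stair_of_isPath {g : LetterGroup n}
    (h : IsPath source target (basePoint n) (basePoint n) g) :
    evalSideBracket (coordUnits n) (stair n n) g = -(1 / 2 : ℚ) •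
      ((coordUnits n g : CoordField n) ⊗ₜ[ℚ] (1 : CoordField n) -
        (1 : CoordField n) ⊗ₜ[ℚ] (coordUnits n g : CoordField n)) := by
  simp only [evalSideBracket_stair_eq, h.outerDer_endDer, smul_sub, smul_ite, smul_zero,
    Finset.sum_sub_distrib, Finset.sum_ite_eq, Finset.mem_univ, if_true, blackWeight, one_smul]

theorem wordHom_sideLoop (u : Letter n) : wordHom (sideLoop u) =
    treePath (source u) * FreeGroup.of u * (treePath (target u))⁻¹ *
      (stair n n ^ winding u)⁻¹ := by
  rw [treePath_conj, mul_inv_cancel_right]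

theorem coordUnits_wordHom_sideLoop (u : Letter n) :
    coordUnits n (wordHom (sideLoop u)) = coordUnits n (FreeGroup.of u) := by
  simp [wordHom_sideLoop, coordUnits_treePath, coordUnits_stair]

theorem evalSideBracket_stair_pow (w : ℕ) (g : LetterGroup n) :
    evalSideBracket (coordUnits n) (stair n n ^ w) g =
      w • evalSideBracket (coordUnits n) (stair n n) g := by
  have hR := evalSideBracket_isDoubleDer (coordUnits n)
  induction w with
  | zero => simp [hR.one_left]
  | succ w ih =>
    rw [pow_succ, hR.left, ih, succ_nsmul]
    simp [coordUnits_stair, ← Algebra.TensorProduct.one_def]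

/-- The Leibniz rule is applied to the loop of `u`, written as the side conjugated by tree paths and
divided by a power of Z. Tree paths and Z evaluate to 1, so their brackets enter additively: those
of the tree paths combine into ∑ ∂_p ⋆ and Z gives the winding term. -/
theorem evalSideBracket_sideLoop_left (u : Letter n) (g : LetterGroup n) :
    evalSideBracket (coordUnits n) (wordHom (sideLoop u)) g =
      evalSideBracket (coordUnits n) (FreeGroup.of u) g -
        ∑ p, swapMul (endDer source target (coordUnits n) p u)
          (evalSideBracket (coordUnits n) (treePath p) g) -
        winding u • swapMul ((coordUnits n (FreeGroup.of u) : CoordField n) ⊗ₜ[ℚ]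
          (1 : CoordField n)) (evalSideBracket (coordUnits n) (stair n n) g) := by
  have hR := evalSideBracket_isDoubleDer (coordUnits n)
  rw [sum_swapMul_endDer_left, wordHom_sideLoop, hR.left, hR.left, hR.left, hR.inv_left,
    hR.inv_left, evalSideBracket_stair_pow, swapMul_tmul_one_left]
  simp only [map_mul, map_inv, map_pow, coordUnits_treePath, coordUnits_stair, one_pow, inv_one,
    Units.val_one, ← Algebra.TensorProduct.one_def, one_mul, mul_one, mul_neg,
    mul_smul_comm]
  abel

theorem evalSideBracket_sideLoop_right (u : Letter n) (g : LetterGroup n) :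
    evalSideBracket (coordUnits n) g (wordHom (sideLoop u)) =
      evalSideBracket (coordUnits n) g (FreeGroup.of u) +
        ∑ p, swapMul (evalSideBracket (coordUnits n) (treePath p) g)
          (endDer source target (coordUnits n) p u) +
        winding u • swapMul (evalSideBracket (coordUnits n) (stair n n) g)
          ((coordUnits n (FreeGroup.of u) : CoordField n) ⊗ₜ[ℚ] (1 : CoordField n)) := by
  rw [evalSideBracket_skew, evalSideBracket_sideLoop_left,
    evalSideBracket_skew _ (FreeGroup.of u) g]
  simp only [map_sub, map_sum, map_nsmul, comm_swapMul]
  abel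

/-- Expanding both based loops around their sides leaves `letterBracket` plus tree path and Z terms.
The former already contain ∂_p. The latter do too, because the bracket with Z is itself a
combination of the ∂_p. -/
theorem coordUnits_isAlmostPoisson : IsAlmostPoisson (quotBracket n) (coordUnits n) := by
  refine ⟨fun p v => -evalSideBracket (coordUnits n) (treePath p) (wordHom (sideLoop v)) -
      (1 / 2 : ℚ) • blackWeight p • winding v •
        ((coordUnits n (FreeGroup.of v) : CoordField n) ⊗ₜ[ℚ] (1 : CoordField n)),
    fun p u => evalSideBracket (coordUnits n) (treePath p) (FreeGroup.of u) +
      (1 / 2 : ℚ) • winding u •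
        ((coordUnits n (FreeGroup.of u) : CoordField n) ⊗ₜ[ℚ] (1 : CoordField n)),
    fun u v => ?_⟩
  -- Expanding the first argument leaves Z paired with the based loop of `v`, and the result is
  -- rewritten as a sum over all vertices; expanding the second leaves Z paired with the side `u`,
  -- and only black vertices occur. Hence `blackWeight` appears in just one of the two witnesses.
  have h1 : ∑ p, endDer source target (coordUnits n) p v =
      (coordUnits n (FreeGroup.of v) : CoordField n) ⊗ₜ[ℚ] (1 : CoordField n) -
        (1 : CoordField n) ⊗ₜ[ℚ] (coordUnits n (FreeGroup.of v) : CoordField n) := by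
    simpa using sum_smul_endDer (fun _ => 1) (coordUnits n) v
  rw [quotBracket_coordUnits, evalSideBracket_sideLoop_left, evalSideBracket_sideLoop_right v,
    evalSideBracket_of, evalSideBracket_stair_of, evalSideBracket_stair_of_isPath
    (isPath_wordHom _), coordUnits_wordHom_sideLoop, ← h1]
  simp only [map_sum, map_add, map_sub, map_neg, map_smul, map_nsmul, LinearMap.add_apply,
    LinearMap.smul_apply, LinearMap.sum_apply, Finset.sum_add_distrib, Finset.sum_sub_distrib,
    Finset.sum_neg_distrib, ← Finset.smul_sum]
  simp only [smul_comm _ (winding v), ← Finset.smul_sum]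
  module

theorem inducedBracket_quot (f g : LoopAlgebra n) :
    inducedBracket (quotBracket n) (quot n f) (quot n g) =
      cyclicClass (quot n (loopBracket f g)) :=
  inducedBracket_evalGroupAlgebra (quotBracket_isDoubleBracket n) coordUnits_isAlmostPoisson
    (p := 1) (fun x => by simp [quotGen_eq]) f g

end CoordBracket

/-! ### The pentagram map on the quotient Z = 1 -/

section QuotPent

variable (n : ℕ)

/-- The images of the sides, with the staircase contracted, under the pentagram map. -/
def quotPentUnits : LetterGroup n →* (CoordField n)ˣ := movedUnits (coordUnits n) (sigma n) 2

theorem quotPentUnits_left (i : ZMod n) : quotPentUnits n (FreeGroup.of (.left, i)) =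
    (sigma n i)⁻¹ * FreeSkewField.varUnit (Coord.X i) := by
  simp [quotPentUnits, movedUnits, movedWord, squareUnits, coordUnits_left, coordUnits_top]

theorem quotPentUnits_bottom (i : ZMod n) : quotPentUnits n (FreeGroup.of (.bottom, i)) =
    (sigma n (i + 1))⁻¹ * FreeSkewField.varUnit (Coord.Y (i + 1)) := by
  have e : i - 1 + 2 = i + 1 := by ring
  simp [quotPentUnits, movedUnits, movedWord, squareUnits, coordUnits_bottom, coordUnits_top,
    coordUnits_right, e]

theorem quotPentUnits_right (i : ZMod n) :
    quotPentUnits n (FreeGroup.of (.right, i)) = (sigma n (i + 3))⁻¹ := by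
  have e : i + 1 + 2 = i + 3 := by ring
  simp [quotPentUnits, movedUnits, movedWord, squareUnits, coordUnits_top, coordUnits_right, e]

theorem quotPentUnits_top (i : ZMod n) :
    quotPentUnits n (FreeGroup.of (.top, i)) = sigma n (i + 2) := by
  simp [quotPentUnits, movedUnits, movedWord, squareUnits]

/-- The product σ₃σ₄⁻¹σ₄σ₅⁻¹⋯ telescopes. For k = n the indices k + 3 and 3 agree in ℤ/n, so Z goes
to 1. -/
theorem quotPentUnits_stair (k : ℕ) :
    quotPentUnits n (stair n k) = sigma n 3 * (sigma n (k + 3))⁻¹ := by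
  induction k with
  | zero => simp [stair]
  | succ k ih =>
    have e : ((k + 1 : ℕ) : ZMod n) + 2 = k + 3 := by push_cast; ring
    rw [stair, map_mul, map_mul, ih, quotPentUnits_top, quotPentUnits_right, e]
    group

theorem quotPentUnits_treePath [NeZero n] (i : ZMod n) :
    quotPentUnits n (treePath (.white i)) = sigma n 3 := by
  have e : i - 1 + 3 = i + 2 := by ring
  rw [treePath, map_mul, quotPentUnits_stair, quotPentUnits_top, ZMod.natCast_zmod_val, e,
    inv_mul_cancel_right]

/-- Every tree path to a white vertex has the weight σ₃, so conjugation by σ₃⁻¹ removes them all.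
The renumbering shift is 2, not 0, because here T is not composed with S²: the left side i must come
from the face i. -/
theorem quotPentGen_eq [NeZero n] (x : LoopGen n) :
    quotPentGen n x = (sigma n 3)⁻¹ * quotPentUnits n (word x) * (sigma n 3)⁻¹⁻¹ := by
  cases x with
  | X i =>
    have e1 : i - 1 + 3 = i + 2 := by ring
    have e2 : i - 1 + 2 = i + 1 := by ring
    have e3 : i - 2 + 3 = i + 1 := by ring
    simp only [quotPentGen, word, map_mul, map_inv, quotPentUnits_treePath, quotPentUnits_left,
      quotPentUnits_right, quotPentUnits_top, e1, e2, e3]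
    group
  | Y i =>
    have e1 : i - 1 + 3 = i + 2 := by ring
    have e2 : i - 1 + 2 = i + 1 := by ring
    have e3 : i - 2 + 3 = i + 1 := by ring
    simp only [quotPentGen, word, map_mul, map_inv, quotPentUnits_treePath, quotPentUnits_bottom,
      quotPentUnits_right, quotPentUnits_top, e1, e2, e3]
    group
  | Z => simp [quotPentGen, word, quotPentUnits_stair]

theorem val_sigma (i : ZMod n) : (sigma n i : CoordField n) =
    coordUnits n (FreeGroup.of (.bottom, i)) + coordUnits n (FreeGroup.of (.left, i)) *
      coordUnits n (FreeGroup.of (.top, i)) * coordUnits n (FreeGroup.of (.right, i)) := by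
  rw [coordUnits_bottom, coordUnits_left, coordUnits_top, coordUnits_right, Units.val_one, mul_one,
    mul_one, add_comm]
  exact map_add (FreeSkewField.ofFree (Coord n)) _ _

theorem inducedBracket_quotPent [NeZero n] (f g : LoopAlgebra n) :
    inducedBracket (quotBracket n) (quotPent n f) (quotPent n g) =
      cyclicClass (quotPent n (loopBracket f g)) :=
  inducedBracket_evalGroupAlgebra (quotBracket_isDoubleBracket n)
    (coordUnits_isAlmostPoisson.squareMove (quotBracket_isDoubleBracket n) (val_sigma n) 2)
    (quotPentGen_eq n) f g

end QuotPent
end PentagramNetwork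

end

theorem theorem12 (n : ℕ) [NeZero n] :
    (∀ f g : PentagramNetwork.LoopAlgebra n, ∃ h : PentagramNetwork.LoopAlgebra n,
      PentagramNetwork.loops n h =
        singleBracket (PentagramNetwork.networkBracket n)
          (PentagramNetwork.loops n f) (PentagramNetwork.loops n g) ∧
      inducedBracket (PentagramNetwork.quotBracket n)
          (PentagramNetwork.quot n f) (PentagramNetwork.quot n g) =
        cyclicClass (PentagramNetwork.quot n h) ∧
      inducedBracket (PentagramNetwork.quotBracket n)
          (PentagramNetwork.quotPent n f) (PentagramNetwork.quotPent n g) =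
        cyclicClass (PentagramNetwork.quotPent n h)) ∧
    (∀ f g : PentagramNetwork.LoopAlgebra n, ∃ h : PentagramNetwork.LoopAlgebra n,
      PentagramNetwork.loops n h =
        singleBracket (PentagramNetwork.networkBracket n)
          (PentagramNetwork.loops n f) (PentagramNetwork.loops n g) ∧
      inducedBracket (PentagramNetwork.networkBracket n)
          (PentagramNetwork.shiftedPent n f) (PentagramNetwork.shiftedPent n g) =
        cyclicClass (PentagramNetwork.shiftedPent n h)) := by
  -- The same element `loopBracket f g` serves in both parts; it depends only on the brackets of the
  -- sides.
  refine ⟨fun f g => ⟨PentagramNetwork.loopBracket f g, PentagramNetwork.loops_loopBracket n f g,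
      PentagramNetwork.inducedBracket_quot f g, PentagramNetwork.inducedBracket_quotPent n f g⟩,
    fun f g => ⟨PentagramNetwork.loopBracket f g, PentagramNetwork.loops_loopBracket n f g,
      PentagramNetwork.inducedBracket_shiftedPent n f g⟩⟩
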